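/- Let $n\ge 3$ and let $\mathcal{C}l_n$ be the real Clifford algebra generated by $e_1,\dots,e_n$ with $e_ie_j+e_je_i=-2\delta_{ij}$, with norm $\|\sum_A a_Ae_A\|^2=\sum_A a_A^2$ and Clifford conjugation $a\mapsto a^\dagger$ (the anti-automorphism with $e_j^\dagger=-e_j$). Identify $x\in\mathbb{R}^{n+1}$ with $x_0+\sum_{j=1}^n x_je_j$, and write $\overline{x}=x_0-\sum_{j=1}^n x_je_j$. Let $\mathbb{S}^n\subset\mathbb{R}^{n+1}$ be the unit sphere with surface measure $dv$, and let $\omega_{n-1}=2\pi^{n/2}/\Gamma(n/2)$. The conjugate spherical Dirac operator is $$\overline{D_s}=\overline{w}\Big(\overline{\Gamma_0}-\frac n2\Big),\qquad \overline{\Gamma_0}=-\sum_{j=1}^n e_j(x_0\partial_{x_j}-x_j\partial_{x_0})-\sum_{1\le i<j\le n}e_ie_j(x_i\partial_{x_j}-x_j\partial_{x_i}),$$ where on $W_2^1(\mathbb{S}^n,\mathcal{C}l_n)$ the tangential derivatives are weak derivatives. Put, for $w\neq v$ in $\mathbb{S}^n$, $$G_s(w,v)=\frac{1}{\omega_{n-1}}\frac{\overline{w-v}}{\|w-v\|^n},\qquad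 H_s(w,v)=-\frac{1}{\omega_{n-1}(n-2)}\frac{1}{\|w-v\|^{n-2}},\qquad G_s^{(3)}(w,v)=-\frac{1}{2\,\omega_{n-1}(n-2)}\frac{\overline{w-v}}{\|w-v\|^{n-2}},$$ $$G^+=G_s+\overline{w}\,H_s-2G_s^{(3)}.$$ For measurable $\Omega\subseteq\mathbb{S}^n$ and $f\in L^2(\Omega,\mathcal{C}l_n)$ let, for $w\in\mathbb{S}^n$, $$T_\Omega f(w)=\int_\Omega G_s(w,v)f(v)\,dv,\quad T^+_\Omega f(w)=\int_\Omega G^+(w,v)f(v)\,dv,\quad \Pi_{s,0}f=(\overline{D_s}+\overline{w})T_\Omega f,\quad \Pi_s^+f=\overline{D_s}T_\Omega^+f .$$ Then the first spherical $\Pi$-type operator $\Pi_{s,0}$ is an $L^2$ isometry up to isomorphism, in the following sense. (1) For every measurable $\Omega\subseteq\mathbb{S}^n$ and all $f,g\in L^2(\Omega,\mathcal{C}l_n)$, the integrals $T_\Omega f(w)$ and $T_\Omega^+g(w)$ converge absolutely for almost every $w\in\mathbb{S}^n$, $T_\Omega f$ and $T_\Omega^+g$ belong to $W_2^1(\mathbb{S}^n,\mathcal{C}l_n)$,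 $\Pi_{s,0}f$ and $\Pi_s^+g$ belong to $L^2(\mathbb{S}^n,\mathcal{C}l_n)$, and $$\langle \Pi_{s,0}f,\Pi_s^+g\rangle=\langle f,g\rangle,\qquad\text{i.e.}\qquad \int_{\mathbb{S}^n}(\Pi_{s,0}f)^\dagger\,\Pi_s^+g\,dw=\int_\Omega f^\dagger g\,dw .$$ (2) For $\Omega=\mathbb{S}^n$, both $\Pi_{s,0}$ and $\Pi_s^+$ are bounded linear isomorphisms of $L^2(\mathbb{S}^n,\mathcal{C}l_n)$ onto itself. -/

import Mathlib

open MeasureTheory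
open scoped ContDiff

/-! ### The real Clifford algebra `Cl_n` with `v ^ 2 = -‖v‖ ^ 2` -/

/-- The quadratic form `v ↦ -(v_1 ^ 2 + ⋯ + v_n ^ 2)` on `ℝ ^ n`. -/
noncomputable abbrev negSq (n : ℕ) : QuadraticForm ℝ (Fin n → ℝ) :=
  QuadraticMap.weightedSumSquares ℝ (fun _ : Fin n => (-1 : ℝ))

/-- The Clifford algebra `Cl_n`, generated by `e_1, …, e_n` with `e_i e_j + e_j e_i = -2 δ_ij`.
Its `star` is Clifford conjugation, the anti-automorphism with `star e_j = -e_j`. -/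
abbrev Cl (n : ℕ) : Type := CliffordAlgebra (negSq n)

/-- The generator `e_j` of `Cl_n`. -/
noncomputable def clGen {n : ℕ} (j : Fin n) : Cl n :=
  CliffordAlgebra.ι (negSq n) (Pi.single j 1)

/-- The basis `e_A`, `A ⊆ {1, …, n}`, of `Cl_n`; see `clBasis_apply`. -/
noncomputable def clBasis (n : ℕ) : Module.Basis (Finset (Fin n)) ℝ (Cl n) :=
  ((Pi.basisFun ℝ (Fin n)).ExteriorAlgebra).map
    (CliffordAlgebra.equivExterior (negSq n)).symm

theorem equivExterior_prod_clGen {n : ℕ} (l : List (Fin n)) (hl : l.Nodup) :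
    CliffordAlgebra.equivExterior (negSq n) ((l.map clGen).prod) =
      (l.map fun j => ExteriorAlgebra.ι ℝ (Pi.single j (1 : ℝ) : Fin n → ℝ)).prod := by
  have polar : ∀ i j : Fin n, i ≠ j →
      QuadraticMap.associated (R := ℝ) (-negSq n) (Pi.single i 1) (Pi.single j 1) = 0 := by
    intro i j hij
    simp [QuadraticMap.associated_apply, QuadraticMap.weightedSumSquares_apply,
      Pi.single_apply, mul_add, Finset.sum_add_distrib, hij, hij.symm]
  have contr : ∀ (i : Fin n) (l : List (Fin n)), i ∉ l →
      CliffordAlgebra.contractLeft (Q := (0 : QuadraticForm ℝ (Fin n → ℝ)))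
        (QuadraticMap.associated (R := ℝ) (-negSq n) (Pi.single i 1))
        ((l.map fun j => ExteriorAlgebra.ι ℝ (Pi.single j (1 : ℝ) : Fin n → ℝ)).prod) = 0 := by
    intro i l
    induction l with
    | nil => intro _; simp
    | cons a l ih =>
      intro h
      rw [List.mem_cons, not_or] at h
      rw [List.map_cons, List.prod_cons]
      refine (CliffordAlgebra.contractLeft_ι_mul _ _ _).trans ?_
      rw [ih h.2, polar i a h.1, zero_smul, mul_zero, sub_zero]
  induction l with
  | nil => simp
  | cons a l ih =>
    rw [List.nodup_cons] at hl
    rw [List.map_cons, List.prod_cons, List.map_cons, List.prod_cons, ← ih hl.2]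
    refine (CliffordAlgebra.changeForm_ι_mul
      CliffordAlgebra.changeForm.associated_neg_proof _ _).trans ?_
    have h := contr a l hl.1
    rw [← ih hl.2] at h
    refine (congrArg _ h).trans ?_
    rw [sub_zero]
    rfl

/-- `e_A = e_{j_1} ⋯ e_{j_r}` for `A = {j_1 < ⋯ < j_r}`. -/
theorem clBasis_apply {n : ℕ} (A : Finset (Fin n)) :
    clBasis n A = ((A.sort (· ≤ ·)).map clGen).prod := by
  rw [clBasis, Module.Basis.map_apply, LinearEquiv.symm_apply_eq,
    equivExterior_prod_clGen _ (Finset.sort_nodup _ _),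
    ExteriorAlgebra.basis_apply_ofCard _ rfl, ExteriorAlgebra.ιMulti_family,
    ExteriorAlgebra.ιMulti_apply]
  congr 1
  apply List.ext_getElem
  · simp
  · intro i h₁ h₂
    simp [Set.powersetCard.ofFinEmbEquiv_symm_apply, Finset.orderEmbOfFin_apply]

/-- Coordinates with respect to the basis `e_A`. -/
noncomputable def clCoord (n : ℕ) : Cl n ≃ₗ[ℝ] EuclideanSpace ℝ (Finset (Fin n)) :=
  (clBasis n).equivFun.trans (WithLp.linearEquiv 2 ℝ (Finset (Fin n) → ℝ)).symm

/-- The norm `‖∑ x_A e_A‖ ^ 2 = ∑ x_A ^ 2`. -/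
noncomputable instance instNormedAddCommGroupCl (n : ℕ) : NormedAddCommGroup (Cl n) :=
  NormedAddCommGroup.induced (Cl n) (EuclideanSpace ℝ (Finset (Fin n))) (clCoord n)
    (clCoord n).injective

noncomputable instance instNormedSpaceCl (n : ℕ) : NormedSpace ℝ (Cl n) :=
  NormedSpace.induced ℝ (Cl n) (EuclideanSpace ℝ (Finset (Fin n))) (clCoord n)

theorem norm_sq_Cl {n : ℕ} (x : Cl n) : ‖x‖ ^ 2 = ∑ A, ((clBasis n).repr x A) ^ 2 := by
  have h : ‖x‖ = ‖clCoord n x‖ := rfl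
  rw [h, EuclideanSpace.norm_sq_eq]
  simp [clCoord]

instance instFiniteDimensionalCl (n : ℕ) : FiniteDimensional ℝ (Cl n) :=
  Module.Basis.finiteDimensional_of_finite (clBasis n)

instance instCompleteSpaceCl (n : ℕ) : CompleteSpace (Cl n) :=
  FiniteDimensional.complete ℝ (Cl n)

/-! ### The sphere and its first-order differential operators -/

/-- `ℝ ^ (n + 1)`, with coordinates `x_0, …, x_n`. -/
abbrev Eu (n : ℕ) : Type := EuclideanSpace ℝ (Fin (n + 1))

/-- The unit sphere `S ^ n` in `ℝ ^ (n + 1)`. -/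
abbrev Sph (n : ℕ) : Type := Metric.sphere (0 : Eu n) 1

/-- The surface measure of `S ^ n`. -/
noncomputable abbrev surf (n : ℕ) : Measure (Sph n) := (volume : Measure (Eu n)).toSphere

/-- The paravector `x_0 + ∑ x_j e_j`; its `star` is `x_0 - ∑ x_j e_j`. -/
noncomputable def para {n : ℕ} (x : Eu n) : Cl n :=
  algebraMap ℝ (Cl n) (x 0) + ∑ j : Fin n, x j.succ • clGen j

/-- `(x_i ∂_j - x_j ∂_i) φ`, a derivative tangential to the sphere. -/
noncomputable def rot {n : ℕ} (i j : Fin (n + 1)) (φ : Eu n → ℝ) (x : Eu n) : ℝ :=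
  x i * fderiv ℝ φ x (EuclideanSpace.single j 1) - x j * fderiv ℝ φ x (EuclideanSpace.single i 1)

/-- `h ∈ L²(S ^ n)` is the weak derivative `(x_i ∂_j - x_j ∂_i) u`. The rotation field
`x_i ∂_j - x_j ∂_i` is skew-adjoint on the sphere; every smooth function on the sphere is the
restriction of a smooth `φ` on `ℝ ^ (n + 1)`. -/
def HasWeakRot {n : ℕ} (i j : Fin (n + 1)) (u h : Sph n → Cl n) : Prop :=
  MemLp h 2 (surf n) ∧ ∀ φ : Eu n → ℝ, ContDiff ℝ ∞ φ →
    ∫ w : Sph n, φ w • h w ∂(surf n) = -∫ w : Sph n, rot i j φ w • u w ∂(surf n)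

/-- The Sobolev space `W_2^1(S ^ n, Cl_n)`. -/
def MemSobolev {n : ℕ} (u : Sph n → Cl n) : Prop :=
  MemLp u 2 (surf n) ∧ ∀ i j : Fin (n + 1), ∃ h, HasWeakRot i j u h

open Classical in
/-- The weak derivative `(x_i ∂_j - x_j ∂_i) u` (zero if there is none); it is unique up to
null sets. -/
noncomputable def weakRot {n : ℕ} (i j : Fin (n + 1)) (u : Sph n → Cl n) : Sph n → Cl n :=
  if h : ∃ v, HasWeakRot i j u v then h.choose else 0

/-- `Γ̄₀ = -∑_j e_j (x_0 ∂_j - x_j ∂_0) - ∑_{i < j} e_i e_j (x_i ∂_j - x_j ∂_i)`. -/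
noncomputable def gammaBar {n : ℕ} (u : Sph n → Cl n) (w : Sph n) : Cl n :=
  -(∑ j : Fin n, clGen j * weakRot 0 j.succ u w)
    - ∑ i : Fin n, ∑ j ∈ Finset.Ioi i, clGen i * clGen j * weakRot i.succ j.succ u w

/-- The conjugate spherical Dirac operator `w̄ (Γ̄₀ - n / 2)`. -/
noncomputable def diracBar {n : ℕ} (u : Sph n → Cl n) (w : Sph n) : Cl n :=
  star (para (w : Eu n)) * (gammaBar u w - ((n : ℝ) / 2) • u w)

/-! ### Kernels, Cauchy-type transforms and the two `Π`-operators -/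

/-- The area `2 π ^ (n / 2) / Γ(n / 2)` of the unit sphere of `ℝ ^ n`. -/
noncomputable def area (n : ℕ) : ℝ := 2 * Real.pi ^ ((n : ℝ) / 2) / Real.Gamma ((n : ℝ) / 2)

/-- The fundamental solution of the spherical Dirac operator. -/
noncomputable def kerG {n : ℕ} (w v : Sph n) : Cl n :=
  ((area n)⁻¹ * (‖(w : Eu n) - (v : Eu n)‖ ^ n)⁻¹) • star (para ((w : Eu n) - (v : Eu n)))

/-- The fundamental solution of the conformal spherical Laplacian (used for `n ≥ 3`). -/
noncomputable def kerH {n : ℕ} (w v : Sph n) : ℝ :=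
  -((area n)⁻¹ * ((n : ℝ) - 2)⁻¹ * (‖(w : Eu n) - (v : Eu n)‖ ^ (n - 2))⁻¹)

/-- The fundamental solution of the third-order operator `(D_s - w) D̄_s (D_s + w)`
(used for `n ≥ 3`). -/
noncomputable def kerG3 {n : ℕ} (w v : Sph n) : Cl n :=
  (-((area n)⁻¹ * (2 * ((n : ℝ) - 2))⁻¹ * (‖(w : Eu n) - (v : Eu n)‖ ^ (n - 2))⁻¹)) •
    star (para ((w : Eu n) - (v : Eu n)))

/-- `G⁺ = G_s + w̄ H_s - 2 G_s⁽³⁾`. -/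
noncomputable def kerPlus {n : ℕ} (w v : Sph n) : Cl n :=
  kerG w v + kerH w v • star (para (w : Eu n)) - (2 : ℝ) • kerG3 w v

/-- `T_Ω f (w) = ∫_Ω G_s(w - v) f(v) dv`. -/
noncomputable def opT {n : ℕ} (Ω : Set (Sph n)) (f : Sph n → Cl n) (w : Sph n) : Cl n :=
  ∫ v in Ω, kerG w v * f v ∂(surf n)

/-- `T_Ω⁺ f (w) = ∫_Ω G⁺(w - v) f(v) dv`. -/
noncomputable def opTPlus {n : ℕ} (Ω : Set (Sph n)) (f : Sph n → Cl n) (w : Sph n) : Cl n :=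
  ∫ v in Ω, kerPlus w v * f v ∂(surf n)

/-- `Π_{s,0} f = (D̄_s + w̄) T_Ω f`. -/
noncomputable def piZero {n : ℕ} (Ω : Set (Sph n)) (f : Sph n → Cl n) (w : Sph n) : Cl n :=
  diracBar (opT Ω f) w + star (para (w : Eu n)) * opT Ω f w

/-- `Π_s⁺ f = D̄_s T_Ω⁺ f`. -/
noncomputable def piPlus {n : ℕ} (Ω : Set (Sph n)) (f : Sph n → Cl n) (w : Sph n) : Cl n :=
  diracBar (opTPlus Ω f) w

/-- The `Cl_n`-valued inner product `⟨u, v⟩ = ∫_Ω u† v`. -/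
noncomputable def clInner {n : ℕ} (Ω : Set (Sph n)) (u v : Sph n → Cl n) : Cl n :=
  ∫ w in Ω, star (u w) * v w ∂(surf n)

open scoped TensorProduct

/-! ### The Clifford algebra as a real inner product space -/

/-! Write `A = Γ₀ - n/2` and `Ā = Γ̄₀ - n/2`, so that the Dirac operator is `w A` and its conjugate
is `w̄ Ā`. Everything rests on three algebraic facts about these operators on Clifford-valued
polynomials restricted to the sphere. Both are symmetric for the `Cl_n`-valued pairing `∫ u† v`.
They are intertwined by the variable, `Ā w = -w A`. They have the same quadratic expression, `Ā² + Ā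
= A² + A`, because both sides are, up to sign and a constant, the scalar Laplacian `∑_{i<j} (x_i ∂_j
- x_j ∂_i)²` of the sphere.

The kernels invert first-order operators: `T (w A u) = u` and `T⁺ (w (A + 1) u) = u` for polynomials
`u` (`opT_opPara_opA`, `opTPlus_opPara_opA_add`). The second rests on the simplification `G⁺(w, v) =
G_s(w, v) + v̄ H_s(w, v)`. Both follow from integration by parts against the regularized kernels
`(‖v - w‖² + ε) ^ p`, as `ε → 0`.

Hence `Π_{s,0}` sends `w A u` to `w̄ (Ā + 1) u`, and `Π_s⁺` sends `w (A + 1) v` to `w̄ Ā v`. Since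
multiplication by a unit paravector preserves the pairing, `⟨w̄ (Ā + 1) u, w̄ Ā v⟩ = ⟨u, (Ā² + Ā) v⟩
= ⟨u, (A² + A) v⟩ = ⟨w A u, w (A + 1) v⟩`, which is the identity on such data (`clForm_opABar_add`).

It remains to pass to all of `L²`. The Laplacian identity gives energy estimates
(`sum_norm_opRot_sq`): `‖u‖` is bounded by twice, and every tangential derivative by three times,
the norm of `A u` or of `(A + 1) u`. These make both operators injective modulo polynomials
vanishing on the sphere. As they preserve degree bounds, they are onto by a dimension count, so the
data `w A u` and `w (A + 1) u` are dense in `L²`. Schur's test bounds the two transforms, the energy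
estimates bound their weak derivatives, and all identities extend by continuity
(`exists_diracBar_clm`, `integral_star_mul_eq_of_denseRange`). A general `Ω` reduces to the sphere
on extending `f` and `g` by zero.

For the isomorphisms, `⟨P f, Q g⟩ = ⟨f, g⟩` bounds `Q` from below. If `Q` also has dense range it is
bijective, and `P` is the inverse of its adjoint (`exists_equiv_of_inner_eq`). For `Q = Π_s⁺`
density follows from the intertwining relation: `w̄ Ā (w u) = -A u`. -/

noncomputable instance instInnerProductSpaceCl (n : ℕ) : InnerProductSpace ℝ (Cl n) :=
  { instNormedSpaceCl n with
    inner := fun a b => inner ℝ (clCoord n a) (clCoord n b)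
    norm_sq_eq_re_inner := fun a => by
      have h : ‖a‖ = ‖clCoord n a‖ := rfl
      rw [h]
      exact norm_sq_eq_re_inner (𝕜 := ℝ) (clCoord n a)
    conj_inner_symm := fun a b => inner_conj_symm (𝕜 := ℝ) (clCoord n a) (clCoord n b)
    add_left := fun a b c => by
      rw [map_add]; exact inner_add_left _ _ _
    smul_left := fun a b r => by
      rw [map_smul]; exact inner_smul_left _ _ _ }

theorem inner_Cl_def {n : ℕ} (a b : Cl n) :
    inner ℝ a b = ∑ A, (clBasis n).repr a A * (clBasis n).repr b A := by
  have h : inner ℝ a b = inner ℝ (clCoord n a) (clCoord n b) := rfl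
  rw [h, PiLp.inner_apply]
  simp [clCoord, mul_comm]

theorem inner_clBasis {n : ℕ} (A B : Finset (Fin n)) :
    inner ℝ (clBasis n A) (clBasis n B) = if A = B then (1 : ℝ) else 0 := by
  classical
  rw [inner_Cl_def]
  simp [Finsupp.single_apply]

theorem clGen_mul_self {n : ℕ} (j : Fin n) : clGen j * clGen j = (-1 : Cl n) := by
  rw [clGen, CliffordAlgebra.ι_sq_scalar]
  simp [QuadraticMap.weightedSumSquares_apply, Pi.single_apply]

theorem clGen_mul_clGen_of_ne {n : ℕ} {i j : Fin n} (h : i ≠ j) :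
    clGen i * clGen j = -(clGen j * clGen i : Cl n) := by
  rw [eq_neg_iff_add_eq_zero, clGen, clGen, CliffordAlgebra.ι_mul_ι_add_swap]
  simp [QuadraticMap.polar, QuadraticMap.weightedSumSquares_apply, Pi.single_apply, mul_add,
    Finset.sum_add_distrib, h, h.symm]

@[simp] theorem star_clGen {n : ℕ} (j : Fin n) : star (clGen j : Cl n) = -clGen j := by
  rw [clGen, CliffordAlgebra.star_ι]

theorem prod_clGen_perm {n : ℕ} {l l' : List (Fin n)} (h : l.Perm l') (hl : l.Nodup) :
    (l.map clGen).prod = ((l'.map clGen).prod : Cl n) ∨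
      (l.map clGen).prod = -((l'.map clGen).prod : Cl n) := by
  induction h with
  | nil => simp
  | cons a _ ih =>
    rcases ih (List.nodup_cons.1 hl).2 with h | h <;> simp [h]
  | swap a b l =>
    right
    have hab : a ≠ b := by
      rintro rfl
      simp at hl
    simp only [List.map_cons, List.prod_cons, ← mul_assoc]
    rw [clGen_mul_clGen_of_ne hab.symm, neg_mul]
  | trans h₁ _ ih₁ ih₂ =>
    rcases ih₁ hl with h | h <;> rcases ih₂ (h₁.nodup_iff.1 hl) with h' | h' <;> simp [h, h']

/-- Moving `e_j` to its sorted position costs only signs, and a repeated `e_j` squares to `-1`; so a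
generator permutes the basis up to sign. -/
theorem clGen_mul_clBasis {n : ℕ} (j : Fin n) (A : Finset (Fin n)) :
    clGen j * clBasis n A = clBasis n (symmDiff {j} A) ∨
      clGen j * clBasis n A = -clBasis n (symmDiff {j} A) := by
  by_cases hj : j ∈ A
  · have hs : symmDiff {j} A = A.erase j := by
      ext i
      by_cases hi : i = j <;> simp [Finset.mem_symmDiff, hi, hj]
    have hp : (A.sort (· ≤ ·)).Perm (j :: (A.erase j).sort (· ≤ ·)) := by
      rw [List.perm_ext_iff_of_nodup (Finset.sort_nodup _ _) (by simp)]
      intro i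
      by_cases hi : i = j <;> simp [hi, hj]
    rw [hs, clBasis_apply, clBasis_apply]
    rcases prod_clGen_perm hp (Finset.sort_nodup _ _) with h | h <;> rw [h] <;>
      simp [← mul_assoc, clGen_mul_self]
  · have hs : symmDiff {j} A = insert j A := by
      ext i
      by_cases hi : i = j <;> simp [Finset.mem_symmDiff, hi, hj]
    have hp : (j :: A.sort (· ≤ ·)).Perm ((insert j A).sort (· ≤ ·)) := by
      rw [List.perm_ext_iff_of_nodup (by simp [hj]) (Finset.sort_nodup _ _)]
      intro i
      simp
    rw [hs, clBasis_apply, clBasis_apply]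
    rcases prod_clGen_perm hp (by simp [hj]) with h | h <;> [left; right] <;> rw [← h] <;> simp

/-- A signed permutation of an orthonormal basis is an isometry. -/
theorem norm_clGen_mul {n : ℕ} (j : Fin n) (a : Cl n) : ‖clGen j * a‖ = ‖a‖ := by
  classical
  let L : Cl n →ₗ[ℝ] Cl n := LinearMap.mulLeft ℝ (clGen j)
  have key : ∀ A B : Finset (Fin n),
      inner ℝ (L (clBasis n A)) (L (clBasis n B)) = inner ℝ (clBasis n A) (clBasis n B) := by
    intro A B
    have hAB : symmDiff {j} A = symmDiff {j} B ↔ A = B := symmDiff_right_inj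
    by_cases h : A = B
    · subst h
      have h1 : ∀ B : Finset (Fin n), ‖clBasis n B‖ ^ 2 = 1 := fun B => by
        rw [← real_inner_self_eq_norm_sq, inner_clBasis, if_pos rfl]
      rcases clGen_mul_clBasis j A with h | h <;> simp [L, h, h1]
    · rcases clGen_mul_clBasis j A with h₁ | h₁ <;> rcases clGen_mul_clBasis j B with h₂ | h₂ <;>
        simp [L, h₁, h₂, inner_clBasis, hAB, h]
  have h2 : inner ℝ (L a) (L a) = inner ℝ a a := by
    conv_rhs => rw [← (clBasis n).sum_repr a]
    conv_lhs => rw [← (clBasis n).sum_repr a]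
    simp only [map_sum, map_smul, sum_inner, inner_sum, inner_smul_left, inner_smul_right, key]
  rw [real_inner_self_eq_norm_sq, real_inner_self_eq_norm_sq] at h2
  exact (sq_eq_sq₀ (norm_nonneg _) (norm_nonneg _)).1 h2

theorem inner_clGen_mul {n : ℕ} (j : Fin n) (a b : Cl n) :
    inner ℝ (clGen j * a) b = -inner ℝ a (clGen j * b) := by
  have h : ∀ x y : Cl n, inner ℝ (clGen j * x) (clGen j * y) = inner ℝ x y := by
    intro x y
    rw [real_inner_eq_norm_add_mul_self_sub_norm_mul_self_sub_norm_mul_self_div_two, ← mul_add,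
      norm_clGen_mul, norm_clGen_mul, norm_clGen_mul,
      ← real_inner_eq_norm_add_mul_self_sub_norm_mul_self_sub_norm_mul_self_div_two]
  have h2 := h a (clGen j * b)
  rw [← mul_assoc, clGen_mul_self, neg_mul, one_mul, inner_neg_right] at h2
  linarith

theorem ι_eq_sum_clGen {n : ℕ} (m : Fin n → ℝ) :
    CliffordAlgebra.ι (negSq n) m = ∑ j, m j • clGen j := by
  conv_lhs => rw [pi_eq_sum_univ' m]
  simp [clGen, map_sum, map_smul, Pi.single]

/-- A generator acts isometrically with square `-1`, so it is skew-adjoint and its adjoint is its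
conjugate. Products and sums follow because both conjugation and adjunction reverse products. -/
theorem inner_mul_left_Cl {n : ℕ} (x a b : Cl n) :
    inner ℝ (x * a) b = inner ℝ a (star x * b) := by
  induction x using CliffordAlgebra.induction generalizing a b with
  | algebraMap r =>
    rw [CliffordAlgebra.star_algebraMap, ← Algebra.smul_def, ← Algebra.smul_def, inner_smul_left,
      inner_smul_right]
    simp
  | ι m =>
    rw [CliffordAlgebra.star_ι, ι_eq_sum_clGen]
    simp only [Finset.sum_mul, sum_inner, inner_sum, smul_mul_assoc, inner_smul_left,
      inner_clGen_mul, neg_mul, inner_neg_right, inner_smul_right]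
    simp
  | mul x y hx hy => rw [mul_assoc, hx, hy, star_mul, mul_assoc]
  | add x y hx hy => rw [add_mul, inner_add_left, hx, hy, star_add, add_mul, inner_add_right]

/-- The scalar part of an element of the Clifford algebra. -/
noncomputable def scalarPart (n : ℕ) : Cl n →L[ℝ] ℝ := innerSL ℝ (1 : Cl n)

theorem scalarPart_star_mul {n : ℕ} (a b : Cl n) : scalarPart n (star a * b) = inner ℝ a b := by
  rw [scalarPart, innerSL_apply_apply, ← inner_mul_left_Cl, mul_one]

theorem norm_one_Cl {n : ℕ} : ‖(1 : Cl n)‖ = 1 := by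
  have h : (1 : Cl n) = clBasis n ∅ := by rw [clBasis_apply]; simp
  have h2 : ‖(1 : Cl n)‖ ^ 2 = 1 := by
    rw [← real_inner_self_eq_norm_sq, h, inner_clBasis]; simp
  exact (pow_eq_one_iff_of_nonneg (norm_nonneg _) two_ne_zero).1 h2

/-- Multiplication of the Clifford algebra as a continuous bilinear map. -/
noncomputable def mulCl (n : ℕ) : Cl n →L[ℝ] Cl n →L[ℝ] Cl n :=
  LinearMap.toContinuousLinearMap
    (LinearMap.toContinuousLinearMap.toLinearMap ∘ₗ LinearMap.mul ℝ (Cl n))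

@[simp] theorem mulCl_apply {n : ℕ} (a b : Cl n) : mulCl n a b = a * b := rfl

/-- Clifford conjugation as a continuous linear map. -/
noncomputable def starCl (n : ℕ) : Cl n →L[ℝ] Cl n :=
  LinearMap.toContinuousLinearMap
    { toFun := star
      map_add' := star_add
      map_smul' := fun r x => CliffordAlgebra.star_smul r x }

@[simp] theorem starCl_apply {n : ℕ} (a : Cl n) : starCl n a = star a := rfl

theorem continuous_mul_Cl {n : ℕ} : Continuous fun p : Cl n × Cl n => p.1 * p.2 :=
  (mulCl n).continuous₂

instance {n : ℕ} : ContinuousMul (Cl n) := ⟨continuous_mul_Cl⟩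
instance {n : ℕ} : ContinuousStar (Cl n) := ⟨(starCl n).continuous⟩

theorem norm_mul_le_Cl {n : ℕ} (a b : Cl n) : ‖a * b‖ ≤ ‖mulCl n‖ * ‖a‖ * ‖b‖ :=
  (mulCl n).le_opNorm₂ a b

theorem norm_star_le_Cl {n : ℕ} (a : Cl n) : ‖star a‖ ≤ ‖starCl n‖ * ‖a‖ :=
  (starCl n).le_opNorm a

/-- The paravector units `e_0 = 1, e_1, …, e_n`. -/
noncomputable def paraUnit {n : ℕ} (μ : Fin (n + 1)) : Cl n :=
  Fin.cons (α := fun _ => Cl n) 1 (fun j => clGen j) μ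

@[simp] theorem paraUnit_zero {n : ℕ} : (paraUnit 0 : Cl n) = 1 := rfl
@[simp] theorem paraUnit_succ {n : ℕ} (j : Fin n) : paraUnit j.succ = clGen j := rfl

/-! ### Paravectors: Clifford relations and invertibility of unit paravectors. -/

theorem para_eq_sum {n : ℕ} (x : Eu n) : para x = ∑ μ, x μ • paraUnit μ := by
  rw [para, Fin.sum_univ_succ]
  simp [Algebra.smul_def]

theorem star_para_eq_sum {n : ℕ} (x : Eu n) : star (para x) = ∑ μ, x μ • star (paraUnit μ) := by
  rw [para_eq_sum, star_sum]
  simp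

theorem paraUnit_mul_star_add {n : ℕ} (μ ν : Fin (n + 1)) :
    paraUnit μ * star (paraUnit ν) + paraUnit ν * star (paraUnit μ) =
      if μ = ν then (2 : Cl n) else 0 := by
  refine Fin.cases ?_ (fun i => ?_) μ <;> refine Fin.cases ?_ (fun j => ?_) ν
  · simp [one_add_one_eq_two]
  · simp [(Fin.succ_ne_zero j).symm]
  · simp
  · by_cases h : i = j
    · subst h
      simp [clGen_mul_self, one_add_one_eq_two]
    · simp [h, clGen_mul_clGen_of_ne h]

theorem star_mul_paraUnit_add {n : ℕ} (μ ν : Fin (n + 1)) :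
    star (paraUnit μ) * paraUnit ν + star (paraUnit ν) * paraUnit μ =
      if μ = ν then (2 : Cl n) else 0 := by
  refine Fin.cases ?_ (fun i => ?_) μ <;> refine Fin.cases ?_ (fun j => ?_) ν
  · simp [one_add_one_eq_two]
  · simp [(Fin.succ_ne_zero j).symm]
  · simp
  · by_cases h : i = j
    · subst h
      simp [clGen_mul_self, one_add_one_eq_two]
    · simp [h, clGen_mul_clGen_of_ne h]

/-- Expanded in paravector units, the off-diagonal terms cancel in pairs. The case `x = y` makes the
conjugate of a unit paravector its inverse. -/
theorem para_mul_star_add {n : ℕ} (x y : Eu n) :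
    para x * star (para y) + para y * star (para x) = algebraMap ℝ (Cl n) (2 * inner ℝ x y) := by
  have h : ∀ a b : Eu n, para a * star (para b) =
      ∑ μ, ∑ ν, (a μ * b ν) • (paraUnit μ * star (paraUnit ν)) := by
    intro a b
    rw [star_para_eq_sum, para_eq_sum, Finset.sum_mul_sum]
    simp [smul_smul, mul_comm]
  rw [h x y, h y x, Finset.sum_comm (f := fun μ ν => (y μ * x ν) • _)]
  simp only [← Finset.sum_add_distrib]
  have : ∀ μ ν : Fin (n + 1), (x μ * y ν) • (paraUnit μ * star (paraUnit ν)) +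
      (y ν * x μ) • (paraUnit ν * star (paraUnit μ)) =
      if μ = ν then algebraMap ℝ (Cl n) (2 * (x μ * y ν)) else 0 := by
    intro μ ν
    rw [mul_comm (y ν), ← smul_add, paraUnit_mul_star_add]
    split_ifs
    · rw [← map_ofNat (algebraMap ℝ (Cl n)) 2, Algebra.smul_def, ← map_mul, mul_comm]
    · rw [smul_zero]
  simp only [this, Finset.sum_ite_eq, Finset.mem_univ, if_true]
  rw [← map_sum, ← Finset.mul_sum, PiLp.inner_apply]
  simp only [RCLike.inner_apply', conj_trivial]

theorem star_para_mul_add {n : ℕ} (x y : Eu n) :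
    star (para x) * para y + star (para y) * para x = algebraMap ℝ (Cl n) (2 * inner ℝ x y) := by
  have h : ∀ a b : Eu n, star (para a) * para b =
      ∑ μ, ∑ ν, (a μ * b ν) • (star (paraUnit μ) * paraUnit ν) := by
    intro a b
    rw [star_para_eq_sum, para_eq_sum, Finset.sum_mul_sum]
    simp [smul_smul, mul_comm]
  rw [h x y, h y x, Finset.sum_comm (f := fun μ ν => (y μ * x ν) • _)]
  simp only [← Finset.sum_add_distrib]
  have : ∀ μ ν : Fin (n + 1), (x μ * y ν) • (star (paraUnit μ) * paraUnit ν) +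
      (y ν * x μ) • (star (paraUnit ν) * paraUnit μ) =
      if μ = ν then algebraMap ℝ (Cl n) (2 * (x μ * y ν)) else 0 := by
    intro μ ν
    rw [mul_comm (y ν), ← smul_add, star_mul_paraUnit_add]
    split_ifs
    · rw [← map_ofNat (algebraMap ℝ (Cl n)) 2, Algebra.smul_def, ← map_mul, mul_comm]
    · rw [smul_zero]
  simp only [this, Finset.sum_ite_eq, Finset.mem_univ, if_true]
  rw [← map_sum, ← Finset.mul_sum, PiLp.inner_apply]
  simp only [RCLike.inner_apply', conj_trivial]

theorem para_mul_star_para {n : ℕ} (w : Sph n) : para (w : Eu n) * star (para (w : Eu n)) = 1 := by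
  have h := para_mul_star_add (w : Eu n) w
  rw [real_inner_self_eq_norm_sq, norm_eq_of_mem_sphere, ← two_smul ℝ (para _ * _)] at h
  have h2 : (2 : ℝ) • (para (w : Eu n) * star (para (w : Eu n))) = (2 : ℝ) • 1 := by
    rw [h, Algebra.smul_def]; simp
  exact smul_right_injective _ two_ne_zero h2

theorem star_para_mul_para {n : ℕ} (w : Sph n) : star (para (w : Eu n)) * para (w : Eu n) = 1 := by
  have h := star_para_mul_add (w : Eu n) w
  rw [real_inner_self_eq_norm_sq, norm_eq_of_mem_sphere, ← two_smul ℝ (star (para _) * _)] at h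
  have h2 : (2 : ℝ) • (star (para (w : Eu n)) * para (w : Eu n)) = (2 : ℝ) • 1 := by
    rw [h, Algebra.smul_def]; simp
  exact smul_right_injective _ two_ne_zero h2

/-- `para` as a continuous linear map. -/
noncomputable def paraL (n : ℕ) : Eu n →L[ℝ] Cl n :=
  LinearMap.toContinuousLinearMap
    { toFun := para
      map_add' := fun x y => by simp [para_eq_sum, add_smul, Finset.sum_add_distrib]
      map_smul' := fun r x => by simp [para_eq_sum, mul_smul, Finset.smul_sum] }

@[simp] theorem paraL_apply {n : ℕ} (x : Eu n) : paraL n x = para x := rfl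

theorem para_sub {n : ℕ} (x y : Eu n) : para (x - y) = para x - para y := (paraL n).map_sub x y

theorem continuous_para {n : ℕ} : Continuous (para : Eu n → Cl n) := (paraL n).continuous

/-! ### Dirac operators in a Weyl–Clifford algebra -/

/-- `x_i` and `d_i` are the generators of a Weyl algebra, and `a_i`, `b_i` are conjugate families of
Clifford units commuting with them. -/
structure WeylClifford {ι R : Type*} [DecidableEq ι] [Ring R] (x d a b : ι → R) : Prop where
  x_comm : ∀ i j, x i * x j = x j * x i
  d_comm : ∀ i j, d i * d j = d j * d i
  d_x : ∀ i j, d i * x j = x j * d i + if i = j then 1 else 0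
  x_a : ∀ i j, x i * a j = a j * x i
  x_b : ∀ i j, x i * b j = b j * x i
  d_a : ∀ i j, d i * a j = a j * d i
  d_b : ∀ i j, d i * b j = b j * d i
  a_b_self : ∀ i, a i * b i = 1
  b_a_self : ∀ i, b i * a i = 1
  a_b : ∀ i j, a i * b j + a j * b i = if i = j then 2 else 0
  b_a : ∀ i j, b i * a j + b j * a i = if i = j then 2 else 0

namespace WeylClifford

variable {ι R : Type*} [DecidableEq ι] [Ring R] {x d a b : ι → R}

theorem swap (h : WeylClifford x d a b) : WeylClifford x d b a :=
  ⟨h.x_comm, h.d_comm, h.d_x, h.x_b, h.x_a, h.d_b, h.d_a, h.b_a_self, h.a_b_self, h.b_a, h.a_b⟩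

variable [Fintype ι]

/-- The Clifford analogue of the canonical commutation relation: each pair `d_i x_i` contributes 1,
which gives the dimension, and the diagonal of the Clifford relation gives twice the Euler operator.
-/
theorem dirac_mul_vec (h : WeylClifford x d a b) :
    (∑ i, b i * d i) * (∑ j, a j * x j) =
      (Fintype.card ι : R) + 2 * (∑ i, x i * d i) - (∑ i, b i * x i) * (∑ j, a j * d j) := by
  have h1 : ∀ i j, b i * d i * (a j * x j) =
      (if i = j then 2 * (x i * d i) + 1 else 0) - b j * x j * (a i * d i) := by
    intro i j
    have e1 : b i * d i * (a j * x j) = b i * a j * (d i * x j) := by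
      rw [mul_assoc, ← mul_assoc (d i), h.d_a, mul_assoc, mul_assoc]
    have e2 : b j * x j * (a i * d i) = b j * a i * (x j * d i) := by
      rw [mul_assoc, ← mul_assoc (x j), h.x_a, mul_assoc, mul_assoc]
    rw [e1, e2, h.d_x, mul_add, eq_sub_of_add_eq (h.b_a i j), sub_mul]
    by_cases hij : i = j
    · subst hij
      simp only [h.b_a_self, if_true, ← one_add_one_eq_two]
      noncomm_ring
    · simp [hij]
  rw [Finset.sum_mul_sum, Finset.sum_mul_sum, Finset.sum_comm (f := fun i j => b i * x i * _),
    Finset.mul_sum]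
  simp only [h1, Finset.sum_sub_distrib, Finset.sum_ite_eq, Finset.mem_univ, if_true,
    Finset.sum_add_distrib]
  simp [add_comm]

/-- The commuting products `y_i y_j` are symmetric while the Clifford coefficients are antisymmetric
off the diagonal. With `y = x` this factors the squared radius, with `y = d` the Laplacian. -/
theorem sum_mul_sum_eq (h : WeylClifford x d a b) {y : ι → R} (hy : ∀ i j, y i * y j = y j * y i)
    (hb : ∀ i j, y i * b j = b j * y i) :
    (∑ i, a i * y i) * (∑ j, b j * y j) = ∑ i, y i * y i := by
  have h1 : ∀ i j, a i * y i * (b j * y j) = a i * b j * (y i * y j) := by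
    intro i j
    rw [mul_assoc, ← mul_assoc (y i), hb, mul_assoc, mul_assoc]
  classical
  have h2 : ∀ i j, i ≠ j → a i * b j * (y i * y j) + a j * b i * (y j * y i) = 0 := by
    intro i j hij
    rw [hy j i, ← add_mul, h.a_b, if_neg hij, zero_mul]
  rw [Finset.sum_mul_sum]
  simp only [h1]
  rw [← Fintype.sum_prod_type' (f := fun i j => a i * b j * (y i * y j)),
    ← Finset.sum_filter_add_sum_filter_not Finset.univ (fun p : ι × ι => p.1 = p.2)]
  have h3 : ∑ p : ι × ι with ¬p.1 = p.2, a p.1 * b p.2 * (y p.1 * y p.2) = 0 := by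
    refine Finset.sum_involution (fun p _ => p.swap) ?_ ?_ ?_ ?_
    · intro p hp
      exact h2 _ _ (Finset.mem_filter.1 hp).2
    · intro p hp _ he
      exact (Finset.mem_filter.1 hp).2 (congrArg Prod.snd he)
    · intro p hp
      simpa [eq_comm] using hp
    · intro p _
      exact p.swap_swap
  rw [h3, add_zero, Finset.sum_filter, Fintype.sum_prod_type]
  simp [h.a_b_self]

theorem euler_mul_vec (h : WeylClifford x d a b) :
    (∑ i, x i * d i) * (∑ j, a j * x j) =
      (∑ j, a j * x j) * (∑ i, x i * d i) + ∑ j, a j * x j := by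
  have h1 : ∀ i j, x i * d i * (a j * x j) =
      a j * x j * (x i * d i) + if i = j then a j * x j else 0 := by
    intro i j
    have e1 : x i * d i * (a j * x j) = a j * (x i * (d i * x j)) := by
      rw [mul_assoc, ← mul_assoc (d i), h.d_a, mul_assoc, ← mul_assoc (x i), h.x_a, mul_assoc]
    rw [e1, h.d_x, mul_add, mul_add, ← mul_assoc (x i), h.x_comm i j]
    by_cases hij : i = j <;> simp [hij, mul_assoc]
  rw [Finset.sum_mul_sum, Finset.sum_mul_sum, Finset.sum_comm (f := fun i j => a i * x i * _)]
  simp only [h1, Finset.sum_add_distrib, Finset.sum_ite_eq, Finset.mem_univ, if_true]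

theorem euler_mul_dirac (h : WeylClifford x d a b) :
    (∑ i, x i * d i) * (∑ j, b j * d j) =
      (∑ j, b j * d j) * (∑ i, x i * d i) - ∑ j, b j * d j := by
  have h1 : ∀ i j, x i * d i * (b j * d j) =
      b j * d j * (x i * d i) - if i = j then b j * d j else 0 := by
    intro i j
    have e1 : x i * d i * (b j * d j) = b j * (x i * (d i * d j)) := by
      rw [mul_assoc, ← mul_assoc (d i), h.d_b, mul_assoc, ← mul_assoc (x i), h.x_b, mul_assoc]
    have e2 : b j * d j * (x i * d i) = b j * ((d j * x i) * d i) := by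
      simp only [mul_assoc]
    rw [e1, e2, h.d_x, h.d_comm i j]
    by_cases hij : i = j
    · subst hij
      simp only [if_true]
      noncomm_ring
    · simp [hij, Ne.symm hij, mul_assoc]
  rw [Finset.sum_mul_sum, Finset.sum_mul_sum, Finset.sum_comm (f := fun i j => b i * d i * _)]
  simp only [h1, Finset.sum_sub_distrib, Finset.sum_ite_eq, Finset.mem_univ, if_true]

variable (x d a b) in
/-- The spherical Dirac operator `(∑ a_i x_i) (∑ b_j d_j) - ∑ x_i d_i`. -/
def gam : R := (∑ i, a i * x i) * (∑ j, b j * d j) - ∑ i, x i * d i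

/-- Substituting the commutation rules of the Dirac and Euler operators with the vector variable
exchanges the two conjugate versions of `gam`; this is the source of the intertwining relation `Ā w
= -w A`. -/
theorem gam_mul_vec (h : WeylClifford x d a b) :
    gam x d b a * (∑ i, b i * x i) =
      (∑ i, b i * x i) * ((Fintype.card ι : R) - 1 - gam x d a b) := by
  have e1 := h.swap.dirac_mul_vec
  have e2 := h.swap.euler_mul_vec
  unfold gam
  rw [sub_mul, mul_assoc, e1, e2]
  noncomm_ring

/-- The point is that the right-hand side no longer contains the Clifford units: both conjugate
versions of `gam` satisfy the same quadratic identity. -/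
theorem gam_sq (h : WeylClifford x d a b) :
    gam x d a b * gam x d a b - ((Fintype.card ι : R) - 2) * gam x d a b =
      -((∑ i, x i * x i) * ∑ i, d i * d i) + (∑ i, x i * d i) * (∑ i, x i * d i) +
        ((Fintype.card ι : R) - 2) * ∑ i, x i * d i := by
  have e1 := h.dirac_mul_vec
  have e2 := h.euler_mul_vec
  have e3 := h.euler_mul_dirac
  have e4 := h.sum_mul_sum_eq h.x_comm h.x_b
  have e5 := h.sum_mul_sum_eq h.d_comm h.d_b
  unfold gam
  set xa := ∑ i, a i * x i
  set xb := ∑ i, b i * x i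
  set Db := ∑ i, b i * d i
  set Da := ∑ i, a i * d i
  set E := ∑ i, x i * d i
  have hN : xa * (Fintype.card ι : R) = (Fintype.card ι : R) * xa :=
    (Nat.cast_commute _ _).symm
  set N := (Fintype.card ι : R)
  have s1 : xa * Db * (xa * Db) = N * (xa * Db) + 2 * (xa * E * Db) - xa * xb * (Da * Db) := by
    rw [mul_assoc, ← mul_assoc Db, e1, sub_mul, mul_sub, add_mul, mul_add, ← mul_assoc xa N, hN]
    noncomm_ring
  have s2 : E * (xa * Db) = xa * E * Db + xa * Db := by
    rw [← mul_assoc, e2, add_mul]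
  have s3 : xa * Db * E = xa * E * Db + xa * Db := by
    rw [mul_assoc xa E, e3]; noncomm_ring
  rw [sub_mul, mul_sub, mul_sub, s1, s2, s3, e4, e5]
  noncomm_ring

/-- This exhibits `gam` as a combination of rotation fields, hence tangential to spheres. The factor
2 comes from counting every pair of indices in both orders. -/
theorem sum_gam (h : WeylClifford x d a b) :
    ∑ i, ∑ j, a i * b j * (x i * d j - x j * d i) = 2 * gam x d a b := by
  have h1 : ∀ i j, a i * b j * (x i * d j - x j * d i) =
      (a i * x i * (b j * d j) + a j * x j * (b i * d i)) -
        if i = j then 2 * (x i * d i) else 0 := by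
    intro i j
    have e1 : ∀ i j, a i * x i * (b j * d j) = a i * b j * (x i * d j) := by
      intro i j
      rw [mul_assoc, ← mul_assoc (x i), h.x_b, mul_assoc, mul_assoc]
    rw [e1, e1, mul_sub, eq_sub_of_add_eq' (h.a_b i j), sub_mul]
    by_cases hij : i = j
    · subst hij
      simp only [if_true]
      noncomm_ring
    · rw [if_neg hij, if_neg hij]
      noncomm_ring
  simp only [h1, Finset.sum_sub_distrib, Finset.sum_add_distrib, Finset.sum_ite_eq,
    Finset.mem_univ, if_true]
  rw [Finset.sum_comm (f := fun i j => a j * x j * (b i * d i)), ← Finset.sum_mul_sum,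
    ← Finset.mul_sum, gam]
  noncomm_ring

/-- The Casimir operator of the rotation group, in terms of radius, Laplacian and Euler operator;
comparison with `gam_sq` turns it into a polynomial in `gam`. -/
theorem sum_rot_sq (h : WeylClifford x d a b) :
    ∑ i, ∑ j, (x i * d j - x j * d i) * (x i * d j - x j * d i) =
      2 * ((∑ i, x i * x i) * (∑ i, d i * d i) - (∑ i, x i * d i) * (∑ i, x i * d i) -
        ((Fintype.card ι : R) - 2) * ∑ i, x i * d i) := by
  have c1 : ∀ i j, x i * d j * (x i * d j) =
      x i * x i * (d j * d j) + if i = j then x i * d i else 0 := by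
    intro i j
    rw [mul_assoc, ← mul_assoc (d j), h.d_x, add_mul, mul_add, mul_assoc (x i) (d j),
      ← mul_assoc (x i) (x i)]
    by_cases hij : i = j
    · subst hij; simp
    · simp [hij, Ne.symm hij]
  have c2 : ∀ i j, x i * d j * (x j * d i) =
      x i * d i * (x j * d j) - (if i = j then x i * d i else 0) + x i * d i := by
    intro i j
    have e1 : x i * d i * (x j * d j) = x i * x j * (d i * d j) + if i = j then x i * d i else 0 := by
      rw [mul_assoc, ← mul_assoc (d i), h.d_x, add_mul, mul_add, mul_assoc (x j) (d i),
        ← mul_assoc (x i) (x j)]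
      by_cases hij : i = j
      · subst hij; simp
      · simp [hij]
    have e2 : x i * d j * (x j * d i) = x i * x j * (d j * d i) + x i * d i := by
      rw [mul_assoc, ← mul_assoc (d j), h.d_x, if_pos rfl, add_mul, mul_add, mul_assoc (x j) (d j),
        ← mul_assoc (x i) (x j), one_mul]
    rw [e1, e2, h.d_comm j i]
    abel
  have h1 : ∀ i j, (x i * d j - x j * d i) * (x i * d j - x j * d i) =
      (x i * d j * (x i * d j) + x j * d i * (x j * d i)) -
        (x i * d j * (x j * d i) + x j * d i * (x i * d j)) := by
    intro i j
    noncomm_ring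
  simp only [h1, Finset.sum_sub_distrib, Finset.sum_add_distrib]
  rw [Finset.sum_comm (f := fun i j => x j * d i * (x j * d i)),
    Finset.sum_comm (f := fun i j => x j * d i * (x i * d j))]
  simp only [c1, c2, Finset.sum_sub_distrib, Finset.sum_add_distrib, Finset.sum_ite_eq,
    Finset.mem_univ, if_true]
  rw [← Finset.sum_mul_sum, ← Finset.sum_mul_sum]
  simp only [Finset.sum_const, Finset.card_univ, nsmul_eq_mul]
  rw [← Finset.mul_sum]
  noncomm_ring

theorem gam_mul_vec_of_card (h : WeylClifford x d a b) {m : ℕ} (hm : Fintype.card ι = m + 1) :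
    gam x d b a * (∑ i, b i * x i) = (∑ i, b i * x i) * (m - gam x d a b) := by
  rw [h.gam_mul_vec, hm, Nat.cast_add, Nat.cast_one, add_sub_cancel_right]

theorem sum_rot_sq_of_card (h : WeylClifford x d a b) {m : ℕ} (hm : Fintype.card ι = m + 1) :
    ∑ i, ∑ j, (x i * d j - x j * d i) * (x i * d j - x j * d i) =
      2 * (((m : R) - 1) * gam x d a b - gam x d a b * gam x d a b) := by
  have e : (Fintype.card ι : R) - 2 = m - 1 := by
    rw [hm, Nat.cast_add, Nat.cast_one, ← one_add_one_eq_two]; abel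
  have h1 := h.gam_sq
  rw [h.sum_rot_sq]
  rw [e] at h1 ⊢
  congr 1
  rw [← neg_sub (gam x d a b * gam x d a b), h1]
  noncomm_ring

end WeylClifford

/-! ### Clifford-valued polynomials -/

/-- Polynomials on `ℝ ^ (n + 1)` with coefficients in the Clifford algebra. -/
abbrev ClPoly (n : ℕ) : Type := MvPolynomial (Fin (n + 1)) ℝ ⊗[ℝ] Cl n

namespace ClPoly

variable {n : ℕ}

/-- Multiplication by a coordinate. -/
noncomputable def opX (μ : Fin (n + 1)) : Module.End ℝ (ClPoly n) :=
  Module.End.rTensorAlgHom ℝ _ (Cl n) (LinearMap.mulLeft ℝ (MvPolynomial.X μ))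

/-- A partial derivative. -/
noncomputable def opD (μ : Fin (n + 1)) : Module.End ℝ (ClPoly n) :=
  Module.End.rTensorAlgHom ℝ _ (Cl n) (MvPolynomial.pderiv μ).toLinearMap

/-- Left multiplication by an element of the Clifford algebra. -/
noncomputable def opC (a : Cl n) : Module.End ℝ (ClPoly n) :=
  Module.End.lTensorAlgHom ℝ _ (MvPolynomial (Fin (n + 1)) ℝ) (LinearMap.mulLeft ℝ a)

@[simp] theorem opX_tmul (μ : Fin (n + 1)) (p : MvPolynomial (Fin (n + 1)) ℝ) (a : Cl n) :
    opX μ (p ⊗ₜ[ℝ] a) = (MvPolynomial.X μ * p) ⊗ₜ[ℝ] a := rfl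

@[simp] theorem opD_tmul (μ : Fin (n + 1)) (p : MvPolynomial (Fin (n + 1)) ℝ) (a : Cl n) :
    opD μ (p ⊗ₜ[ℝ] a) = (MvPolynomial.pderiv μ p) ⊗ₜ[ℝ] a := rfl

@[simp] theorem opC_tmul (b : Cl n) (p : MvPolynomial (Fin (n + 1)) ℝ) (a : Cl n) :
    opC b (p ⊗ₜ[ℝ] a) = p ⊗ₜ[ℝ] (b * a) := rfl

theorem opC_mul (a b : Cl n) : opC (a * b) = opC a * opC b :=
  TensorProduct.ext' fun p c => by simp [mul_assoc]

theorem opC_one : opC (1 : Cl n) = 1 :=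
  TensorProduct.ext' fun p c => by simp

theorem opC_add (a b : Cl n) : opC (a + b) = opC a + opC b :=
  TensorProduct.ext' fun p c => by simp [add_mul, TensorProduct.tmul_add]

theorem pderiv_comm (i j : Fin (n + 1)) (p : MvPolynomial (Fin (n + 1)) ℝ) :
    MvPolynomial.pderiv i (MvPolynomial.pderiv j p) =
      MvPolynomial.pderiv j (MvPolynomial.pderiv i p) := by
  induction p using MvPolynomial.induction_on with
  | C a => simp
  | add p q hp hq => simp [hp, hq]
  | mul_X p k hp =>
    by_cases h₁ : i = k <;> by_cases h₂ : j = k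
    · rw [h₁, h₂]
    · subst h₁
      simp [Derivation.leibniz, MvPolynomial.pderiv_X, hp, h₂, add_comm]
    · subst h₂
      simp [Derivation.leibniz, MvPolynomial.pderiv_X, hp, h₁, add_comm]
    · simp [Derivation.leibniz, MvPolynomial.pderiv_X, hp, h₁, h₂]

/-- Coordinates and derivatives act on the polynomial factor, Clifford units on the other tensor
factor, so all mixed commutation relations are automatic. -/
theorem weylClifford : WeylClifford (opX : Fin (n + 1) → Module.End ℝ (ClPoly n)) opD
    (fun μ => opC (star (paraUnit μ))) (fun μ => opC (paraUnit μ)) where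
  x_comm i j := TensorProduct.ext' fun p c => by simp [mul_left_comm]
  d_comm i j := TensorProduct.ext' fun p c => by simp [pderiv_comm i j]
  d_x i j := TensorProduct.ext' fun p c => by
    by_cases h : i = j
    · subst h
      simp [Derivation.leibniz, TensorProduct.add_tmul]
    · simp [Derivation.leibniz, h, MvPolynomial.pderiv_X, Ne.symm h]
  x_a i j := TensorProduct.ext' fun p c => by simp
  x_b i j := TensorProduct.ext' fun p c => by simp
  d_a i j := TensorProduct.ext' fun p c => by simp
  d_b i j := TensorProduct.ext' fun p c => by simp
  a_b_self i := by
    rw [← opC_mul, ← opC_one]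
    congr 1
    refine Fin.cases ?_ (fun j => ?_) i <;> simp [clGen_mul_self]
  b_a_self i := by
    rw [← opC_mul, ← opC_one]
    congr 1
    refine Fin.cases ?_ (fun j => ?_) i <;> simp [clGen_mul_self]
  a_b i j := by
    rw [← opC_mul, ← opC_mul, ← opC_add, star_mul_paraUnit_add]
    split_ifs
    · rw [← one_add_one_eq_two, opC_add, opC_one, one_add_one_eq_two]
    · exact TensorProduct.ext' fun p c => by simp
  b_a i j := by
    rw [← opC_mul, ← opC_mul, ← opC_add, paraUnit_mul_star_add]
    split_ifs
    · rw [← one_add_one_eq_two, opC_add, opC_one, one_add_one_eq_two]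
    · exact TensorProduct.ext' fun p c => by simp

/-- The rotation field `x_i ∂_j - x_j ∂_i`. -/
noncomputable def opRot (i j : Fin (n + 1)) : Module.End ℝ (ClPoly n) :=
  opX i * opD j - opX j * opD i

/-- Left multiplication by the paravector variable. -/
noncomputable def opPara : Module.End ℝ (ClPoly n) := ∑ μ, opC (paraUnit μ) * opX μ

/-- Left multiplication by the conjugate paravector variable. -/
noncomputable def opParaStar : Module.End ℝ (ClPoly n) := ∑ μ, opC (star (paraUnit μ)) * opX μ

/-- The operator `Γ₀`. -/
noncomputable def opGam : Module.End ℝ (ClPoly n) :=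
  WeylClifford.gam opX opD (fun μ => opC (star (paraUnit μ))) (fun μ => opC (paraUnit μ))

/-- The operator `Γ̄₀`. -/
noncomputable def opGamBar : Module.End ℝ (ClPoly n) :=
  WeylClifford.gam opX opD (fun μ => opC (paraUnit μ)) (fun μ => opC (star (paraUnit μ)))

theorem opGamBar_opPara (u : ClPoly n) :
    opGamBar (opPara u) = opPara ((n : ℝ) • u - opGam u) := by
  have h := LinearMap.congr_fun
    (weylClifford (n := n).gam_mul_vec_of_card (Fintype.card_fin _)) u
  refine h.trans (congrArg (opPara : Module.End ℝ (ClPoly n)) ?_)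
  rw [Nat.cast_smul_eq_nsmul]
  rfl

theorem sum_opRot_opRot (u : ClPoly n) : ∑ i, ∑ j, opRot i j (opRot i j u) =
    (2 : ℝ) • (((n : ℝ) - 1) • opGam u - opGam (opGam u)) := by
  have h := LinearMap.congr_fun
    (weylClifford (n := n).sum_rot_sq_of_card (Fintype.card_fin _)) u
  simp only [LinearMap.sum_apply] at h
  have e : ((n : ℝ) - 1) • opGam u = n • opGam u - opGam u := by module
  refine h.trans ?_
  rw [e, two_smul, ← two_nsmul]
  rfl

theorem sum_opRot_opRot' (u : ClPoly n) : ∑ i, ∑ j, opRot i j (opRot i j u) =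
    (2 : ℝ) • (((n : ℝ) - 1) • opGamBar u - opGamBar (opGamBar u)) := by
  have h := LinearMap.congr_fun
    (weylClifford (n := n).swap.sum_rot_sq_of_card (Fintype.card_fin _)) u
  simp only [LinearMap.sum_apply] at h
  have e : ((n : ℝ) - 1) • opGamBar u = n • opGamBar u - opGamBar u := by module
  refine h.trans ?_
  rw [e, two_smul, ← two_nsmul]
  rfl

theorem two_smul_opGam (u : ClPoly n) : (2 : ℝ) • opGam u =
    ∑ i, ∑ j, opC (star (paraUnit i) * paraUnit j) (opRot i j u) := by
  have h := LinearMap.congr_fun (weylClifford (n := n).sum_gam) u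
  simp only [LinearMap.sum_apply] at h
  simp only [opC_mul]
  rw [two_smul, ← two_nsmul]
  exact h.symm

theorem two_smul_opGamBar (u : ClPoly n) : (2 : ℝ) • opGamBar u =
    ∑ i, ∑ j, opC (paraUnit i * star (paraUnit j)) (opRot i j u) := by
  have h := LinearMap.congr_fun (weylClifford (n := n).swap.sum_gam) u
  simp only [LinearMap.sum_apply] at h
  simp only [opC_mul]
  rw [two_smul, ← two_nsmul]
  exact h.symm

/-- Evaluation of a Clifford-valued polynomial at a point. -/
noncomputable def ev (x : Eu n) : ClPoly n →ₗ[ℝ] Cl n :=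
  TensorProduct.lift
    ((LinearMap.lsmul ℝ (Cl n)).comp (MvPolynomial.aeval (fun i => x i)).toLinearMap)

@[simp] theorem ev_tmul (x : Eu n) (p : MvPolynomial (Fin (n + 1)) ℝ) (a : Cl n) :
    ev x (p ⊗ₜ[ℝ] a) = MvPolynomial.aeval (fun i => x i) p • a := rfl

theorem ev_opX (x : Eu n) (μ : Fin (n + 1)) (u : ClPoly n) : ev x (opX μ u) = x μ • ev x u := by
  have : ev x ∘ₗ opX μ = x μ • ev x := TensorProduct.ext' fun p c => by simp [mul_smul]
  exact LinearMap.congr_fun this u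

theorem ev_opC (x : Eu n) (b : Cl n) (u : ClPoly n) : ev x (opC b u) = b * ev x u := by
  have : ev x ∘ₗ opC b = LinearMap.mulLeft ℝ b ∘ₗ ev x :=
    TensorProduct.ext' fun p c => by simp
  exact LinearMap.congr_fun this u

theorem ev_opPara (x : Eu n) (u : ClPoly n) : ev x (opPara u) = para x * ev x u := by
  rw [opPara, LinearMap.sum_apply, map_sum, para_eq_sum, Finset.sum_mul]
  simp [ev_opC, ev_opX]

theorem ev_opParaStar (x : Eu n) (u : ClPoly n) :
    ev x (opParaStar u) = star (para x) * ev x u := by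
  rw [opParaStar, LinearMap.sum_apply, map_sum, star_para_eq_sum, Finset.sum_mul]
  simp [ev_opC, ev_opX]

/-! ### Formal derivatives of polynomials agree with analytic ones. -/

theorem contDiff_aeval (p : MvPolynomial (Fin (n + 1)) ℝ) :
    ContDiff ℝ ∞ fun x : Eu n => MvPolynomial.aeval (fun i => x i) p := by
  induction p using MvPolynomial.induction_on with
  | C a => simpa using contDiff_const
  | add p q hp hq => simpa using hp.add hq
  | mul_X p i hp =>
    simp only [map_mul, MvPolynomial.aeval_X]
    exact hp.mul (EuclideanSpace.proj (𝕜 := ℝ) i).contDiff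

theorem fderiv_aeval (p : MvPolynomial (Fin (n + 1)) ℝ) (x : Eu n) (μ : Fin (n + 1)) :
    fderiv ℝ (fun x : Eu n => MvPolynomial.aeval (fun i => x i) p) x (EuclideanSpace.single μ 1) =
      MvPolynomial.aeval (fun i => x i) (MvPolynomial.pderiv μ p) := by
  have hd : ∀ q : MvPolynomial (Fin (n + 1)) ℝ,
      DifferentiableAt ℝ (fun x : Eu n => MvPolynomial.aeval (fun i => x i) q) x := fun q =>
    (contDiff_aeval q).differentiable (by simp) x
  induction p using MvPolynomial.induction_on with
  | C a => simp
  | add p q hp hq =>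
    simp only [map_add]
    rw [fderiv_fun_add (hd p) (hd q), add_apply, hp, hq]
  | mul_X p i hp =>
    have hX : HasFDerivAt (fun x : Eu n => x i) (EuclideanSpace.proj (𝕜 := ℝ) i : Eu n →L[ℝ] ℝ) x :=
      (EuclideanSpace.proj (𝕜 := ℝ) i : Eu n →L[ℝ] ℝ).hasFDerivAt
    simp only [map_mul, MvPolynomial.aeval_X]
    rw [fderiv_fun_mul (hd p) hX.differentiableAt, hX.fderiv]
    simp only [add_apply, smul_apply, hp]
    by_cases h : i = μ
    · subst h
      simp [Derivation.leibniz]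
    · simp [Derivation.leibniz, MvPolynomial.pderiv_X, h]

theorem contDiff_ev (u : ClPoly n) : ContDiff ℝ ∞ fun x : Eu n => ev x u := by
  induction u using TensorProduct.induction_on with
  | zero => simpa using contDiff_const
  | tmul p a => exact (contDiff_aeval p).smul contDiff_const
  | add u v hu hv => simpa using hu.add hv

theorem fderiv_ev (u : ClPoly n) (x : Eu n) (μ : Fin (n + 1)) :
    fderiv ℝ (fun x : Eu n => ev x u) x (EuclideanSpace.single μ 1) = ev x (opD μ u) := by
  have hd : ∀ u : ClPoly n, DifferentiableAt ℝ (fun x : Eu n => ev x u) x := fun u =>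
    (contDiff_ev u).differentiable (by simp) x
  induction u using TensorProduct.induction_on with
  | zero => simp
  | tmul p a =>
    simp only [ev_tmul, opD_tmul]
    rw [fderiv_smul_const ((contDiff_aeval p).differentiable (by simp) x)]
    rw [ContinuousLinearMap.smulRight_apply, fderiv_aeval]
  | add u v hu hv =>
    simp only [map_add]
    rw [fderiv_fun_add (hd u) (hd v), add_apply, hu, hv]

theorem opRot_self (i : Fin (n + 1)) : (opRot i i : Module.End ℝ (ClPoly n)) = 0 :=
  LinearMap.ext fun u => by simp [opRot]

theorem opRot_swap (i j : Fin (n + 1)) : (opRot j i : Module.End ℝ (ClPoly n)) = -opRot i j :=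
  LinearMap.ext fun u => by simp [opRot]

theorem sum_eq_two_mul_sum_Ioi {V : Type*} [AddCommGroup V] {m : ℕ} (S : Fin m → Fin m → V)
    (hS : ∀ i j, S i j = S j i) (h0 : ∀ i, S i i = 0) :
    ∑ i, ∑ j, S i j = 2 • ∑ i, ∑ j ∈ Finset.Ioi i, S i j := by
  have h1 : ∀ i, ∑ j, S i j = ∑ j ∈ Finset.Iio i, S i j + ∑ j ∈ Finset.Ioi i, S i j := by
    intro i
    have : (Finset.univ : Finset (Fin m)) = (Finset.Iio i ∪ Finset.Ioi i) ∪ {i} := by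
      ext j
      rcases lt_trichotomy i j with h | h | h <;> simp [h, h.le]
    rw [this, Finset.sum_union, Finset.sum_union]
    · simp [h0]
    · rw [Finset.disjoint_left]
      intro j hj hj'
      exact lt_asymm (Finset.mem_Iio.1 hj) (Finset.mem_Ioi.1 hj')
    · simp
  have h2 : ∑ i, ∑ j ∈ Finset.Iio i, S i j = ∑ i, ∑ j ∈ Finset.Ioi i, S i j := by
    rw [Finset.sum_comm' (t' := Finset.univ) (s' := fun j => Finset.Ioi j) (by simp)]
    exact Finset.sum_congr rfl fun i _ => Finset.sum_congr rfl fun j _ => hS j i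
  simp only [h1, Finset.sum_add_distrib, h2, two_smul]

/-- This matches the Weyl algebra operator with the formula that defines `gammaBar`. Each summand of
the symmetric double sum is invariant under exchanging the indices, both factors changing sign, so
each pair `i < j` occurs twice. -/
theorem ev_opGamBar (x : Eu n) (u : ClPoly n) : ev x (opGamBar u) =
    -(∑ j : Fin n, clGen j * ev x (opRot 0 j.succ u)) -
      ∑ i : Fin n, ∑ j ∈ Finset.Ioi i, clGen i * clGen j * ev x (opRot i.succ j.succ u) := by
  have h : (2 : ℝ) • ev x (opGamBar u) =
      ∑ i, ∑ j, paraUnit i * star (paraUnit j) * ev x (opRot i j u) := by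
    rw [← map_smul, two_smul_opGamBar]
    simp only [map_sum, ev_opC]
  have h2 := sum_eq_two_mul_sum_Ioi
    (fun i j : Fin n => clGen i * clGen j * ev x (opRot i.succ j.succ u))
    (fun i j => by
      by_cases hij : i = j
      · rw [hij]
      · rw [opRot_swap j.succ i.succ, clGen_mul_clGen_of_ne hij]; simp)
    (fun i => by simp [opRot_self])
  refine smul_right_injective (Cl n) (two_ne_zero (α := ℝ)) ?_
  simp only
  rw [h, Fin.sum_univ_succ, Fin.sum_univ_succ, smul_sub, two_smul ℝ (Finset.sum _ _), ← two_nsmul, ← h2]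
  simp only [Fin.sum_univ_succ (fun j => paraUnit (Fin.succ _) * star (paraUnit j) * _)]
  simp only [Finset.sum_add_distrib, opRot_self, opRot_swap 0 (Fin.succ _)]
  simp [two_smul]
  abel

end ClPoly

/-! ### Rotation invariance of the surface measure -/

/-- The action of a linear isometry on the sphere. -/
noncomputable def sphMap {n : ℕ} (g : Eu n ≃ₗᵢ[ℝ] Eu n) (w : Sph n) : Sph n :=
  ⟨g w, by simp⟩

@[simp] theorem coe_sphMap {n : ℕ} (g : Eu n ≃ₗᵢ[ℝ] Eu n) (w : Sph n) :
    (sphMap g w : Eu n) = g w := rfl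

-- The surface measure of a set is a multiple of the volume of the cone over it, and linear
-- isometries preserve volume and map cones to cones.
open scoped Pointwise in
theorem measurePreserving_sphMap {n : ℕ} (g : Eu n ≃ₗᵢ[ℝ] Eu n) :
    MeasurePreserving (sphMap g) (surf n) (surf n) := by
  have hm : Measurable (sphMap g) :=
    (g.continuous.comp continuous_subtype_val).measurable.subtype_mk
  refine ⟨hm, Measure.ext fun s hs => ?_⟩
  rw [Measure.map_apply hm hs, Measure.toSphere_apply' _ hs, Measure.toSphere_apply' _ (hm hs)]
  congr 1
  rw [← g.measurePreserving.measure_preimage_emb g.toHomeomorph.measurableEmbedding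
    (Set.Ioo (0 : ℝ) 1 • (((↑) : Sph n → Eu n) '' s))]
  congr 1
  ext x
  simp only [Set.mem_smul, Set.mem_image, Set.mem_preimage]
  constructor
  · rintro ⟨r, hr, _, ⟨w, hw, rfl⟩, rfl⟩
    exact ⟨r, hr, _, ⟨sphMap g w, hw, rfl⟩, by simp⟩
  · rintro ⟨r, hr, _, ⟨w, hw, rfl⟩, h⟩
    refine ⟨r, hr, _, ⟨sphMap g.symm w, ?_, rfl⟩, ?_⟩
    · have : sphMap g (sphMap g.symm w) = w := Subtype.ext (by simp)
      rwa [this]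
    · apply g.injective
      rw [← h]
      simp

/-- The rotation by the angle `θ` in the plane spanned by `e_i` and `e_j`. -/
noncomputable def planeRot {n : ℕ} (i j : Fin (n + 1)) (hij : i ≠ j) (θ : ℝ) :
    Eu n ≃ₗᵢ[ℝ] Eu n :=
  LinearIsometry.toLinearIsometryEquiv
    { toFun := fun x => x +
        ((Real.cos θ - 1) * x i - Real.sin θ * x j) • EuclideanSpace.single i (1 : ℝ) +
        (Real.sin θ * x i + (Real.cos θ - 1) * x j) • EuclideanSpace.single j (1 : ℝ)
      map_add' := fun x y => by
        simp only [PiLp.add_apply]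
        module
      map_smul' := fun r x => by
        simp only [PiLp.smul_apply, smul_eq_mul, RingHom.id_apply]
        module
      norm_map' := fun x => by
        rw [← sq_eq_sq₀ (norm_nonneg _) (norm_nonneg _)]
        simp only [LinearMap.coe_mk, AddHom.coe_mk]
        rw [← real_inner_self_eq_norm_sq, ← real_inner_self_eq_norm_sq]
        simp only [inner_add_left, inner_add_right, inner_smul_left, inner_smul_right,
          EuclideanSpace.inner_single_left, EuclideanSpace.inner_single_right]
        simp [hij, hij.symm]
        linear_combination (x i ^ 2 + x j ^ 2) * Real.sin_sq_add_cos_sq θ } rfl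

theorem planeRot_apply {n : ℕ} {i j : Fin (n + 1)} (hij : i ≠ j) (θ : ℝ) (x : Eu n) :
    planeRot i j hij θ x = x +
        ((Real.cos θ - 1) * x i - Real.sin θ * x j) • EuclideanSpace.single i (1 : ℝ) +
        (Real.sin θ * x i + (Real.cos θ - 1) * x j) • EuclideanSpace.single j (1 : ℝ) := rfl

theorem hasDerivAt_planeRot {n : ℕ} {i j : Fin (n + 1)} (hij : i ≠ j) (θ : ℝ) (x : Eu n) :
    HasDerivAt (fun θ => planeRot i j hij θ x)
      ((-Real.sin θ * x i - Real.cos θ * x j) • EuclideanSpace.single i (1 : ℝ) +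
        (Real.cos θ * x i - Real.sin θ * x j) • EuclideanSpace.single j (1 : ℝ)) θ := by
  simp only [planeRot_apply]
  have h1 := (((Real.hasDerivAt_cos θ).sub_const 1).mul_const (x i)).sub
    ((Real.hasDerivAt_sin θ).mul_const (x j))
  have h2 := ((Real.hasDerivAt_sin θ).mul_const (x i)).add
    (((Real.hasDerivAt_cos θ).sub_const 1).mul_const (x j))
  have h3 := ((h1.smul_const (EuclideanSpace.single i (1 : ℝ))).const_add x).add
    (h2.smul_const (EuclideanSpace.single j (1 : ℝ)))
  exact h3.congr_deriv (by module)

theorem abs_apply_le_one {n : ℕ} (w : Sph n) (i : Fin (n + 1)) : |(w : Eu n) i| ≤ 1 := by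
  have h := PiLp.norm_apply_le (w : Eu n) i
  rwa [norm_eq_of_mem_sphere, Real.norm_eq_abs] at h

/-- The integral of `Φ` composed with a rotation by `θ` does not depend on `θ`; its derivative at `θ
= 0` is the integral of the rotation field applied to `Φ`. All integrations by parts below are
instances of this. -/
theorem integral_rotation_eq_zero {n : ℕ} {E : Type*} [NormedAddCommGroup E] [NormedSpace ℝ E]
    {Φ : Eu n → E} (hΦ : ContDiff ℝ 1 Φ) (i j : Fin (n + 1)) :
    ∫ w : Sph n, fderiv ℝ Φ w ((w : Eu n) i • EuclideanSpace.single j (1 : ℝ) -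
      (w : Eu n) j • EuclideanSpace.single i (1 : ℝ)) ∂(surf n) = 0 := by
  by_cases hij : i = j
  · subst hij
    simp
  have hd : Continuous (fderiv ℝ Φ) := hΦ.continuous_fderiv one_ne_zero
  obtain ⟨C, hC⟩ := (isCompact_sphere (0 : Eu n) 1).exists_bound_of_continuousOn hd.continuousOn
  have hcont : ∀ θ, Continuous fun w : Sph n => planeRot i j hij θ (w : Eu n) := fun θ =>
    (planeRot i j hij θ).continuous.comp continuous_subtype_val
  have hco : ∀ k : Fin (n + 1), Continuous fun w : Sph n => (w : Eu n) k := fun k =>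
    (EuclideanSpace.proj (𝕜 := ℝ) k).continuous.comp continuous_subtype_val
  set F' : ℝ → Sph n → E := fun θ w => fderiv ℝ Φ (planeRot i j hij θ (w : Eu n))
    ((-Real.sin θ * (w : Eu n) i - Real.cos θ * (w : Eu n) j) • EuclideanSpace.single i (1 : ℝ) +
      (Real.cos θ * (w : Eu n) i - Real.sin θ * (w : Eu n) j) • EuclideanSpace.single j (1 : ℝ))
    with hF'
  have hF'c : ∀ θ, Continuous (F' θ) := by
    intro θ
    refine (hd.comp (hcont θ)).clm_apply ?_
    have h1 := hco i
    have h2 := hco j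
    fun_prop
  -- The velocity of a point under the rotation has two components, each a sum of two terms of
  -- absolute value at most 1; hence the factor 4 in the dominating constant.
  have key := (hasDerivAt_integral_of_dominated_loc_of_deriv_le (μ := surf n) (x₀ := (0 : ℝ))
    (s := Set.univ) (F := fun θ w => Φ (planeRot i j hij θ (w : Eu n))) (F' := F')
    (bound := fun _ => C * 4) Filter.univ_mem ?_ ?_ ?_ ?_ (integrable_const _) ?_).2
  · have hconst : (fun θ => ∫ w : Sph n, Φ (planeRot i j hij θ (w : Eu n)) ∂(surf n)) =
        fun _ => ∫ w : Sph n, Φ w ∂(surf n) := by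
      funext θ
      have hemb : MeasurableEmbedding (sphMap (planeRot i j hij θ)) := by
        refine Continuous.measurableEmbedding
          (((planeRot i j hij θ).continuous.comp continuous_subtype_val).subtype_mk _) ?_
        intro a b h
        have h2 := Subtype.ext_iff.1 h
        rw [coe_sphMap, coe_sphMap] at h2
        exact Subtype.ext ((planeRot i j hij θ).injective h2)
      exact (measurePreserving_sphMap (planeRot i j hij θ)).integral_comp hemb
        (fun w : Sph n => Φ w)
    rw [hconst] at key
    have h0 := key.unique (hasDerivAt_const (0 : ℝ) _)
    rw [← h0]
    congr 1
    funext w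
    have : planeRot i j hij 0 (w : Eu n) = w := by simp [planeRot_apply]
    simp only [hF', this]
    congr 1
    simp only [Real.sin_zero, Real.cos_zero]
    module
  · exact Filter.Eventually.of_forall fun θ =>
      (hΦ.continuous.comp (hcont θ)).aestronglyMeasurable
  · exact (hΦ.continuous.comp (hcont 0)).integrable_of_hasCompactSupport
      (HasCompactSupport.of_compactSpace _)
  · exact (hF'c 0).aestronglyMeasurable
  · refine Filter.Eventually.of_forall fun w θ _ => ?_
    have hs := Real.abs_sin_le_one θ
    have hc := Real.abs_cos_le_one θ
    have hi := abs_apply_le_one w i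
    have hj := abs_apply_le_one w j
    have hb : ∀ a b : ℝ, |a| ≤ 1 → |b| ≤ 1 → |a * b| ≤ 1 := fun a b ha hb => by
      rw [abs_mul]; exact mul_le_one₀ ha (abs_nonneg _) hb
    have hmem : planeRot i j hij θ (w : Eu n) ∈ Metric.sphere (0 : Eu n) 1 := by simp
    have hC0 : 0 ≤ C := (norm_nonneg _).trans (hC _ hmem)
    refine (ContinuousLinearMap.le_opNorm _ _).trans
      (mul_le_mul (hC _ hmem) ?_ (norm_nonneg _) hC0)
    refine (norm_add_le _ _).trans ?_
    simp only [norm_smul, PiLp.norm_single, norm_one, mul_one, Real.norm_eq_abs]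
    have h1 := abs_sub (-Real.sin θ * (w : Eu n) i) (Real.cos θ * (w : Eu n) j)
    have h2 := abs_sub (Real.cos θ * (w : Eu n) i) (Real.sin θ * (w : Eu n) j)
    have := hb (-Real.sin θ) _ (by rwa [abs_neg]) hi
    have := hb _ _ hc hj
    have := hb _ _ hc hi
    have := hb _ _ hs hj
    linarith
  · refine Filter.Eventually.of_forall fun w θ _ => ?_
    exact (hΦ.differentiable one_ne_zero _).hasFDerivAt.comp_hasDerivAt θ
      (hasDerivAt_planeRot hij θ (w : Eu n))

theorem rot_eq_fderiv {n : ℕ} (i j : Fin (n + 1)) (φ : Eu n → ℝ) (x : Eu n) :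
    rot i j φ x = fderiv ℝ φ x (x i • EuclideanSpace.single j (1 : ℝ) -
      x j • EuclideanSpace.single i (1 : ℝ)) := by
  simp [rot]

namespace ClPoly

variable {n : ℕ}

theorem ev_opRot (x : Eu n) (i j : Fin (n + 1)) (u : ClPoly n) :
    ev x (opRot i j u) = fderiv ℝ (fun x => ev x u) x (x i • EuclideanSpace.single j (1 : ℝ) -
      x j • EuclideanSpace.single i (1 : ℝ)) := by
  rw [map_sub, map_smul, map_smul, fderiv_ev, fderiv_ev, ← ev_opX, ← ev_opX, ← map_sub]
  rfl

theorem continuous_ev (u : ClPoly n) : Continuous fun w : Sph n => ev (w : Eu n) u :=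
  (contDiff_ev u).continuous.comp continuous_subtype_val

end ClPoly

theorem integrable_of_continuous_sph {n : ℕ} {E : Type*} [NormedAddCommGroup E]
    {f : Sph n → E} (hf : Continuous f) : Integrable f (surf n) :=
  hf.integrable_of_hasCompactSupport (HasCompactSupport.of_compactSpace _)

theorem integral_smul_ev_opRot {n : ℕ} {φ : Eu n → ℝ} (hφ : ContDiff ℝ 1 φ) (i j : Fin (n + 1))
    (u : ClPoly n) :
    ∫ w : Sph n, φ w • ClPoly.ev (w : Eu n) (ClPoly.opRot i j u) ∂(surf n) =
      -∫ w : Sph n, rot i j φ w • ClPoly.ev (w : Eu n) u ∂(surf n) := by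
  have hu : ContDiff ℝ 1 fun x : Eu n => ClPoly.ev x u := (ClPoly.contDiff_ev u).of_le (by simp)
  have h := integral_rotation_eq_zero (hφ.smul hu) i j
  have hco : ∀ k : Fin (n + 1), Continuous fun w : Sph n => (w : Eu n) k := fun k =>
    (EuclideanSpace.proj (𝕜 := ℝ) k).continuous.comp continuous_subtype_val
  have hrot : Continuous fun w : Sph n => rot i j φ (w : Eu n) := by
    simp only [rot_eq_fderiv]
    refine ((hφ.continuous_fderiv one_ne_zero).comp continuous_subtype_val).clm_apply ?_
    have h1 := hco i
    have h2 := hco j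
    fun_prop
  rw [eq_neg_iff_add_eq_zero, ← integral_add, ← h]
  · congr 1
    funext w
    have e := fderiv_smul (hφ.differentiable one_ne_zero (w : Eu n))
      (hu.differentiable one_ne_zero (w : Eu n))
    rw [e, ClPoly.ev_opRot, rot_eq_fderiv]
    rfl
  · exact integrable_of_continuous_sph
      ((hφ.continuous.comp continuous_subtype_val).smul (ClPoly.continuous_ev _))
  · exact integrable_of_continuous_sph (hrot.smul (ClPoly.continuous_ev _))

/-! ### Zonal integrals -/

theorem lintegral_eq_lintegral_sphere {E : Type*} [NormedAddCommGroup E] [NormedSpace ℝ E]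
    [MeasurableSpace E] [BorelSpace E] [FiniteDimensional ℝ E] [Nontrivial E] (μ : Measure E)
    [μ.IsAddHaarMeasure] {G : E → ENNReal} (hG : Measurable G) :
    ∫⁻ x, G x ∂μ = ∫⁻ r in Set.Ioi (0 : ℝ), ENNReal.ofReal (r ^ (Module.finrank ℝ E - 1)) *
      ∫⁻ v : Metric.sphere (0 : E) 1, G (r • (v : E)) ∂μ.toSphere := by
  have hG2 : Measurable fun p : Metric.sphere (0 : E) 1 × Set.Ioi (0 : ℝ) =>
      G ((p.2 : ℝ) • (p.1 : E)) := by fun_prop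
  have hG3 : Measurable fun r : ℝ =>
      ∫⁻ v : Metric.sphere (0 : E) 1, G (r • (v : E)) ∂μ.toSphere := by
    refine Measurable.lintegral_prod_right'
      (f := fun p : ℝ × Metric.sphere (0 : E) 1 => G (p.1 • (p.2 : E))) ?_
    fun_prop
  calc ∫⁻ x, G x ∂μ = ∫⁻ x in ({0}ᶜ : Set E), G x ∂μ := by
        rw [restrict_compl_singleton]
    _ = ∫⁻ x : ({0}ᶜ : Set E), G x ∂(μ.comap (↑)) :=
        (lintegral_subtype_comap (measurableSet_singleton _).compl _).symm
    _ = ∫⁻ p, G ((p.2 : ℝ) • (p.1 : E))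
          ∂(μ.toSphere.prod (Measure.volumeIoiPow (Module.finrank ℝ E - 1))) := by
        rw [← μ.measurePreserving_homeomorphUnitSphereProd.lintegral_comp hG2]
        refine lintegral_congr fun x => ?_
        have := congrArg Subtype.val ((homeomorphUnitSphereProd E).symm_apply_apply x)
        rw [homeomorphUnitSphereProd_symm_apply_coe] at this
        exact congrArg G this.symm
    _ = ∫⁻ r : Set.Ioi (0 : ℝ), ∫⁻ v : Metric.sphere (0 : E) 1, G ((r : ℝ) • (v : E)) ∂μ.toSphere
          ∂(Measure.volumeIoiPow (Module.finrank ℝ E - 1)) :=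
        lintegral_prod_symm' _ hG2
    _ = _ := by
        refine (lintegral_withDensity_eq_lintegral_mul _ (by fun_prop)
          (g := fun r : Set.Ioi (0 : ℝ) =>
            ∫⁻ v : Metric.sphere (0 : E) 1, G ((r : ℝ) • (v : E)) ∂μ.toSphere)
          (hG3.comp measurable_subtype_coe)).trans ?_
        exact lintegral_subtype_comap measurableSet_Ioi (fun r : ℝ =>
          ENNReal.ofReal (r ^ (Module.finrank ℝ E - 1)) *
            ∫⁻ v : Metric.sphere (0 : E) 1, G (r • (v : E)) ∂μ.toSphere)

theorem area_pos {n : ℕ} (hn : 0 < n) : 0 < area n := by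
  have : 0 < Real.Gamma ((n : ℝ) / 2) := Real.Gamma_pos_of_pos (by positivity)
  unfold area
  positivity

theorem toSphere_univ_eq_area {n : ℕ} (hn : 0 < n) :
    (volume : Measure (EuclideanSpace ℝ (Fin n))).toSphere Set.univ = ENNReal.ofReal (area n) := by
  have : Nonempty (Fin n) := ⟨⟨0, hn⟩⟩
  have hn' : (0 : ℝ) < n := by exact_mod_cast hn
  rw [Measure.toSphere_apply_univ, EuclideanSpace.volume_ball]
  simp only [finrank_euclideanSpace, Fintype.card_fin, ENNReal.ofReal_one, one_pow, one_mul]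
  rw [← ENNReal.ofReal_natCast, ← ENNReal.ofReal_mul (by positivity), area,
    Real.Gamma_add_one (by positivity)]
  congr 1
  have h1 : √Real.pi ^ n = Real.pi ^ ((n : ℝ) / 2) := by
    rw [Real.sqrt_eq_rpow, ← Real.rpow_natCast, ← Real.rpow_mul Real.pi_pos.le]
    congr 1
    ring
  rw [h1]
  have : Real.Gamma ((n : ℝ) / 2) ≠ 0 := (Real.Gamma_pos_of_pos (by positivity)).ne'
  field_simp

theorem lintegral_norm_eq {n : ℕ} (hn : 0 < n) {h : ℝ → ENNReal} (hh : Measurable h) :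
    ∫⁻ y : EuclideanSpace ℝ (Fin n), h ‖y‖ =
      ENNReal.ofReal (area n) * ∫⁻ r in Set.Ioi (0 : ℝ), ENNReal.ofReal (r ^ (n - 1)) * h r := by
  have : Nonempty (Fin n) := ⟨⟨0, hn⟩⟩
  rw [lintegral_eq_lintegral_sphere volume
      (G := fun y : EuclideanSpace ℝ (Fin n) => h ‖y‖) (by fun_prop),
    ← lintegral_const_mul _ (by fun_prop)]
  refine setLIntegral_congr_fun measurableSet_Ioi fun r hr => ?_
  have : ∀ v : Metric.sphere (0 : EuclideanSpace ℝ (Fin n)) 1,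
      h ‖r • (v : EuclideanSpace ℝ (Fin n))‖ = h r := fun v => by
    rw [norm_smul, norm_eq_of_mem_sphere, mul_one, Real.norm_of_nonneg (le_of_lt hr)]
  simp only [this, lintegral_const, finrank_euclideanSpace, Fintype.card_fin,
    toSphere_univ_eq_area hn]
  ring

theorem lintegral_Eu_eq {n : ℕ} (hn : 0 < n) {g : ℝ × ℝ → ENNReal} (hg : Measurable g) :
    ∫⁻ x : Eu n, g (x 0, √(‖x‖ ^ 2 - x 0 ^ 2)) =
      ENNReal.ofReal (area n) *
        ∫⁻ p in {p : ℝ × ℝ | 0 < p.2}, ENNReal.ofReal (p.2 ^ (n - 1)) * g p := by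
  have hg' : ∀ a, Measurable fun r => g (a, r) := fun a => hg.comp (by fun_prop)
  have hN : ∀ x : Eu n, ‖x‖ ^ 2 - x 0 ^ 2 = ∑ i : Fin n, x i.succ ^ 2 := fun x => by
    rw [EuclideanSpace.real_norm_sq_eq, Fin.sum_univ_succ]; ring
  have hN' : ∀ y : EuclideanSpace ℝ (Fin n), ‖y‖ = √(∑ i, y i ^ 2) := fun y => by
    rw [EuclideanSpace.norm_eq]; simp
  calc ∫⁻ x : Eu n, g (x 0, √(‖x‖ ^ 2 - x 0 ^ 2))
      = ∫⁻ x : Fin (n + 1) → ℝ, g (x 0, √(∑ i : Fin n, x i.succ ^ 2)) := by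
        simp only [hN]
        exact (PiLp.volume_preserving_ofLp (Fin (n + 1))).lintegral_comp
          (f := fun x : Fin (n + 1) → ℝ => g (x 0, √(∑ i : Fin n, x i.succ ^ 2)))
          (hg.comp (by fun_prop))
    _ = ∫⁻ p : ℝ × (Fin n → ℝ), g (p.1, √(∑ i : Fin n, p.2 i ^ 2)) :=
        (volume_preserving_piFinSuccAbove (fun _ : Fin (n + 1) => ℝ) 0).lintegral_comp
          (f := fun p : ℝ × (Fin n → ℝ) => g (p.1, √(∑ i : Fin n, p.2 i ^ 2)))
          (hg.comp (by fun_prop))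
    _ = ∫⁻ a : ℝ, ∫⁻ y : Fin n → ℝ, g (a, √(∑ i : Fin n, y i ^ 2)) :=
        lintegral_prod _ (hg.comp (by fun_prop)).aemeasurable
    _ = ∫⁻ a : ℝ, ENNReal.ofReal (area n) *
          ∫⁻ r in Set.Ioi (0 : ℝ), ENNReal.ofReal (r ^ (n - 1)) * g (a, r) := by
        refine lintegral_congr fun a => ?_
        rw [← lintegral_norm_eq hn (hg' a)]
        simp only [hN']
        exact ((PiLp.volume_preserving_ofLp (Fin n)).lintegral_comp
          (f := fun y : Fin n → ℝ => g (a, √(∑ i : Fin n, y i ^ 2)))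
          (hg.comp (by fun_prop))).symm
    _ = ENNReal.ofReal (area n) * ∫⁻ a : ℝ,
          ∫⁻ r in Set.Ioi (0 : ℝ), ENNReal.ofReal (r ^ (n - 1)) * g (a, r) := by
        refine lintegral_const_mul _ ?_
        exact Measurable.lintegral_prod_right'
          (f := fun p : ℝ × ℝ => ENNReal.ofReal (p.2 ^ (n - 1)) * g p) (by fun_prop)
    _ = _ := by
        congr 1
        have hs : {p : ℝ × ℝ | 0 < p.2} = Set.univ ×ˢ Set.Ioi 0 := by
          ext p; simp
        rw [hs, Measure.volume_eq_prod, ← Measure.prod_restrict, Measure.restrict_univ,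
          lintegral_prod]
        fun_prop

theorem lintegral_Ioo_pow (n : ℕ) :
    ∫⁻ r in Set.Ioo (0 : ℝ) 1, ENNReal.ofReal (r ^ n) = ENNReal.ofReal (1 / (n + 1)) := by
  rw [Measure.restrict_congr_set Ioo_ae_eq_Ioc, ← ofReal_integral_eq_lintegral_ofReal,
    ← intervalIntegral.integral_of_le zero_le_one]
  · simp
  · exact (intervalIntegral.intervalIntegrable_pow n).1
  · filter_upwards [ae_restrict_mem measurableSet_Ioc] with r hr
    exact pow_nonneg hr.1.le _

/-- The integral of the degree-zero extension `F (x_0 / ‖x‖)` over the unit ball is evaluated twice: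
in polar coordinates of `ℝ ^ (n + 1)`, and by slicing along the axis, integrating over radii of `ℝ ^
n` and then using polar coordinates of the half-plane. Both give the same finite radial factor,
which cancels. -/
theorem lintegral_zonal {n : ℕ} (hn : 0 < n) {F : ℝ → ENNReal} (hF : Measurable F) (w : Sph n) :
    ∫⁻ v : Sph n, F (inner ℝ (w : Eu n) (v : Eu n)) ∂(surf n) =
      ENNReal.ofReal (area n) *
        ∫⁻ θ in Set.Ioo 0 Real.pi, ENNReal.ofReal (Real.sin θ ^ (n - 1)) * F (Real.cos θ) := by
  -- The reflection exchanging two vectors of equal length moves the pole to `w`.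
  obtain ⟨g, hg⟩ : ∃ g : Eu n ≃ₗᵢ[ℝ] Eu n, g (EuclideanSpace.single 0 1) = (w : Eu n) :=
    ⟨_, Submodule.reflection_sub (by simp)⟩
  have hsphere : ∫⁻ v : Sph n, F (inner ℝ (w : Eu n) (v : Eu n)) ∂(surf n) =
      ∫⁻ v : Sph n, F ((v : Eu n) 0) ∂(surf n) := by
    rw [← (measurePreserving_sphMap g).lintegral_comp
      (f := fun v : Sph n => F (inner ℝ (w : Eu n) (v : Eu n))) (hF.comp (by fun_prop))]
    refine lintegral_congr fun v => ?_
    rw [coe_sphMap, ← hg, LinearIsometryEquiv.inner_map_map, EuclideanSpace.inner_single_left]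
    simp
  set S := ∫⁻ v : Sph n, F ((v : Eu n) 0) ∂(surf n) with hS
  set I := ∫⁻ θ in Set.Ioo 0 Real.pi, ENNReal.ofReal (Real.sin θ ^ (n - 1)) * F (Real.cos θ)
    with hI
  have hc0 : ENNReal.ofReal (1 / ((n : ℝ) + 1)) ≠ 0 := by
    rw [Ne, ENNReal.ofReal_eq_zero, not_le]; positivity
  let χ : ℝ → ENNReal := (Set.Iio 1).indicator 1
  have hχ : Measurable χ := measurable_one.indicator measurableSet_Iio
  have hpow : ∫⁻ r in Set.Ioi (0 : ℝ), ENNReal.ofReal (r ^ n) * χ r =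
      ENNReal.ofReal (1 / (n + 1)) := by
    rw [← lintegral_Ioo_pow, ← lintegral_indicator measurableSet_Ioi,
      ← lintegral_indicator measurableSet_Ioo]
    refine lintegral_congr fun r => ?_
    by_cases h0 : 0 < r <;> by_cases h1 : r < 1 <;> simp [χ, h0, h1]
  have hhomog : ∫⁻ x : Eu n, F (x 0 / ‖x‖) * χ ‖x‖ = ENNReal.ofReal (1 / (n + 1)) * S := by
    rw [lintegral_eq_lintegral_sphere volume (by fun_prop), ← hpow,
      ← lintegral_mul_const _ (by fun_prop)]
    have hm : Measurable fun v : Sph n => F ((v : Eu n) 0) := hF.comp (by fun_prop)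
    refine setLIntegral_congr_fun measurableSet_Ioi fun r hr => ?_
    have : ∀ v : Sph n, F ((r • (v : Eu n)) 0 / ‖r • (v : Eu n)‖) * χ ‖r • (v : Eu n)‖ =
        F ((v : Eu n) 0) * χ r := fun v => by
      rw [norm_smul, norm_eq_of_mem_sphere, mul_one, Real.norm_of_nonneg (le_of_lt hr),
        PiLp.smul_apply, smul_eq_mul, mul_div_cancel_left₀ _ (ne_of_gt hr)]
    simp only [this, finrank_euclideanSpace, Fintype.card_fin, Nat.add_sub_cancel]
    rw [lintegral_mul_const _ hm, ← hS]
    ring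
  have hslice : ∫⁻ x : Eu n, F (x 0 / ‖x‖) * χ ‖x‖ =
      ENNReal.ofReal (area n) * (ENNReal.ofReal (1 / (n + 1)) * I) := by
    have e : ∀ x : Eu n, F (x 0 / ‖x‖) * χ ‖x‖ = (fun p : ℝ × ℝ =>
        F (p.1 / √(p.1 ^ 2 + p.2 ^ 2)) * χ √(p.1 ^ 2 + p.2 ^ 2)) (x 0, √(‖x‖ ^ 2 - x 0 ^ 2)) := by
      intro x
      have h1 : 0 ≤ ‖x‖ ^ 2 - x 0 ^ 2 := by
        have := PiLp.norm_apply_le x 0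
        rw [Real.norm_eq_abs] at this
        nlinarith [abs_nonneg (x 0), sq_abs (x 0)]
      simp only
      rw [Real.sq_sqrt h1, add_sub_cancel, Real.sqrt_sq (norm_nonneg _)]
    refine (lintegral_congr e).trans ((lintegral_Eu_eq hn (g := fun p : ℝ × ℝ =>
      F (p.1 / √(p.1 ^ 2 + p.2 ^ 2)) * χ √(p.1 ^ 2 + p.2 ^ 2)) (by fun_prop)).trans ?_)
    congr 1
    have hms : MeasurableSet {p : ℝ × ℝ | 0 < p.2} := measurableSet_lt measurable_const measurable_snd
    rw [← lintegral_indicator hms, ← lintegral_comp_polarCoord_symm, polarCoord_target,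
      Measure.volume_eq_prod]
    set T : ℝ → ENNReal := (Set.Ioo 0 Real.pi).indicator
      fun θ => ENNReal.ofReal (Real.sin θ ^ (n - 1)) * F (Real.cos θ) with hT
    have hTm : Measurable T := by
      refine Measurable.indicator ?_ measurableSet_Ioo
      fun_prop
    have hIT : I = ∫⁻ θ in Set.Ioo (-Real.pi) Real.pi, T θ := by
      rw [hT, setLIntegral_indicator measurableSet_Ioo, hI]
      congr 2
      rw [Set.Ioo_inter_Ioo]
      simp [Real.pi_pos.le]
    rw [hIT, ← hpow, ← lintegral_prod_mul (by fun_prop) hTm.aemeasurable, Measure.prod_restrict]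
    refine setLIntegral_congr_fun (measurableSet_Ioi.prod measurableSet_Ioo) ?_
    rintro ⟨r, θ⟩ ⟨hr, hθ⟩
    have hr' : 0 < r := hr
    simp only [polarCoord_symm_apply, smul_eq_mul]
    -- Only the upper half-plane carries mass: the second coordinate is a radius in `ℝ ^ n`. For `θ
    -- ≤ 0` both indicators vanish.
    by_cases h0 : 0 < θ
    · have hsin : 0 < Real.sin θ := Real.sin_pos_of_pos_of_lt_pi h0 hθ.2
      have hmem : (r * Real.cos θ, r * Real.sin θ) ∈ {p : ℝ × ℝ | 0 < p.2} := mul_pos hr' hsin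
      have hsq : √((r * Real.cos θ) ^ 2 + (r * Real.sin θ) ^ 2) = r := by
        rw [mul_pow, mul_pow, ← mul_add, add_comm, Real.sin_sq_add_cos_sq, mul_one,
          Real.sqrt_sq hr'.le]
      rw [Set.indicator_of_mem hmem, hT, Set.indicator_of_mem (show θ ∈ Set.Ioo 0 Real.pi from
        ⟨h0, hθ.2⟩), hsq, mul_div_cancel_left₀ _ hr'.ne', mul_pow,
        ENNReal.ofReal_mul (by positivity)]
      obtain ⟨m, rfl⟩ : ∃ m, n = m + 1 := ⟨n - 1, by omega⟩
      rw [Nat.add_sub_cancel, pow_succ', ENNReal.ofReal_mul hr'.le]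
      ring
    · have hsin : Real.sin θ ≤ 0 :=
        Real.sin_nonpos_of_nonpos_of_neg_pi_le (not_lt.1 h0) hθ.1.le
      have hmem : (r * Real.cos θ, r * Real.sin θ) ∉ {p : ℝ × ℝ | 0 < p.2} :=
        not_lt.2 (mul_nonpos_of_nonneg_of_nonpos hr'.le hsin)
      rw [Set.indicator_of_notMem hmem, hT, Set.indicator_of_notMem (fun h => h0 h.1), mul_zero,
        mul_zero]
  rw [hsphere]
  rw [hhomog, ← mul_assoc, mul_comm (ENNReal.ofReal (area n)), mul_assoc] at hslice
  exact (ENNReal.mul_right_inj hc0 ENNReal.ofReal_ne_top).1 hslice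

/-! ### Integrals of negative powers of the chordal distance. -/

theorem norm_sub_sph_sq {n : ℕ} (w v : Sph n) :
    ‖(w : Eu n) - v‖ ^ 2 = 2 - 2 * inner ℝ (w : Eu n) (v : Eu n) := by
  rw [norm_sub_sq_real, norm_eq_of_mem_sphere, norm_eq_of_mem_sphere]
  ring

theorem norm_sub_sph {n : ℕ} (w v : Sph n) :
    ‖(w : Eu n) - v‖ = √(2 - 2 * inner ℝ (w : Eu n) (v : Eu n)) := by
  rw [← norm_sub_sph_sq, Real.sqrt_sq (norm_nonneg _)]

theorem sqrt_two_sub_two_cos {θ : ℝ} (h : θ ∈ Set.Ioo 0 Real.pi) :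
    √(2 - 2 * Real.cos θ) = 2 * Real.sin (θ / 2) := by
  have h1 : 0 < Real.sin (θ / 2) :=
    Real.sin_pos_of_pos_of_lt_pi (by linarith [h.1]) (by linarith [h.2, Real.pi_pos])
  have h2 : 2 - 2 * Real.cos θ = (2 * Real.sin (θ / 2)) ^ 2 := by
    have h3 := Real.cos_two_mul (θ / 2)
    have h4 := Real.sin_sq_add_cos_sq (θ / 2)
    rw [mul_div_cancel₀ θ two_ne_zero] at h3
    nlinarith
  rw [h2, Real.sqrt_sq (by positivity)]

theorem lintegral_norm_sub_inv {n : ℕ} (hn : 0 < n) {k : ℕ} (w : Sph n) :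
    ∫⁻ v : Sph n, ENNReal.ofReal (‖(w : Eu n) - v‖ ^ k)⁻¹ ∂(surf n) =
      ENNReal.ofReal (area n) * ∫⁻ θ in Set.Ioo 0 Real.pi,
        ENNReal.ofReal (Real.sin θ ^ (n - 1) * ((2 * Real.sin (θ / 2)) ^ k)⁻¹) := by
  simp only [norm_sub_sph]
  rw [lintegral_zonal hn (F := fun t => ENNReal.ofReal (√(2 - 2 * t) ^ k)⁻¹) (by fun_prop) w]
  congr 1
  refine setLIntegral_congr_fun measurableSet_Ioo fun θ hθ => ?_
  rw [sqrt_two_sub_two_cos hθ, ENNReal.ofReal_mul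
    (pow_nonneg (Real.sin_pos_of_pos_of_lt_pi hθ.1 hθ.2).le _)]

/-- The double-angle formula cancels the singular factor against the same power of `sin θ` from the
surface element. -/
theorem sin_pow_mul_half_inv {m k : ℕ} {θ : ℝ} (h : θ ∈ Set.Ioo 0 Real.pi) :
    Real.sin θ ^ (m + k) * ((2 * Real.sin (θ / 2)) ^ k)⁻¹ =
      Real.sin θ ^ m * Real.cos (θ / 2) ^ k := by
  have h1 : 0 < Real.sin (θ / 2) :=
    Real.sin_pos_of_pos_of_lt_pi (by linarith [h.1]) (by linarith [h.2, Real.pi_pos])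
  have h2 : Real.sin θ = 2 * Real.sin (θ / 2) * Real.cos (θ / 2) := by
    rw [← Real.sin_two_mul, mul_div_cancel₀ θ two_ne_zero]
  have h3 : (2 * Real.sin (θ / 2)) ^ k ≠ 0 := by positivity
  have h4 : Real.sin θ ^ k = (2 * Real.sin (θ / 2)) ^ k * Real.cos (θ / 2) ^ k := by
    rw [h2, mul_pow]
  rw [pow_add, h4]
  field_simp

/-- After cancellation the integrand in `θ` is a power of `cos (θ / 2)`, at most 1. This uniform
bound feeds both dominated convergence and Schur's test. -/
theorem lintegral_norm_sub_inv_le {n : ℕ} (hn : 0 < n) (w : Sph n) :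
    ∫⁻ v : Sph n, ENNReal.ofReal (‖(w : Eu n) - v‖ ^ (n - 1))⁻¹ ∂(surf n) ≤
      ENNReal.ofReal (area n * Real.pi) := by
  rw [lintegral_norm_sub_inv hn, ENNReal.ofReal_mul (area_pos hn).le]
  gcongr
  calc _ ≤ ∫⁻ θ in Set.Ioo 0 Real.pi, 1 := by
        refine setLIntegral_mono measurable_const fun θ hθ => ?_
        have h := sin_pow_mul_half_inv (m := 0) (k := n - 1) hθ
        rw [zero_add] at h
        rw [h, pow_zero, one_mul, ENNReal.ofReal_le_one]
        exact pow_le_one₀ (Real.cos_nonneg_of_neg_pi_div_two_le_of_le (by linarith [hθ.1, Real.pi_pos])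
          (by linarith [hθ.2])) (Real.cos_le_one _)
    _ = ENNReal.ofReal Real.pi := by simp

theorem integrable_norm_sub_inv {n : ℕ} (hn : 0 < n) (w : Sph n) :
    Integrable (fun v : Sph n => (‖(w : Eu n) - v‖ ^ (n - 1))⁻¹) (surf n) := by
  refine ⟨by fun_prop, ?_⟩
  rw [hasFiniteIntegral_iff_ofReal (Filter.Eventually.of_forall fun v => by positivity)]
  exact (lintegral_norm_sub_inv_le hn w).trans_lt ENNReal.ofReal_lt_top

/-- The one exact value needed: it normalizes the fundamental solution in
`tendsto_integral_regKer_mul_unit`. -/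
theorem integral_norm_sub_inv {n : ℕ} (hn : 2 ≤ n) (w : Sph n) :
    ∫ v : Sph n, (‖(w : Eu n) - v‖ ^ (n - 2))⁻¹ ∂(surf n) = area n * (4 / n) := by
  have hn0 : 0 < n := by omega
  have hn0' : (n : ℝ) ≠ 0 := by exact_mod_cast hn0.ne'
  rw [integral_eq_lintegral_of_nonneg_ae (Filter.Eventually.of_forall fun v => by positivity)
    (by fun_prop), lintegral_norm_sub_inv hn0, ENNReal.toReal_mul,
    ENNReal.toReal_ofReal (area_pos hn0).le]
  congr 1
  have h1 : ∀ θ ∈ Set.Ioo 0 Real.pi, Real.sin θ ^ (n - 1) * ((2 * Real.sin (θ / 2)) ^ (n - 2))⁻¹ =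
      2 * Real.sin (θ / 2) * Real.cos (θ / 2) ^ (n - 1) := by
    intro θ hθ
    have h := sin_pow_mul_half_inv (m := 1) (k := n - 2) hθ
    rw [show 1 + (n - 2) = n - 1 by omega, pow_one] at h
    have h2 : Real.sin θ = 2 * Real.sin (θ / 2) * Real.cos (θ / 2) := by
      rw [← Real.sin_two_mul, mul_div_cancel₀ θ two_ne_zero]
    rw [h, h2, show n - 1 = (n - 2) + 1 by omega, pow_succ']
    ring
  have hd : ∀ θ : ℝ, HasDerivAt (fun θ => -(4 / (n : ℝ)) * Real.cos (θ / 2) ^ n)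
      (2 * Real.sin (θ / 2) * Real.cos (θ / 2) ^ (n - 1)) θ := by
    intro θ
    have h := ((((hasDerivAt_id θ).div_const 2).cos).pow n).const_mul (-(4 / (n : ℝ)))
    refine h.congr_deriv ?_
    simp only [id]
    field_simp
    ring
  have hc : Continuous fun θ : ℝ => 2 * Real.sin (θ / 2) * Real.cos (θ / 2) ^ (n - 1) := by
    fun_prop
  rw [setLIntegral_congr_fun measurableSet_Ioo fun θ hθ => congrArg ENNReal.ofReal (h1 θ hθ),
    Measure.restrict_congr_set Ioo_ae_eq_Ioc, ← ofReal_integral_eq_lintegral_ofReal,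
    ← intervalIntegral.integral_of_le Real.pi_pos.le,
    intervalIntegral.integral_eq_sub_of_hasDerivAt (fun θ _ => hd θ) (hc.intervalIntegrable _ _)]
  · rw [ENNReal.toReal_ofReal] <;> simp [hn0.ne']
    positivity
  · exact (hc.intervalIntegrable 0 Real.pi).1
  · filter_upwards [ae_restrict_mem measurableSet_Ioc] with θ hθ
    have := Real.sin_nonneg_of_nonneg_of_le_pi (x := θ / 2) (by linarith [hθ.1])
      (by linarith [hθ.2, hθ.1])
    have := Real.cos_nonneg_of_neg_pi_div_two_le_of_le (x := θ / 2)
      (by linarith [hθ.1, Real.pi_pos])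
      (by linarith [hθ.2])
    positivity

/-! ### Integration by parts against regularized kernels -/

/-- The regularized kernel `(‖x - w‖ ^ 2 + ε) ^ p`. -/
noncomputable def regKer {n : ℕ} (w : Eu n) (ε p : ℝ) (x : Eu n) : ℝ := (‖x - w‖ ^ 2 + ε) ^ p

theorem regBase_pos {n : ℕ} (w : Eu n) {ε : ℝ} (hε : 0 < ε) (x : Eu n) : 0 < ‖x - w‖ ^ 2 + ε := by
  positivity

theorem contDiff_regKer {n : ℕ} (w : Eu n) {ε : ℝ} (hε : 0 < ε) (p : ℝ) :
    ContDiff ℝ 1 (regKer w ε p) := by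
  have h : ContDiff ℝ 1 fun x : Eu n => ‖x - w‖ ^ 2 + ε :=
    ((contDiff_id.sub contDiff_const).norm_sq ℝ).add contDiff_const
  exact h.rpow_const_of_ne fun x => (regBase_pos w hε x).ne'

theorem continuous_regKer {n : ℕ} (w : Eu n) {ε : ℝ} (hε : 0 < ε) (p : ℝ) :
    Continuous fun v : Sph n => regKer w ε p v :=
  (contDiff_regKer w hε p).continuous.comp continuous_subtype_val

theorem rot_regKer {n : ℕ} (w : Eu n) {ε : ℝ} (hε : 0 < ε) (p : ℝ) (i j : Fin (n + 1)) (x : Eu n) :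
    rot i j (regKer w ε p) x = 2 * p * regKer w ε (p - 1) x * (x j * w i - x i * w j) := by
  have h1 : HasFDerivAt (fun x : Eu n => ‖x - w‖ ^ 2 + ε) (2 • innerSL ℝ (x - w)) x := by
    simpa using! (((hasFDerivAt_id x).sub_const w).norm_sq).add_const ε
  have h2 := h1.rpow_const (p := p) (Or.inl (regBase_pos w hε x).ne')
  have h3 : fderiv ℝ (regKer w ε p) x = _ := h2.fderiv
  rw [rot_eq_fderiv, h3]
  simp only [smul_apply, innerSL_apply_apply, inner_sub_right, inner_smul_right,
    EuclideanSpace.inner_single_right, PiLp.sub_apply, smul_eq_mul, nsmul_eq_mul, regKer]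
  simp
  ring

namespace ClPoly

variable {n : ℕ}

theorem integral_mul_const {f : Sph n → Cl n} (a : Cl n) (hf : Continuous f) :
    ∫ v, a * f v ∂(surf n) = a * ∫ v, f v ∂(surf n) :=
  (mulCl n a).integral_comp_comm (integrable_of_continuous_sph hf)

/-- Integration by parts moves each rotation field onto the radial kernel; there it lowers the
exponent by 1 and produces the coefficients of the bivector spanned by `v` and `w`. -/
theorem integral_regKer_smul_sum_opRot (w : Eu n) {ε : ℝ} (hε : 0 < ε) (p : ℝ) (u : ClPoly n)
    (c : Fin (n + 1) → Fin (n + 1) → Cl n) :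
    ∫ v : Sph n, regKer w ε p v • ∑ i, ∑ j, c i j * ev (v : Eu n) (opRot i j u) ∂(surf n) =
      ∫ v : Sph n, (2 * p * regKer w ε (p - 1) v) •
        ((∑ i, ∑ j, ((v : Eu n) i * w j - (v : Eu n) j * w i) • c i j) * ev (v : Eu n) u)
          ∂(surf n) := by
  have hco : ∀ k : Fin (n + 1), Continuous fun w : Sph n => (w : Eu n) k := fun k =>
    (EuclideanSpace.proj (𝕜 := ℝ) k).continuous.comp continuous_subtype_val
  have h1 : ∀ i j, ∫ v : Sph n, c i j * (regKer w ε p v • ev (v : Eu n) (opRot i j u)) ∂(surf n) =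
      ∫ v : Sph n, (2 * p * regKer w ε (p - 1) v) •
        ((((v : Eu n) i * w j - (v : Eu n) j * w i) • c i j) * ev (v : Eu n) u) ∂(surf n) := by
    intro i j
    have hrot : Continuous fun v : Sph n => rot i j (regKer w ε p) v • ev (v : Eu n) u := by
      simp only [rot_regKer w hε]
      exact ((continuous_const.mul (continuous_regKer w hε _)).mul
        (((hco j).mul continuous_const).sub ((hco i).mul continuous_const))).smul (continuous_ev u)
    have hreg : Continuous fun v : Sph n => regKer w ε p v • ev (v : Eu n) (opRot i j u) :=
      (continuous_regKer w hε p).smul (continuous_ev _)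
    rw [integral_mul_const _ hreg, integral_smul_ev_opRot (contDiff_regKer w hε p), mul_neg, ← integral_mul_const _ hrot,
      ← integral_neg]
    congr 1
    funext v
    rw [rot_regKer w hε, mul_smul_comm, smul_mul_assoc, ← neg_smul, smul_smul]
    congr 1
    ring
  have hi1 : ∀ i j, Integrable (fun v : Sph n =>
      regKer w ε p v • (c i j * ev (v : Eu n) (opRot i j u))) (surf n) := fun i j =>
    integrable_of_continuous_sph
      ((continuous_regKer w hε p).smul (continuous_const.mul (continuous_ev _)))
  have hi2 : ∀ i j, Integrable (fun v : Sph n => (2 * p * regKer w ε (p - 1) v) •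
        ((((v : Eu n) i * w j - (v : Eu n) j * w i) • c i j) * ev (v : Eu n) u)) (surf n) :=
    fun i j => integrable_of_continuous_sph
      ((continuous_const.mul (continuous_regKer w hε _)).smul
        (((((hco i).mul continuous_const).sub ((hco j).mul continuous_const)).smul
          continuous_const).mul (continuous_ev u)))
  simp only [Finset.smul_sum, Finset.sum_mul]
  rw [integral_finsetSum _ fun i _ => integrable_finsetSum _ fun j _ => hi1 i j,
    integral_finsetSum _ fun i _ => integrable_finsetSum _ fun j _ => hi2 i j]
  refine Finset.sum_congr rfl fun i _ => ?_
  rw [integral_finsetSum _ fun j _ => hi1 i j, integral_finsetSum _ fun j _ => hi2 i j]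
  refine Finset.sum_congr rfl fun j _ => ?_
  rw [← h1]
  simp only [mul_smul_comm]

theorem sum_smul_star_paraUnit_mul (x y : Eu n) :
    ∑ i, ∑ j, (x i * y j - x j * y i) • (star (paraUnit i) * paraUnit j : Cl n) =
      star (para x) * para y - star (para y) * para x := by
  rw [star_para_eq_sum, star_para_eq_sum, para_eq_sum, para_eq_sum, Finset.sum_mul_sum,
    Finset.sum_mul_sum, ← Finset.sum_sub_distrib]
  refine Finset.sum_congr rfl fun i _ => ?_
  rw [← Finset.sum_sub_distrib]
  refine Finset.sum_congr rfl fun j _ => ?_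
  rw [smul_mul_smul_comm, smul_mul_smul_comm, ← sub_smul, mul_comm (x j)]

theorem sum_smul_paraUnit_mul_star (x y : Eu n) :
    ∑ i, ∑ j, (x i * y j - x j * y i) • (paraUnit i * star (paraUnit j) : Cl n) =
      para x * star (para y) - para y * star (para x) := by
  rw [star_para_eq_sum, star_para_eq_sum, para_eq_sum, para_eq_sum, Finset.sum_mul_sum,
    Finset.sum_mul_sum, ← Finset.sum_sub_distrib]
  refine Finset.sum_congr rfl fun i _ => ?_
  rw [← Finset.sum_sub_distrib]
  refine Finset.sum_congr rfl fun j _ => ?_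
  rw [smul_mul_smul_comm, smul_mul_smul_comm, ← sub_smul, mul_comm (x j)]

theorem integral_regKer_smul_opGam (w : Eu n) {ε : ℝ} (hε : 0 < ε) (p : ℝ) (u : ClPoly n) :
    ∫ v : Sph n, regKer w ε p v • ev (v : Eu n) (opGam u) ∂(surf n) =
      ∫ v : Sph n, (p * regKer w ε (p - 1) v) • ((star (para (v : Eu n)) * para w -
        star (para w) * para (v : Eu n)) * ev (v : Eu n) u) ∂(surf n) := by
  have h := integral_regKer_smul_sum_opRot w hε p u fun i j => star (paraUnit i) * paraUnit j
  have h2 : ∀ v : Sph n, ∑ i, ∑ j, star (paraUnit i) * paraUnit j * ev (v : Eu n) (opRot i j u) =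
      (2 : ℝ) • ev (v : Eu n) (opGam u) := fun v => by
    rw [← map_smul, two_smul_opGam]
    simp only [map_sum, ev_opC]
  simp only [h2, sum_smul_star_paraUnit_mul, smul_comm (regKer w ε p _) (2 : ℝ), mul_assoc (2 : ℝ),
    mul_smul (2 : ℝ), integral_smul] at h
  exact smul_right_injective _ two_ne_zero h

theorem integral_regKer_smul_opGamBar (w : Eu n) {ε : ℝ} (hε : 0 < ε) (p : ℝ) (u : ClPoly n) :
    ∫ v : Sph n, regKer w ε p v • ev (v : Eu n) (opGamBar u) ∂(surf n) =
      ∫ v : Sph n, (p * regKer w ε (p - 1) v) • ((para (v : Eu n) * star (para w) -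
        para w * star (para (v : Eu n))) * ev (v : Eu n) u) ∂(surf n) := by
  have h := integral_regKer_smul_sum_opRot w hε p u fun i j => paraUnit i * star (paraUnit j)
  have h2 : ∀ v : Sph n, ∑ i, ∑ j, paraUnit i * star (paraUnit j) * ev (v : Eu n) (opRot i j u) =
      (2 : ℝ) • ev (v : Eu n) (opGamBar u) := fun v => by
    rw [← map_smul, two_smul_opGamBar]
    simp only [map_sum, ev_opC]
  simp only [h2, sum_smul_paraUnit_mul_star, smul_comm (regKer w ε p _) (2 : ℝ), mul_assoc (2 : ℝ),
    mul_smul (2 : ℝ), integral_smul] at h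
  exact smul_right_injective _ two_ne_zero h

/-- The operator `Γ₀ - n / 2`. -/
noncomputable def opA (n : ℕ) : Module.End ℝ (ClPoly n) := opGam - ((n : ℝ) / 2) • 1

/-- The operator `Γ̄₀ - n / 2`. -/
noncomputable def opABar (n : ℕ) : Module.End ℝ (ClPoly n) := opGamBar - ((n : ℝ) / 2) • 1

theorem opA_apply (u : ClPoly n) : opA n u = opGam u - ((n : ℝ) / 2) • u := rfl

theorem opABar_apply (u : ClPoly n) : opABar n u = opGamBar u - ((n : ℝ) / 2) • u := rfl

/-- The relation `Γ̄₀ w = w (n - Γ₀)` becomes antisymmetric exactly after the shift by `n / 2`. -/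
theorem opABar_opPara (u : ClPoly n) : opABar n (opPara u) = -opPara (opA n u) := by
  rw [opABar_apply, opGamBar_opPara, opA_apply, map_sub, map_sub, map_smul, map_smul]
  module

/-- With `q = w̄ v`, everything lies in the commutative algebra generated by `q`, which satisfies
`q² = 2⟨w, v⟩ q - 1` on the sphere. The factor `q + 1` splits off. -/
theorem kernel_algebra (w v : Sph n) (φ φ' c : ℝ) (a : Cl n) :
    c • φ • ((star (para (w : Eu n)) * para (v : Eu n) + 1) * a) -
      (star (para (w : Eu n)) * (φ' • ((para (v : Eu n) * star (para (w : Eu n)) -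
        para (w : Eu n) * star (para (v : Eu n))) * (para (v : Eu n) * a))) +
      φ' • ((star (para (v : Eu n)) * para (w : Eu n) -
        star (para (w : Eu n)) * para (v : Eu n)) * a)) =
    (c * φ + ‖(v : Eu n) - w‖ ^ 2 * φ') • ((star (para (w : Eu n)) * para (v : Eu n) + 1) * a) := by
  have hq := star_para_mul_add (w : Eu n) v
  have hs : ‖(v : Eu n) - w‖ ^ 2 = 2 - 2 * inner ℝ (w : Eu n) (v : Eu n) := by
    rw [norm_sub_rev, norm_sub_sph_sq]
  have hqq : star (para (w : Eu n)) * para (v : Eu n) *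
      (star (para (v : Eu n)) * para (w : Eu n)) = 1 := by
    rw [mul_assoc, ← mul_assoc (para (v : Eu n)), para_mul_star_para, one_mul, star_para_mul_para]
  have hww : star (para (w : Eu n)) * (para (w : Eu n) * (star (para (v : Eu n)) *
      (para (v : Eu n) * a))) = a := by
    rw [← mul_assoc, star_para_mul_para, one_mul, ← mul_assoc, star_para_mul_para, one_mul]
  set q := star (para (w : Eu n)) * para (v : Eu n) with hqdef
  set q' := star (para (v : Eu n)) * para (w : Eu n)
  have hq' : q' = (2 * inner ℝ (w : Eu n) (v : Eu n) : ℝ) • 1 - q := by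
    rw [eq_sub_iff_add_eq', hq, Algebra.algebraMap_eq_smul_one]
  have hq2 : q * q = (2 * inner ℝ (w : Eu n) (v : Eu n) : ℝ) • q - 1 := by
    rw [← hqq, hq', mul_sub, mul_smul_comm, mul_one]
    abel
  have e1 : star (para (w : Eu n)) * ((para (v : Eu n) * star (para (w : Eu n)) -
        para (w : Eu n) * star (para (v : Eu n))) * (para (v : Eu n) * a)) = q * q * a - a := by
    rw [sub_mul, mul_sub]
    simp only [mul_assoc, hww, hqdef]
  rw [mul_smul_comm, e1, hq2, hq', hs]
  simp only [sub_mul, add_mul, smul_mul_assoc, one_mul]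
  module

/-- Away from the diagonal the Cauchy kernel is annihilated by the adjoint operator. For the
regularized kernel this fails only by a term with an explicit factor `ε`, an approximate delta
function at `w` with weight `w̄ v + 1`. -/
theorem integral_regKer_cauchy (w : Sph n) {ε : ℝ} (hε : 0 < ε) (u : ClPoly n) :
    ∫ v : Sph n, regKer (w : Eu n) ε (-(n : ℝ) / 2) v • (star (para ((w : Eu n) - (v : Eu n))) *
        ev (v : Eu n) (opPara (opA n u))) ∂(surf n) =
      ∫ v : Sph n, ((n : ℝ) / 2 * (ε * regKer (w : Eu n) ε (-(n : ℝ) / 2 - 1) v)) •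
        ((star (para (w : Eu n)) * para (v : Eu n) + 1) * ev (v : Eu n) u) ∂(surf n) := by
  set φ : Sph n → ℝ := fun v => regKer (w : Eu n) ε (-(n : ℝ) / 2) v with hφ
  -- The `w̄` part of the kernel sees `w A u` as `n/2 - Γ̄₀` applied to the product of the variable
  -- with `u`, while the `v̄` part cancels the variable and leaves `A u`.
  have hφc : Continuous φ := continuous_regKer _ hε _
  have hpc : Continuous fun v : Sph n => para (v : Eu n) :=
    continuous_para.comp continuous_subtype_val
  have h1 := integral_regKer_smul_opGam (w : Eu n) hε (-(n : ℝ) / 2) u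
  have h2 := integral_regKer_smul_opGamBar (w : Eu n) hε (-(n : ℝ) / 2) (opPara u)
  have e : ∀ v : Sph n, φ v • (star (para ((w : Eu n) - (v : Eu n))) *
      ev (v : Eu n) (opPara (opA n u))) =
      ((n : ℝ) / 2) • φ v • ((star (para (w : Eu n)) * para (v : Eu n) + 1) * ev (v : Eu n) u) -
        (star (para (w : Eu n)) * (φ v • ev (v : Eu n) (opGamBar (opPara u))) +
          φ v • ev (v : Eu n) (opGam u)) := by
    intro v
    have e1 : star (para (w : Eu n)) * ev (v : Eu n) (opPara (opA n u)) =
        ((n : ℝ) / 2) • (star (para (w : Eu n)) * para (v : Eu n) * ev (v : Eu n) u) -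
          star (para (w : Eu n)) * ev (v : Eu n) (opGamBar (opPara u)) := by
      have : opPara (opA n u) = ((n : ℝ) / 2) • opPara u - opGamBar (opPara u) := by
        rw [opGamBar_opPara, opA_apply, map_sub, map_sub, map_smul, map_smul]
        module
      rw [this, map_sub, map_smul, ev_opPara, mul_sub, mul_smul_comm, mul_assoc]
    have e2 : star (para (v : Eu n)) * ev (v : Eu n) (opPara (opA n u)) =
        ev (v : Eu n) (opGam u) - ((n : ℝ) / 2) • ev (v : Eu n) u := by
      rw [ev_opPara, ← mul_assoc, star_para_mul_para, one_mul, opA_apply, map_sub, map_smul]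
    rw [para_sub, star_sub, sub_mul, e1, e2, add_mul, one_mul, mul_smul_comm]
    module
  have hi0 : Continuous (fun v : Sph n =>
      φ v • ((star (para (w : Eu n)) * para (v : Eu n) + 1) * ev (v : Eu n) u)) :=
    hφc.smul (((continuous_const.mul hpc).add continuous_const).mul (continuous_ev u))
  have hi1 : Integrable (fun v : Sph n => ((n : ℝ) / 2) • φ v •
      ((star (para (w : Eu n)) * para (v : Eu n) + 1) * ev (v : Eu n) u)) (surf n) :=
    integrable_of_continuous_sph (hi0.const_smul ((n : ℝ) / 2))
  have hi2 : Continuous (fun v : Sph n => φ v • ev (v : Eu n) (opGamBar (opPara u))) :=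
    hφc.smul (continuous_ev _)
  have hi3 : Continuous (fun v : Sph n => φ v • ev (v : Eu n) (opGam u)) :=
    hφc.smul (continuous_ev _)
  have hc1 : Continuous fun v : Sph n => -(n : ℝ) / 2 * regKer (w : Eu n) ε (-(n : ℝ) / 2 - 1) v :=
    continuous_const.mul (continuous_regKer _ hε _)
  have hc2 : Continuous fun v : Sph n =>
      (-(n : ℝ) / 2 * regKer (w : Eu n) ε (-(n : ℝ) / 2 - 1) v) •
        ((para (v : Eu n) * star (para (w : Eu n)) - para (w : Eu n) * star (para (v : Eu n))) *
          ev (v : Eu n) (opPara u)) :=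
    hc1.smul (((hpc.mul continuous_const).sub (continuous_const.mul hpc.star)).mul
      (continuous_ev _))
  have hc3 : Continuous fun v : Sph n =>
      (-(n : ℝ) / 2 * regKer (w : Eu n) ε (-(n : ℝ) / 2 - 1) v) •
        ((star (para (v : Eu n)) * para (w : Eu n) - star (para (w : Eu n)) * para (v : Eu n)) *
          ev (v : Eu n) u) :=
    hc1.smul (((hpc.star.mul continuous_const).sub (continuous_const.mul hpc)).mul
      (continuous_ev _))
  have hI : Integrable (fun v : Sph n =>
      star (para (w : Eu n)) * (φ v • ev (v : Eu n) (opGamBar (opPara u)))) (surf n) :=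
    integrable_of_continuous_sph (continuous_const.mul hi2)
  have hI3 := integrable_of_continuous_sph hi3
  have hI4 : Integrable (fun v : Sph n =>
      star (para (w : Eu n)) * (φ v • ev (v : Eu n) (opGamBar (opPara u))) +
        φ v • ev (v : Eu n) (opGam u)) (surf n) := hI.add hI3
  have hI2 : Integrable (fun v : Sph n => star (para (w : Eu n)) *
      ((-(n : ℝ) / 2 * regKer (w : Eu n) ε (-(n : ℝ) / 2 - 1) v) •
        ((para (v : Eu n) * star (para (w : Eu n)) - para (w : Eu n) * star (para (v : Eu n))) *
          ev (v : Eu n) (opPara u)))) (surf n) :=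
    integrable_of_continuous_sph (continuous_const.mul hc2)
  refine (integral_congr_ae (Filter.Eventually.of_forall e)).trans ?_
  rw [integral_sub hi1 hI4, integral_add hI hI3, integral_mul_const _ hi2, h1, h2,
    ← integral_mul_const _ hc2, ← integral_add hI2 (integrable_of_continuous_sph hc3)]
  refine (integral_sub hi1 (hI2.add (integrable_of_continuous_sph hc3))).symm.trans ?_
  congr 1
  funext v
  simp only [Pi.add_apply]
  rw [ev_opPara, kernel_algebra]
  congr 1
  have hb := regBase_pos (w : Eu n) hε (v : Eu n)
  have : φ v = regKer (w : Eu n) ε (-(n : ℝ) / 2 - 1) v * (‖(v : Eu n) - w‖ ^ 2 + ε) := by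
    simp only [hφ, regKer]
    rw [← Real.rpow_add_one hb.ne', sub_add_cancel]
  rw [this]
  ring

end ClPoly

/-! ### Representation formulas -/

namespace ClPoly

variable {n : ℕ}

/-- On the sphere `w̄ v + v̄ w = 2 - ‖v - w‖²`, so all terms without `ε` cancel. -/
theorem cauchy_add_algebra (w v : Sph n) {φ ρ : ℝ} (ε : ℝ) (h : ρ = φ * (‖(v : Eu n) - w‖ ^ 2 + ε))
    (u : ClPoly n) :
    φ • (star (para ((w : Eu n) - (v : Eu n))) * ev (v : Eu n) (opPara u)) +
      ((1 / 2 : ℝ) • φ • ((star (para (v : Eu n)) * para (w : Eu n) -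
        star (para (w : Eu n)) * para (v : Eu n)) * ev (v : Eu n) u) +
      (1 / 2 : ℝ) • ρ • ev (v : Eu n) u) = (ε / 2 * φ) • ev (v : Eu n) u := by
  have hs : ‖(v : Eu n) - w‖ ^ 2 = 2 - 2 * inner ℝ (w : Eu n) (v : Eu n) := by
    rw [norm_sub_rev, norm_sub_sph_sq]
  have hq : star (para (v : Eu n)) * para (w : Eu n) =
      (2 * inner ℝ (w : Eu n) (v : Eu n) : ℝ) • 1 - star (para (w : Eu n)) * para (v : Eu n) := by
    rw [eq_sub_iff_add_eq', star_para_mul_add, Algebra.algebraMap_eq_smul_one]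
  have e : star (para ((w : Eu n) - (v : Eu n))) * ev (v : Eu n) (opPara u) =
      star (para (w : Eu n)) * para (v : Eu n) * ev (v : Eu n) u - ev (v : Eu n) u := by
    rw [ev_opPara, para_sub, star_sub, sub_mul, ← mul_assoc, ← mul_assoc, star_para_mul_para,
      one_mul]
  rw [e, hq, h, hs, sub_mul, sub_mul, smul_mul_assoc, one_mul]
  module

/-- The regularized `H`-term compensates the extra `+ u`: up to an error of order `ε`, applying the
corrected kernel to `w (A + 1) u` is applying the Cauchy kernel to `w A u`. Integrating by parts
with exponent `1 - n/2` cancels `n - 2` and leaves the coefficient `1/2` twice. -/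
theorem integral_regKer_cauchy_add (hn : 3 ≤ n) (w : Sph n) {ε : ℝ} (hε : 0 < ε) (u : ClPoly n) :
    ∫ v : Sph n, regKer (w : Eu n) ε (-(n : ℝ) / 2) v • (star (para ((w : Eu n) - (v : Eu n))) *
        ev (v : Eu n) (opPara (opA n u + u))) ∂(surf n) +
      ∫ v : Sph n, (-((n : ℝ) - 2)⁻¹ * regKer (w : Eu n) ε (1 - (n : ℝ) / 2) v) •
        ev (v : Eu n) (opA n u + u) ∂(surf n) =
      ∫ v : Sph n, regKer (w : Eu n) ε (-(n : ℝ) / 2) v • (star (para ((w : Eu n) - (v : Eu n))) *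
        ev (v : Eu n) (opPara (opA n u))) ∂(surf n) +
      ∫ v : Sph n, (ε / 2 * regKer (w : Eu n) ε (-(n : ℝ) / 2) v) • ev (v : Eu n) u ∂(surf n) := by
  have hn2 : ((n : ℝ) - 2) ≠ 0 := by
    have : (3 : ℝ) ≤ n := by exact_mod_cast hn
    linarith
  set φ : Sph n → ℝ := fun v => regKer (w : Eu n) ε (-(n : ℝ) / 2) v with hφ
  set ρ : Sph n → ℝ := fun v => regKer (w : Eu n) ε (1 - (n : ℝ) / 2) v with hρ
  have hφc : Continuous φ := continuous_regKer _ hε _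
  have hρc : Continuous ρ := continuous_regKer _ hε _
  have hpc : Continuous fun v : Sph n => para (v : Eu n) :=
    continuous_para.comp continuous_subtype_val
  have hconj : Continuous fun v : Sph n => star (para ((w : Eu n) - (v : Eu n))) :=
    (continuous_para.comp (continuous_const.sub continuous_subtype_val)).star
  have h1 := integral_regKer_smul_opGam (w : Eu n) hε (1 - (n : ℝ) / 2) u
  rw [show (1 : ℝ) - n / 2 - 1 = -(n : ℝ) / 2 by ring] at h1
  have hiA : ∀ y : ClPoly n, Integrable (fun v : Sph n =>
      φ v • (star (para ((w : Eu n) - (v : Eu n))) * ev (v : Eu n) y)) (surf n) := fun y =>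
    integrable_of_continuous_sph (hφc.smul (hconj.mul (continuous_ev y)))
  have hiρ : ∀ y : ClPoly n, Integrable (fun v : Sph n => ρ v • ev (v : Eu n) y) (surf n) :=
    fun y => integrable_of_continuous_sph (hρc.smul (continuous_ev y))
  have hiB : Integrable (fun v : Sph n => φ v • ((star (para (v : Eu n)) * para (w : Eu n) -
      star (para (w : Eu n)) * para (v : Eu n)) * ev (v : Eu n) u)) (surf n) :=
    integrable_of_continuous_sph (hφc.smul (((hpc.star.mul continuous_const).sub
      (continuous_const.mul hpc)).mul (continuous_ev u)))
  have hiρ' : ∀ (c : ℝ) (y : ClPoly n),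
      Integrable (fun v : Sph n => c • ρ v • ev (v : Eu n) y) (surf n) := fun c y =>
    (hiρ y).smul c
  have hiB' : Integrable (fun v : Sph n => (1 / 2 : ℝ) • φ v • ((star (para (v : Eu n)) *
      para (w : Eu n) - star (para (w : Eu n)) * para (v : Eu n)) * ev (v : Eu n) u)) (surf n) :=
    hiB.smul (1 / 2 : ℝ)
  have e1 : ∫ v : Sph n, φ v • (star (para ((w : Eu n) - (v : Eu n))) *
        ev (v : Eu n) (opPara (opA n u + u))) ∂(surf n) =
      ∫ v : Sph n, φ v • (star (para ((w : Eu n) - (v : Eu n))) *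
        ev (v : Eu n) (opPara (opA n u))) ∂(surf n) +
      ∫ v : Sph n, φ v • (star (para ((w : Eu n) - (v : Eu n))) *
        ev (v : Eu n) (opPara u)) ∂(surf n) := by
    rw [← integral_add (hiA _) (hiA _)]
    congr 1
    funext v
    rw [map_add, map_add, mul_add, smul_add]
  have e2 : ∫ v : Sph n, (-((n : ℝ) - 2)⁻¹ * ρ v) • ev (v : Eu n) (opA n u + u) ∂(surf n) =
      (-((n : ℝ) - 2)⁻¹) • (∫ v : Sph n, ρ v • ev (v : Eu n) (opGam u) ∂(surf n)) +
        (1 / 2 : ℝ) • ∫ v : Sph n, ρ v • ev (v : Eu n) u ∂(surf n) := by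
    rw [← integral_smul, ← integral_smul, ← integral_add (hiρ' _ _) (hiρ' _ _)]
    congr 1
    funext v
    rw [opA_apply, map_add, map_sub, map_smul, mul_smul, smul_add, smul_sub, smul_add, smul_sub,
      smul_smul, smul_smul, smul_smul, smul_smul]
    have : -((n : ℝ) - 2)⁻¹ * ρ v * (n / 2) = -((n : ℝ) - 2)⁻¹ * ρ v - 1 / 2 * ρ v := by
      field_simp
      ring
    rw [this]
    module
  have e3 : (-((n : ℝ) - 2)⁻¹) • (∫ v : Sph n, ρ v • ev (v : Eu n) (opGam u) ∂(surf n)) =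
      (1 / 2 : ℝ) • ∫ v : Sph n, φ v • ((star (para (v : Eu n)) * para (w : Eu n) -
        star (para (w : Eu n)) * para (v : Eu n)) * ev (v : Eu n) u) ∂(surf n) := by
    have h2 : ∫ v : Sph n, ρ v • ev (v : Eu n) (opGam u) ∂(surf n) = (1 - (n : ℝ) / 2) •
        ∫ v : Sph n, φ v • ((star (para (v : Eu n)) * para (w : Eu n) -
          star (para (w : Eu n)) * para (v : Eu n)) * ev (v : Eu n) u) ∂(surf n) := by
      refine h1.trans ?_
      rw [← integral_smul]
      simp only [mul_smul, hφ]
    rw [h2, smul_smul]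
    congr 1
    field_simp
    ring
  rw [e1, e2, e3, add_assoc]
  congr 1
  rw [← integral_smul, ← integral_smul, ← integral_add hiB' (hiρ' _ _)]
  refine (integral_add (hiA _) (hiB'.add (hiρ' _ _))).symm.trans ?_
  congr 1
  funext v
  simp only [Pi.add_apply]
  refine cauchy_add_algebra w v _ ?_ u
  simp only [hφ, hρ, regKer]
  rw [← Real.rpow_add_one (regBase_pos (w : Eu n) hε (v : Eu n)).ne']
  congr 1
  ring

theorem opGam_one : opGam ((1 : MvPolynomial (Fin (n + 1)) ℝ) ⊗ₜ[ℝ] (1 : Cl n)) = 0 := by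
  have h := two_smul_opGam ((1 : MvPolynomial (Fin (n + 1)) ℝ) ⊗ₜ[ℝ] (1 : Cl n))
  have h2 : ∀ i j, opRot i j ((1 : MvPolynomial (Fin (n + 1)) ℝ) ⊗ₜ[ℝ] (1 : Cl n)) = 0 := by
    intro i j
    simp [opRot]
  simp only [h2, map_zero, Finset.sum_const_zero] at h
  exact (smul_eq_zero.1 h).resolve_left two_ne_zero

end ClPoly

/-! ### Removing the regularization: estimates and limits as `ε → 0`. -/

theorem surf_singleton {n : ℕ} (hn : 0 < n) (w : Sph n) : surf n {w} = 0 := by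
  have h := lintegral_zonal hn (F := Set.indicator {1} 1)
    (measurable_one.indicator (measurableSet_singleton _)) w
  have h1 : ∫⁻ θ in Set.Ioo 0 Real.pi, ENNReal.ofReal (Real.sin θ ^ (n - 1)) *
      Set.indicator {1} 1 (Real.cos θ) = 0 := by
    rw [setLIntegral_congr_fun (g := fun _ => 0) measurableSet_Ioo]
    · simp
    · intro θ hθ
      have : Real.cos θ ≠ 1 := by
        intro h
        have := (Real.cos_eq_one_iff_of_lt_of_lt (by linarith [hθ.1, Real.pi_pos])
          (by linarith [hθ.2, Real.pi_pos])).1 h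
        exact hθ.1.ne' this
      simp [this]
  rw [h1, mul_zero] at h
  refine le_antisymm ?_ bot_le
  rw [← h, ← lintegral_indicator_one (measurableSet_singleton w)]
  refine lintegral_mono fun v => ?_
  by_cases hv : v = w
  · subst hv
    simp
  · simp [hv]

/-- Dominated convergence in the form used for every limit `ε → 0`; the diagonal point is null, so
behaviour there is irrelevant. -/
theorem tendsto_integral_of_le_norm_sub_inv {n : ℕ} (hn : 0 < n) (w : Sph n)
    {f : ℕ → Sph n → Cl n} {g : Sph n → Cl n} (hf : ∀ k, Continuous (f k)) (C : ℝ)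
    (hb : ∀ k v, v ≠ w → ‖f k v‖ ≤ C * (‖(w : Eu n) - v‖ ^ (n - 1))⁻¹)
    (hlim : ∀ v, v ≠ w → Filter.Tendsto (fun k => f k v) Filter.atTop (nhds (g v))) :
    Filter.Tendsto (fun k => ∫ v, f k v ∂(surf n)) Filter.atTop (nhds (∫ v, g v ∂(surf n))) := by
  have hae : ∀ᵐ v ∂(surf n), v ≠ w := by
    rw [ae_iff]
    simpa using surf_singleton hn w
  refine tendsto_integral_of_dominated_convergence _
    (fun k => (hf k).aestronglyMeasurable) ((integrable_norm_sub_inv hn w).const_mul C) ?_ ?_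
  · exact fun k => hae.mono fun v hv => hb k v hv
  · exact hae.mono fun v hv => hlim v hv

theorem norm_sub_pos_of_ne {n : ℕ} {v w : Sph n} (h : v ≠ w) : 0 < ‖(v : Eu n) - w‖ :=
  norm_pos_iff.2 (sub_ne_zero.2 fun e => h (Subtype.ext e))

theorem sq_rpow_neg_half {r : ℝ} (hr : 0 < r) (n : ℕ) : (r ^ 2) ^ (-(n : ℝ) / 2) = (r ^ n)⁻¹ := by
  rw [← Real.rpow_natCast r 2, ← Real.rpow_mul hr.le, ← Real.rpow_natCast r n,
    ← Real.rpow_neg hr.le]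
  congr 1
  push_cast
  ring

theorem sq_rpow_one_sub_half {r : ℝ} (hr : 0 < r) {n : ℕ} (hn : 2 ≤ n) :
    (r ^ 2) ^ (1 - (n : ℝ) / 2) = (r ^ (n - 2))⁻¹ := by
  rw [← sq_rpow_neg_half hr, Nat.cast_sub hn]
  congr 1
  push_cast
  ring

theorem regKer_nonneg {n : ℕ} (w : Eu n) {ε : ℝ} (hε : 0 < ε) (p : ℝ) (x : Eu n) :
    0 ≤ regKer w ε p x :=
  Real.rpow_nonneg (regBase_pos w hε x).le _

theorem regKer_le {n : ℕ} {w v : Sph n} (h : v ≠ w) {ε p : ℝ} (hε : 0 < ε) (hp : p ≤ 0) :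
    regKer (w : Eu n) ε p v ≤ (‖(v : Eu n) - w‖ ^ 2) ^ p := by
  have := norm_sub_pos_of_ne h
  exact Real.rpow_le_rpow_of_nonpos (by positivity) (by linarith) hp

theorem tendsto_regKer {n : ℕ} {w v : Sph n} (h : v ≠ w) (p : ℝ) {ε : ℕ → ℝ}
    (hε : Filter.Tendsto ε Filter.atTop (nhds 0)) :
    Filter.Tendsto (fun k => regKer (w : Eu n) (ε k) p v) Filter.atTop
      (nhds ((‖(v : Eu n) - w‖ ^ 2) ^ p)) := by
  have hpos := norm_sub_pos_of_ne h
  have h1 : Filter.Tendsto (fun k => ‖(v : Eu n) - w‖ ^ 2 + ε k) Filter.atTop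
      (nhds (‖(v : Eu n) - w‖ ^ 2)) := by
    simpa using hε.const_add (‖(v : Eu n) - w‖ ^ 2)
  exact h1.rpow_const (Or.inl (by positivity))

theorem norm_sub_inv_le {n : ℕ} (hn : 2 ≤ n) {w v : Sph n} (h : v ≠ w) :
    (‖(v : Eu n) - w‖ ^ (n - 2))⁻¹ ≤ 2 * (‖(v : Eu n) - w‖ ^ (n - 1))⁻¹ := by
  have hpos := norm_sub_pos_of_ne h
  have h2 : ‖(v : Eu n) - w‖ ≤ 2 := by
    refine (norm_sub_le _ _).trans ?_
    rw [norm_eq_of_mem_sphere, norm_eq_of_mem_sphere]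
    norm_num
  rw [show n - 1 = (n - 2) + 1 by omega, pow_succ, mul_inv]
  have h3 : 1 ≤ 2 * ‖(v : Eu n) - w‖⁻¹ := by
    rw [← div_eq_mul_inv, one_le_div hpos]
    exact h2
  have h4 : 0 ≤ (‖(v : Eu n) - w‖ ^ (n - 2))⁻¹ := by positivity
  nlinarith

theorem norm_star_para_mul {n : ℕ} (x : Eu n) (a : Cl n) : ‖star (para x) * a‖ = ‖x‖ * ‖a‖ := by
  have h := para_mul_star_add x x
  rw [real_inner_self_eq_norm_sq, ← two_smul ℝ (para _ * _), map_mul, map_ofNat] at h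
  have h2 : para x * star (para x) = algebraMap ℝ (Cl n) (‖x‖ ^ 2) := by
    refine smul_right_injective _ (two_ne_zero (α := ℝ)) (h.trans ?_)
    simp [two_smul, two_mul]
  rw [← sq_eq_sq₀ (norm_nonneg _) (by positivity), ← real_inner_self_eq_norm_sq,
    inner_mul_left_Cl, star_star, ← mul_assoc, h2, ← Algebra.smul_def, inner_smul_right,
    real_inner_self_eq_norm_sq, mul_pow]

theorem norm_para_mul {n : ℕ} (x : Eu n) (a : Cl n) : ‖para x * a‖ = ‖x‖ * ‖a‖ := by
  have h := star_para_mul_add x x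
  rw [real_inner_self_eq_norm_sq, ← two_smul ℝ (star (para _) * _), map_mul, map_ofNat] at h
  have h2 : star (para x) * para x = algebraMap ℝ (Cl n) (‖x‖ ^ 2) := by
    refine smul_right_injective _ (two_ne_zero (α := ℝ)) (h.trans ?_)
    simp [two_smul, two_mul]
  rw [← sq_eq_sq₀ (norm_nonneg _) (by positivity), ← real_inner_self_eq_norm_sq,
    inner_mul_left_Cl, ← mul_assoc, h2, ← Algebra.smul_def, inner_smul_right,
    real_inner_self_eq_norm_sq, mul_pow]

theorem exists_norm_le_of_continuous_sph {n : ℕ} {F : Sph n → Cl n} (hF : Continuous F) :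
    ∃ C, 0 ≤ C ∧ ∀ v, ‖F v‖ ≤ C := by
  obtain ⟨C, hC⟩ := isCompact_univ.exists_bound_of_continuousOn (f := F) hF.continuousOn
  exact ⟨max C 0, le_max_right _ _, fun v => (hC v trivial).trans (le_max_left _ _)⟩

theorem norm_pow_inv_mul {n : ℕ} (hn : 0 < n) {r : ℝ} (hr : 0 < r) :
    (r ^ n)⁻¹ * r = (r ^ (n - 1))⁻¹ := by
  obtain ⟨m, rfl⟩ : ∃ m, n = m + 1 := ⟨n - 1, by omega⟩
  rw [pow_succ, Nat.add_sub_cancel]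
  field_simp

theorem norm_pow_inv_mul_sq {n : ℕ} (hn : 2 ≤ n) {r : ℝ} (hr : 0 < r) :
    (r ^ n)⁻¹ * r ^ 2 = (r ^ (n - 2))⁻¹ := by
  obtain ⟨m, rfl⟩ : ∃ m, n = m + 2 := ⟨n - 2, by omega⟩
  rw [pow_add, Nat.add_sub_cancel]
  field_simp

namespace ClPoly

variable {n : ℕ}

theorem exists_lipschitz_ev (u : ClPoly n) : ∃ L, 0 ≤ L ∧ ∀ v w : Sph n,
    ‖ev (v : Eu n) u - ev (w : Eu n) u‖ ≤ L * ‖(v : Eu n) - w‖ := by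
  have hd : Differentiable ℝ fun x : Eu n => ev x u := (contDiff_ev u).differentiable (by simp)
  have hc : Continuous (fderiv ℝ fun x : Eu n => ev x u) := (contDiff_ev u).continuous_fderiv (by simp)
  obtain ⟨C, hC⟩ := (isCompact_closedBall (0 : Eu n) 1).exists_bound_of_continuousOn hc.continuousOn
  refine ⟨max C 0, le_max_right _ _, fun v w => ?_⟩
  refine (convex_closedBall (0 : Eu n) 1).norm_image_sub_le_of_norm_fderiv_le (𝕜 := ℝ)
    (f := fun x : Eu n => ev x u) (fun x _ => hd x) (fun x hx => (hC x hx).trans (le_max_left _ _))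
    ?_ ?_
  · exact Metric.sphere_subset_closedBall w.2
  · exact Metric.sphere_subset_closedBall v.2

end ClPoly

theorem tendsto_one_div_succ :
    Filter.Tendsto (fun k : ℕ => 1 / ((k : ℝ) + 1)) Filter.atTop (nhds 0) :=
  tendsto_one_div_add_atTop_nhds_zero_nat

theorem tendsto_integral_regKer_cauchy {n : ℕ} (hn : 2 ≤ n) (w : Sph n) {F : Sph n → Cl n}
    (hF : Continuous F) :
    Filter.Tendsto (fun k : ℕ => ∫ v : Sph n, regKer (w : Eu n) (1 / ((k : ℝ) + 1)) (-(n : ℝ) / 2) v •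
      (star (para ((w : Eu n) - (v : Eu n))) * F v) ∂(surf n)) Filter.atTop
      (nhds (area n • opT Set.univ F w)) := by
  have hn0 : 0 < n := by omega
  have hpos : ∀ k : ℕ, 0 < 1 / ((k : ℝ) + 1) := fun k => by positivity
  obtain ⟨C, hC0, hC⟩ := exists_norm_le_of_continuous_sph hF
  have hconj : Continuous fun v : Sph n => star (para ((w : Eu n) - (v : Eu n))) :=
    (continuous_para.comp (continuous_const.sub continuous_subtype_val)).star
  rw [opT, setIntegral_univ, ← integral_smul]
  refine tendsto_integral_of_le_norm_sub_inv hn0 w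
    (fun k => (continuous_regKer _ (hpos k) _).smul (hconj.mul hF)) C ?_ ?_
  · intro k v hv
    have hr := norm_sub_pos_of_ne hv
    have h1 := regKer_le hv (hpos k) (p := -(n : ℝ) / 2) (by
      have : (0 : ℝ) ≤ n := Nat.cast_nonneg n
      linarith)
    rw [sq_rpow_neg_half hr] at h1
    rw [norm_smul, norm_star_para_mul, Real.norm_of_nonneg (regKer_nonneg _ (hpos k) _ _),
      ← norm_pow_inv_mul hn0 (by rwa [norm_sub_rev]), norm_sub_rev (w : Eu n)]
    have := mul_le_mul h1 (hC v) (norm_nonneg _) (by positivity)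
    nlinarith [norm_nonneg ((v : Eu n) - w)]
  · intro v hv
    have hr := norm_sub_pos_of_ne hv
    have h1 := tendsto_regKer hv (-(n : ℝ) / 2) tendsto_one_div_succ
    rw [sq_rpow_neg_half hr] at h1
    have h2 : area n • (kerG w v * F v) =
        (‖(v : Eu n) - w‖ ^ n)⁻¹ • (star (para ((w : Eu n) - (v : Eu n))) * F v) := by
      have := (area_pos hn0).ne'
      rw [kerG, smul_mul_assoc, smul_smul, ← mul_assoc, mul_inv_cancel₀ this, one_mul,
        norm_sub_rev]
    rw [h2]
    exact h1.smul_const _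

theorem continuous_regKer_mul_sq {n : ℕ} (w : Eu n) {ε : ℝ} (hε : 0 < ε) (p : ℝ) :
    Continuous fun v : Sph n => (regKer w ε p v * ‖(v : Eu n) - w‖ ^ 2) • (1 : Cl n) := by
  have h1 := continuous_regKer w hε p
  fun_prop

namespace ClPoly

variable {n : ℕ}

/-- Testing the Cauchy identity on the constant `u = 1`, which `Γ₀` kills, trades the concentrating
kernel for a weakly singular one and so avoids computing the mass of the approximate delta function
directly. -/
theorem integral_regKer_mul_unit (hn : 3 ≤ n) (w : Sph n) {ε : ℝ} (hε : 0 < ε) :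
    ∫ v : Sph n, ((n : ℝ) / 2 * (ε * regKer (w : Eu n) ε (-(n : ℝ) / 2 - 1) v)) •
        (star (para (w : Eu n)) * para (v : Eu n) + 1) ∂(surf n) =
      ((n : ℝ) / 4) • ∫ v : Sph n, (regKer (w : Eu n) ε (-(n : ℝ) / 2) v * ‖(v : Eu n) - w‖ ^ 2) •
        (1 : Cl n) ∂(surf n) := by
  have hn2 : (1 - (n : ℝ) / 2) ≠ 0 := by
    have : (3 : ℝ) ≤ n := by exact_mod_cast hn
    linarith
  have h0 := integral_regKer_cauchy w hε ((1 : MvPolynomial (Fin (n + 1)) ℝ) ⊗ₜ[ℝ] (1 : Cl n))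
  have h1 := integral_regKer_smul_opGam (w : Eu n) hε (1 - (n : ℝ) / 2)
    ((1 : MvPolynomial (Fin (n + 1)) ℝ) ⊗ₜ[ℝ] (1 : Cl n))
  have hev : ∀ x : Eu n, ev x ((1 : MvPolynomial (Fin (n + 1)) ℝ) ⊗ₜ[ℝ] (1 : Cl n)) = 1 := by
    intro x
    simp [ev_tmul]
  have hpc : Continuous fun v : Sph n => para (v : Eu n) :=
    continuous_para.comp continuous_subtype_val
  rw [show (1 : ℝ) - n / 2 - 1 = -(n : ℝ) / 2 by ring] at h1
  simp only [opGam_one, map_zero, smul_zero, integral_zero, hev, mul_one, mul_smul,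
    integral_smul] at h1
  have h2 := (smul_eq_zero.1 h1.symm).resolve_left hn2
  simp only [hev, mul_one] at h0
  -- Adding a multiple of the vanishing integral of the antisymmetric part `v̄ w - w̄ v` symmetrizes
  -- `1 - w̄ v` into `‖v - w‖² / 2`.
  refine h0.symm.trans ((?_ : _ = _ + ((n : ℝ) / 4) • (0 : Cl n)).trans (by rw [smul_zero, add_zero]))
  rw [← h2]
  have hA : Continuous fun v : Sph n => regKer (w : Eu n) ε (-(n : ℝ) / 2) v •
      (star (para (v : Eu n)) * para (w : Eu n) - star (para (w : Eu n)) * para (v : Eu n)) :=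
    (continuous_regKer _ hε _).smul ((hpc.star.mul continuous_const).sub
      (continuous_const.mul hpc))
  have hB : Continuous fun v : Sph n =>
      (regKer (w : Eu n) ε (-(n : ℝ) / 2) v * ‖(v : Eu n) - w‖ ^ 2) • (1 : Cl n) :=
    continuous_regKer_mul_sq _ hε _
  rw [← smul_add, ← integral_add (integrable_of_continuous_sph hB) (integrable_of_continuous_sph hA),
    ← integral_smul]
  congr 1
  funext v
  have hs : ‖(v : Eu n) - w‖ ^ 2 = 2 - 2 * inner ℝ (w : Eu n) (v : Eu n) := by
    rw [norm_sub_rev, norm_sub_sph_sq]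
  have hq : star (para (v : Eu n)) * para (w : Eu n) =
      (2 * inner ℝ (w : Eu n) (v : Eu n) : ℝ) • 1 - star (para (w : Eu n)) * para (v : Eu n) := by
    rw [eq_sub_iff_add_eq', star_para_mul_add, Algebra.algebraMap_eq_smul_one]
  rw [ev_opPara, opA_apply, map_sub, opGam_one, map_zero, map_smul, hev, hq, hs, para_sub, star_sub,
    sub_mul, ← mul_assoc, ← mul_assoc, star_para_mul_para, zero_sub, mul_neg, mul_neg, one_mul,
    mul_smul_comm, mul_one]
  module

theorem tendsto_integral_regKer_mul_unit (hn : 3 ≤ n) (w : Sph n) :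
    Filter.Tendsto (fun k : ℕ => ∫ v : Sph n,
      ((n : ℝ) / 2 * (1 / ((k : ℝ) + 1) * regKer (w : Eu n) (1 / ((k : ℝ) + 1)) (-(n : ℝ) / 2 - 1) v)) •
        (star (para (w : Eu n)) * para (v : Eu n) + 1) ∂(surf n)) Filter.atTop
      (nhds (area n • (1 : Cl n))) := by
  have hpos : ∀ k : ℕ, 0 < 1 / ((k : ℝ) + 1) := fun k => by positivity
  have hn0 : 0 < n := by omega
  have hn0' : (n : ℝ) ≠ 0 := by exact_mod_cast hn0.ne'
  simp only [integral_regKer_mul_unit hn w (hpos _)]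
  have h : area n • (1 : Cl n) = ((n : ℝ) / 4) •
      ∫ v : Sph n, ((‖(w : Eu n) - v‖ ^ (n - 2))⁻¹) • (1 : Cl n) ∂(surf n) := by
    rw [integral_smul_const, integral_norm_sub_inv (by omega), smul_smul]
    congr 1
    field_simp
  rw [h]
  have hc : ∀ k : ℕ, Continuous fun v : Sph n => (regKer (w : Eu n) (1 / ((k : ℝ) + 1))
      (-(n : ℝ) / 2) v * ‖(v : Eu n) - w‖ ^ 2) • (1 : Cl n) := fun k =>
    continuous_regKer_mul_sq _ (hpos k) _
  refine Filter.Tendsto.const_smul (tendsto_integral_of_le_norm_sub_inv hn0 w hc 2 ?_ ?_) _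
  · intro k v hv
    have hr := norm_sub_pos_of_ne hv
    have h1 := regKer_le hv (hpos k) (p := -(n : ℝ) / 2) (by
      have : (0 : ℝ) ≤ n := Nat.cast_nonneg n
      linarith)
    rw [sq_rpow_neg_half hr] at h1
    rw [norm_smul, norm_one_Cl, mul_one, norm_mul, norm_pow, norm_norm,
      Real.norm_of_nonneg (regKer_nonneg _ (hpos k) _ _), norm_sub_rev (w : Eu n)]
    refine le_trans ?_ (norm_sub_inv_le (by omega) hv)
    rw [← norm_pow_inv_mul_sq (by omega) hr]
    gcongr
  · intro v hv
    have hr := norm_sub_pos_of_ne hv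
    have h1 := tendsto_regKer hv (-(n : ℝ) / 2) tendsto_one_div_succ
    rw [sq_rpow_neg_half hr] at h1
    rw [norm_sub_rev (w : Eu n), ← norm_pow_inv_mul_sq (by omega) hr]
    exact (h1.mul_const _).smul_const _

/-- The left side is the limit of the regularized identity. On its right side `u(v)` is split as
`(u(v) - u(w)) + u(w)`: the first part tends to zero by Lipschitz continuity, the second carries the
total mass `area n`. -/
theorem opT_opPara_opA (hn : 3 ≤ n) (u : ClPoly n) (w : Sph n) :
    opT Set.univ (fun v : Sph n => ev (v : Eu n) (opPara (opA n u))) w = ev (w : Eu n) u := by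
  have hpos : ∀ k : ℕ, 0 < 1 / ((k : ℝ) + 1) := fun k => by positivity
  have hn0 : 0 < n := by omega
  have hpc : Continuous fun v : Sph n => para (v : Eu n) :=
    continuous_para.comp continuous_subtype_val
  have h1 := tendsto_integral_regKer_cauchy (by omega) w (continuous_ev (opPara (opA n u)))
  simp only [integral_regKer_cauchy w (hpos _) u] at h1
  have hδ : ∀ k : ℕ, Continuous fun v : Sph n => (n : ℝ) / 2 * (1 / ((k : ℝ) + 1) *
      regKer (w : Eu n) (1 / ((k : ℝ) + 1)) (-(n : ℝ) / 2 - 1) v) := fun k =>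
    continuous_const.mul (continuous_const.mul (continuous_regKer _ (hpos k) _))
  have hq : Continuous fun v : Sph n => star (para (w : Eu n)) * para (v : Eu n) + 1 :=
    (continuous_const.mul hpc).add continuous_const
  have hA : ∀ k : ℕ, Continuous fun v : Sph n => ((n : ℝ) / 2 * (1 / ((k : ℝ) + 1) *
      regKer (w : Eu n) (1 / ((k : ℝ) + 1)) (-(n : ℝ) / 2 - 1) v)) •
        ((star (para (w : Eu n)) * para (v : Eu n) + 1) *
          (ev (v : Eu n) u - ev (w : Eu n) u)) := fun k =>
    (hδ k).smul (hq.mul ((continuous_ev u).sub continuous_const))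
  have hB : ∀ k : ℕ, Continuous fun v : Sph n => ((n : ℝ) / 2 * (1 / ((k : ℝ) + 1) *
      regKer (w : Eu n) (1 / ((k : ℝ) + 1)) (-(n : ℝ) / 2 - 1) v)) •
        (star (para (w : Eu n)) * para (v : Eu n) + 1) := fun k => (hδ k).smul hq
  have hB' : ∀ k : ℕ, Continuous fun v : Sph n => (((n : ℝ) / 2 * (1 / ((k : ℝ) + 1) *
      regKer (w : Eu n) (1 / ((k : ℝ) + 1)) (-(n : ℝ) / 2 - 1) v)) •
        (star (para (w : Eu n)) * para (v : Eu n) + 1)) * ev (w : Eu n) u := fun k =>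
    (hB k).mul continuous_const
  obtain ⟨L, hL0, hL⟩ := exists_lipschitz_ev u
  have h2 : Filter.Tendsto (fun k : ℕ => ∫ v : Sph n, ((n : ℝ) / 2 * (1 / ((k : ℝ) + 1) *
      regKer (w : Eu n) (1 / ((k : ℝ) + 1)) (-(n : ℝ) / 2 - 1) v)) •
        ((star (para (w : Eu n)) * para (v : Eu n) + 1) *
          (ev (v : Eu n) u - ev (w : Eu n) u)) ∂(surf n)) Filter.atTop
      (nhds (∫ _ : Sph n, (0 : Cl n) ∂(surf n))) := by
    refine tendsto_integral_of_le_norm_sub_inv hn0 w hA (n / 2 * (2 * L)) ?_ ?_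
    · intro k v hv
      have hr := norm_sub_pos_of_ne hv
      have hp : -(n : ℝ) / 2 ≤ 0 := by
        have : (0 : ℝ) ≤ n := Nat.cast_nonneg n
        linarith
      have h3 := regKer_le hv (hpos k) hp
      rw [sq_rpow_neg_half hr] at h3
      -- The factor `ε` is absorbed by one power of the base `‖v - w‖² + ε`; the Lipschitz factor
      -- then reduces the singularity to the integrable exponent `n - 1`.
      have h4 : 1 / ((k : ℝ) + 1) * regKer (w : Eu n) (1 / ((k : ℝ) + 1)) (-(n : ℝ) / 2 - 1) v ≤
          regKer (w : Eu n) (1 / ((k : ℝ) + 1)) (-(n : ℝ) / 2) v := by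
        have hb := regBase_pos (w : Eu n) (hpos k) (v : Eu n)
        have : regKer (w : Eu n) (1 / ((k : ℝ) + 1)) (-(n : ℝ) / 2) v =
            (‖(v : Eu n) - w‖ ^ 2 + 1 / ((k : ℝ) + 1)) *
              regKer (w : Eu n) (1 / ((k : ℝ) + 1)) (-(n : ℝ) / 2 - 1) v := by
          simp only [regKer]
          rw [mul_comm, ← Real.rpow_add_one hb.ne', sub_add_cancel]
        rw [this]
        have h0 := regKer_nonneg (w : Eu n) (hpos k) (-(n : ℝ) / 2 - 1) v
        gcongr
        linarith [sq_nonneg ‖(v : Eu n) - w‖]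
      have h5 : ‖(star (para (w : Eu n)) * para (v : Eu n) + 1) *
          (ev (v : Eu n) u - ev (w : Eu n) u)‖ ≤ 2 * (L * ‖(v : Eu n) - w‖) := by
        rw [add_mul, one_mul, mul_assoc]
        refine (norm_add_le _ _).trans ?_
        rw [norm_star_para_mul, norm_para_mul, norm_eq_of_mem_sphere, norm_eq_of_mem_sphere]
        linarith [hL v w]
      have h0 := regKer_nonneg (w : Eu n) (hpos k) (-(n : ℝ) / 2 - 1) v
      rw [norm_smul, Real.norm_of_nonneg (by positivity), norm_sub_rev (w : Eu n),
        ← norm_pow_inv_mul hn0 hr]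
      calc _ ≤ (n : ℝ) / 2 * (‖(v : Eu n) - w‖ ^ n)⁻¹ * (2 * (L * ‖(v : Eu n) - w‖)) := by
            gcongr
            exact h4.trans h3
        _ = _ := by ring
    · intro v hv
      have h3 := ((tendsto_one_div_succ.mul (tendsto_regKer hv (-(n : ℝ) / 2 - 1)
        tendsto_one_div_succ)).const_mul ((n : ℝ) / 2)).smul_const
          ((star (para (w : Eu n)) * para (v : Eu n) + 1) * (ev (v : Eu n) u - ev (w : Eu n) u))
      simpa using h3
  have h3 : Filter.Tendsto (fun k : ℕ => (∫ v : Sph n, ((n : ℝ) / 2 * (1 / ((k : ℝ) + 1) *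
      regKer (w : Eu n) (1 / ((k : ℝ) + 1)) (-(n : ℝ) / 2 - 1) v)) •
        (star (para (w : Eu n)) * para (v : Eu n) + 1) ∂(surf n)) * ev (w : Eu n) u) Filter.atTop
      (nhds ((area n • (1 : Cl n)) * ev (w : Eu n) u)) :=
    (tendsto_integral_regKer_mul_unit hn w).mul tendsto_const_nhds
  have h4 := h2.add h3
  have h5 := tendsto_nhds_unique (h1.congr fun k => ?_) h4
  · rw [integral_zero, zero_add, smul_mul_assoc, one_mul] at h5
    exact smul_right_injective _ (area_pos hn0).ne' h5
  · have h6 := ((mulCl n).flip (ev (w : Eu n) u)).integral_comp_comm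
      (integrable_of_continuous_sph (hB k))
    simp only [ContinuousLinearMap.flip_apply, mulCl_apply] at h6
    rw [← h6, ← integral_add (integrable_of_continuous_sph (hA k))
      (integrable_of_continuous_sph (hB' k))]
    congr 1
    funext v
    rw [smul_mul_assoc, ← smul_add, ← mul_add, sub_add_cancel]

end ClPoly

/-! ### Bounds for the kernels -/

/-- Twice the third-order kernel is `(w̄ - v̄) H_s`, so it only replaces `w̄` by `v̄`. Acting on
data `v F(v)`, the second term becomes the scalar potential of `F`. -/
theorem kerPlus_eq {n : ℕ} (hn : 3 ≤ n) (w v : Sph n) :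
    kerPlus w v = kerG w v + kerH w v • star (para (v : Eu n)) := by
  have hn2 : ((n : ℝ) - 2) ≠ 0 := by
    have : (3 : ℝ) ≤ n := by exact_mod_cast hn
    linarith
  have h : (2 : ℝ) • kerG3 w v = kerH w v • star (para ((w : Eu n) - (v : Eu n))) := by
    rw [kerG3, kerH, smul_smul]
    congr 1
    field_simp
  rw [kerPlus, h, para_sub, star_sub]
  module

theorem stronglyMeasurable_kerG {n : ℕ} :
    StronglyMeasurable fun p : Sph n × Sph n => kerG p.1 p.2 := by
  have h1 : Measurable fun p : Sph n × Sph n =>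
      (area n)⁻¹ * (‖(p.1 : Eu n) - (p.2 : Eu n)‖ ^ n)⁻¹ := by fun_prop
  exact h1.stronglyMeasurable.smul (continuous_para.comp ((continuous_subtype_val.comp
    continuous_fst).sub (continuous_subtype_val.comp continuous_snd))).star.stronglyMeasurable

theorem stronglyMeasurable_kerPlus {n : ℕ} (hn : 3 ≤ n) :
    StronglyMeasurable fun p : Sph n × Sph n => kerPlus p.1 p.2 := by
  simp only [kerPlus_eq hn]
  have h1 : Measurable fun p : Sph n × Sph n => kerH p.1 p.2 := by
    unfold kerH
    fun_prop
  exact stronglyMeasurable_kerG.add (h1.stronglyMeasurable.smul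
    (continuous_para.comp (continuous_subtype_val.comp continuous_snd)).star.stronglyMeasurable)

theorem stronglyMeasurable_kerG_right {n : ℕ} (w : Sph n) :
    StronglyMeasurable fun v : Sph n => kerG w v := by
  have h := (stronglyMeasurable_kerG (n := n)).comp_measurable (measurable_prodMk_left (x := w))
  exact h

theorem stronglyMeasurable_kerPlus_right {n : ℕ} (hn : 3 ≤ n) (w : Sph n) :
    StronglyMeasurable fun v : Sph n => kerPlus w v := by
  have h := (stronglyMeasurable_kerPlus hn).comp_measurable (measurable_prodMk_left (x := w))
  exact h

theorem norm_kerG_mul_le {n : ℕ} (hn : 2 ≤ n) (w v : Sph n) (a : Cl n) :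
    ‖kerG w v * a‖ ≤ (area n)⁻¹ * ((‖(w : Eu n) - v‖ ^ (n - 1))⁻¹ * ‖a‖) := by
  have hn0 : 0 < n := by omega
  have hA := area_pos hn0
  rw [kerG, smul_mul_assoc, norm_smul, norm_star_para_mul, Real.norm_of_nonneg (by positivity)]
  rcases eq_or_ne w v with rfl | h
  · simp
    positivity
  · rw [← norm_pow_inv_mul hn0 (norm_sub_pos_of_ne h)]
    exact le_of_eq (by ring)

theorem norm_kerH_mul_le {n : ℕ} (hn : 3 ≤ n) (w v : Sph n) (a : Cl n) :
    ‖kerH w v • star (para (v : Eu n)) * a‖ ≤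
      2 * (area n)⁻¹ * ((‖(w : Eu n) - v‖ ^ (n - 1))⁻¹ * ‖a‖) := by
  have hA := area_pos (n := n) (by omega)
  have hn2 : (3 : ℝ) ≤ n := by exact_mod_cast hn
  have hn3 : ((n : ℝ) - 2)⁻¹ ≤ 1 := inv_le_one_of_one_le₀ (by linarith)
  have hn4 : 0 < ((n : ℝ) - 2)⁻¹ := inv_pos.2 (by linarith)
  rw [kerH, smul_mul_assoc, norm_smul, norm_star_para_mul, norm_eq_of_mem_sphere, one_mul, norm_neg,
    Real.norm_of_nonneg (by positivity)]
  -- On the diagonal the kernel is zero by the convention `0⁻¹ = 0`, which needs `n - 2 ≠ 0`.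
  rcases eq_or_ne w v with rfl | h
  · simp [show n - 2 ≠ 0 by omega]
    positivity
  · have h1 := norm_sub_inv_le (n := n) (by omega) h
    calc _ ≤ (area n)⁻¹ * 1 * (2 * (‖(w : Eu n) - v‖ ^ (n - 1))⁻¹) * ‖a‖ := by gcongr
      _ = _ := by ring

theorem norm_kerPlus_mul_le {n : ℕ} (hn : 3 ≤ n) (w v : Sph n) (a : Cl n) :
    ‖kerPlus w v * a‖ ≤ 3 * (area n)⁻¹ * ((‖(w : Eu n) - v‖ ^ (n - 1))⁻¹ * ‖a‖) := by
  rw [kerPlus_eq hn, add_mul]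
  refine (norm_add_le _ _).trans ?_
  linarith [norm_kerG_mul_le (n := n) (by omega) w v a, norm_kerH_mul_le hn w v a]

theorem integrable_of_le_norm_sub_inv {n : ℕ} (hn : 0 < n) (w : Sph n) {k F : Sph n → Cl n}
    (hk : StronglyMeasurable k) (hF : Continuous F) (C : ℝ)
    (h : ∀ v a, ‖k v * a‖ ≤ C * ((‖(w : Eu n) - v‖ ^ (n - 1))⁻¹ * ‖a‖)) :
    Integrable (fun v => k v * F v) (surf n) := by
  obtain ⟨B, hB0, hB⟩ := exists_norm_le_of_continuous_sph hF
  refine Integrable.mono' ((integrable_norm_sub_inv hn w).const_mul (|C| * B))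
    (hk.mul hF.stronglyMeasurable).aestronglyMeasurable (Filter.Eventually.of_forall fun v => ?_)
  calc _ ≤ _ := h v (F v)
    _ ≤ |C| * ((‖(w : Eu n) - v‖ ^ (n - 1))⁻¹ * B) := by
      gcongr
      · exact le_abs_self C
      · exact hB v
    _ = _ := by ring

namespace ClPoly

variable {n : ℕ}

theorem tendsto_integral_regKer_kerH (hn : 3 ≤ n) (w : Sph n) {F : Sph n → Cl n}
    (hF : Continuous F) :
    Filter.Tendsto (fun k : ℕ => ∫ v : Sph n, (-((n : ℝ) - 2)⁻¹ *
      regKer (w : Eu n) (1 / ((k : ℝ) + 1)) (1 - (n : ℝ) / 2) v) • F v ∂(surf n)) Filter.atTop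
      (nhds (area n • ∫ v : Sph n, kerH w v • F v ∂(surf n))) := by
  have hn0 : 0 < n := by omega
  have hn2 : (3 : ℝ) ≤ n := by exact_mod_cast hn
  have hn4 : 0 < ((n : ℝ) - 2)⁻¹ := inv_pos.2 (by linarith)
  have hpos : ∀ k : ℕ, 0 < 1 / ((k : ℝ) + 1) := fun k => by positivity
  obtain ⟨C, hC0, hC⟩ := exists_norm_le_of_continuous_sph hF
  have hc : ∀ k : ℕ, Continuous fun v : Sph n => (-((n : ℝ) - 2)⁻¹ *
      regKer (w : Eu n) (1 / ((k : ℝ) + 1)) (1 - (n : ℝ) / 2) v) • F v := fun k =>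
    (continuous_const.mul (continuous_regKer _ (hpos k) _)).smul hF
  rw [← integral_smul]
  refine tendsto_integral_of_le_norm_sub_inv hn0 w hc (((n : ℝ) - 2)⁻¹ * 2 * C) ?_ ?_
  · intro k v hv
    have hr := norm_sub_pos_of_ne hv
    have h1 := (regKer_le hv (hpos k) (p := 1 - (n : ℝ) / 2) (by linarith)).trans
      (sq_rpow_one_sub_half hr (by omega)).le
    have h2 := h1.trans (norm_sub_inv_le (by omega) hv)
    rw [norm_smul, norm_mul, norm_neg, Real.norm_of_nonneg hn4.le,
      Real.norm_of_nonneg (regKer_nonneg _ (hpos k) _ _), norm_sub_rev (w : Eu n)]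
    calc _ ≤ ((n : ℝ) - 2)⁻¹ * (2 * (‖(v : Eu n) - w‖ ^ (n - 1))⁻¹) * C := by
          gcongr
          exact hC v
      _ = _ := by ring
  · intro v hv
    have hr := norm_sub_pos_of_ne hv
    have h1 := tendsto_regKer hv (1 - (n : ℝ) / 2) tendsto_one_div_succ
    rw [sq_rpow_one_sub_half hr (by omega)] at h1
    have h2 : area n • kerH w v • F v =
        (-((n : ℝ) - 2)⁻¹ * (‖(v : Eu n) - w‖ ^ (n - 2))⁻¹) • F v := by
      have := (area_pos hn0).ne'
      rw [kerH, smul_smul, norm_sub_rev]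
      congr 1
      field_simp
    rw [h2]
    exact (h1.const_mul _).smul_const _

theorem tendsto_integral_eps_regKer (hn : 3 ≤ n) (w : Sph n) {F : Sph n → Cl n}
    (hF : Continuous F) :
    Filter.Tendsto (fun k : ℕ => ∫ v : Sph n, (1 / ((k : ℝ) + 1) / 2 *
      regKer (w : Eu n) (1 / ((k : ℝ) + 1)) (-(n : ℝ) / 2) v) • F v ∂(surf n)) Filter.atTop
      (nhds 0) := by
  have hn0 : 0 < n := by omega
  have hn2 : (3 : ℝ) ≤ n := by exact_mod_cast hn
  have hpos : ∀ k : ℕ, 0 < 1 / ((k : ℝ) + 1) := fun k => by positivity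
  obtain ⟨C, hC0, hC⟩ := exists_norm_le_of_continuous_sph hF
  have hc : ∀ k : ℕ, Continuous fun v : Sph n => (1 / ((k : ℝ) + 1) / 2 *
      regKer (w : Eu n) (1 / ((k : ℝ) + 1)) (-(n : ℝ) / 2) v) • F v := fun k =>
    (continuous_const.mul (continuous_regKer _ (hpos k) _)).smul hF
  rw [← integral_zero (Sph n) (Cl n) (μ := surf n)]
  refine tendsto_integral_of_le_norm_sub_inv hn0 w hc C ?_ ?_
  · intro k v hv
    have hr := norm_sub_pos_of_ne hv
    have h1 := (regKer_le hv (hpos k) (p := 1 - (n : ℝ) / 2) (by linarith)).trans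
      (sq_rpow_one_sub_half hr (by omega)).le
    have h2 := h1.trans (norm_sub_inv_le (by omega) hv)
    have h0 := regKer_nonneg (w : Eu n) (hpos k) (-(n : ℝ) / 2) v
    have h4 : 1 / ((k : ℝ) + 1) * regKer (w : Eu n) (1 / ((k : ℝ) + 1)) (-(n : ℝ) / 2) v ≤
        regKer (w : Eu n) (1 / ((k : ℝ) + 1)) (1 - (n : ℝ) / 2) v := by
      have hb := regBase_pos (w : Eu n) (hpos k) (v : Eu n)
      have : regKer (w : Eu n) (1 / ((k : ℝ) + 1)) (1 - (n : ℝ) / 2) v =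
          (‖(v : Eu n) - w‖ ^ 2 + 1 / ((k : ℝ) + 1)) *
            regKer (w : Eu n) (1 / ((k : ℝ) + 1)) (-(n : ℝ) / 2) v := by
        simp only [regKer]
        rw [mul_comm, ← Real.rpow_add_one hb.ne']
        congr 1
        ring
      rw [this]
      gcongr
      linarith [sq_nonneg ‖(v : Eu n) - w‖]
    rw [norm_smul, Real.norm_of_nonneg (mul_nonneg (by positivity) h0), norm_sub_rev (w : Eu n)]
    calc _ ≤ (‖(v : Eu n) - w‖ ^ (n - 1))⁻¹ * C := by
          gcongr
          · linarith
          · exact hC v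
      _ = _ := by ring
  · intro v hv
    have h3 := ((tendsto_one_div_succ.div_const 2).mul (tendsto_regKer hv (-(n : ℝ) / 2)
        tendsto_one_div_succ)).smul_const (F v)
    simpa using h3

/-- In the limit of `integral_regKer_cauchy_add` the `ε`-term disappears, so the `T⁺` transform of
`w (A + 1) u` equals the `T` transform of `w A u`, which is `u`. -/
theorem opTPlus_opPara_opA_add (hn : 3 ≤ n) (u : ClPoly n) (w : Sph n) :
    opTPlus Set.univ (fun v : Sph n => ev (v : Eu n) (opPara (opA n u + u))) w =
      ev (w : Eu n) u := by
  have hpos : ∀ k : ℕ, 0 < 1 / ((k : ℝ) + 1) := fun k => by positivity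
  have hn0 : 0 < n := by omega
  have hc := continuous_ev (opPara (opA n u + u))
  have h1 := (tendsto_integral_regKer_cauchy (by omega) w hc).add
    (tendsto_integral_regKer_kerH hn w (continuous_ev (opA n u + u)))
  have h2 := (tendsto_integral_regKer_cauchy (by omega) w (continuous_ev (opPara (opA n u)))).add
    (tendsto_integral_eps_regKer hn w (continuous_ev u))
  simp only [integral_regKer_cauchy_add hn w (hpos _) u] at h1
  have h3 := tendsto_nhds_unique h1 h2
  rw [opT_opPara_opA hn, add_zero, ← smul_add] at h3
  have h4 := smul_right_injective (Cl n) (area_pos hn0).ne' h3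
  refine Eq.trans ?_ h4
  rw [opTPlus, opT, setIntegral_univ, setIntegral_univ]
  have hG : Integrable (fun v : Sph n => kerG w v * ev (v : Eu n) (opPara (opA n u + u)))
      (surf n) :=
    integrable_of_le_norm_sub_inv hn0 w (stronglyMeasurable_kerG_right w) hc _ fun v a => norm_kerG_mul_le (by omega) w v a
  have hP : Integrable (fun v : Sph n => kerPlus w v * ev (v : Eu n) (opPara (opA n u + u)))
      (surf n) :=
    integrable_of_le_norm_sub_inv hn0 w (stronglyMeasurable_kerPlus_right hn w) hc _ fun v a => norm_kerPlus_mul_le hn w v a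
  rw [← sub_eq_iff_eq_add', ← integral_sub hP hG]
  congr 1
  funext v
  rw [kerPlus_eq hn, add_mul, add_sub_cancel_left, smul_mul_assoc, ev_opPara, ← mul_assoc,
    star_para_mul_para, one_mul]

end ClPoly

/-! ### Energy identities for Clifford-valued polynomials -/

namespace ClPoly

variable {n : ℕ}

/-- The `Cl_n`-valued inner product of the restrictions to the sphere. -/
noncomputable def clForm (n : ℕ) : ClPoly n →ₗ[ℝ] ClPoly n →ₗ[ℝ] Cl n :=
  have hi : ∀ u v : ClPoly n, Integrable (fun w : Sph n => star (ev (w : Eu n) u) * ev (w : Eu n) v)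
      (surf n) := fun u v =>
    integrable_of_continuous_sph ((continuous_ev u).star.mul (continuous_ev v))
  LinearMap.mk₂ ℝ (fun u v => ∫ w : Sph n, star (ev (w : Eu n) u) * ev (w : Eu n) v ∂(surf n))
    (fun u u' v => by
      rw [← integral_add (hi _ _) (hi _ _)]
      simp only [map_add, star_add, add_mul])
    (fun c u v => by
      rw [← integral_smul]
      simp only [map_smul, CliffordAlgebra.star_smul, smul_mul_assoc])
    (fun u v v' => by
      rw [← integral_add (hi _ _) (hi _ _)]
      simp only [map_add, mul_add])
    (fun c u v => by
      rw [← integral_smul]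
      simp only [map_smul, mul_smul_comm])

theorem clForm_apply (u v : ClPoly n) : clForm n u v =
    ∫ w : Sph n, star (ev (w : Eu n) u) * ev (w : Eu n) v ∂(surf n) := rfl

theorem contDiff_star_ev_mul_ev (u v : ClPoly n) :
    ContDiff ℝ 1 fun x : Eu n => star (ev x u) * ev x v := by
  have hu : ContDiff ℝ 1 fun x : Eu n => ev x u := (contDiff_ev u).of_le (by simp)
  have hv : ContDiff ℝ 1 fun x : Eu n => ev x v := (contDiff_ev v).of_le (by simp)
  have h : ContDiff ℝ 1 fun x : Eu n => ((mulCl n).comp (starCl n)) (ev x u) :=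
    ((mulCl n).comp (starCl n)).contDiff.comp hu
  exact h.clm_apply hv

theorem fderiv_star_ev_mul_ev (u v : ClPoly n) (x y : Eu n) :
    fderiv ℝ (fun x : Eu n => star (ev x u) * ev x v) x y =
      star (ev x u) * fderiv ℝ (fun x : Eu n => ev x v) x y +
        star (fderiv ℝ (fun x : Eu n => ev x u) x y) * ev x v := by
  have hu : DifferentiableAt ℝ (fun x : Eu n => ev x u) x :=
    (contDiff_ev u).differentiable (by simp) x
  have hv : DifferentiableAt ℝ (fun x : Eu n => ev x v) x :=
    (contDiff_ev v).differentiable (by simp) x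
  have h : HasFDerivAt (fun x : Eu n => ((mulCl n).comp (starCl n)) (ev x u))
      (((mulCl n).comp (starCl n)).comp (fderiv ℝ (fun x : Eu n => ev x u) x)) x :=
    ((mulCl n).comp (starCl n)).hasFDerivAt.comp x hu.hasFDerivAt
  have h2 := (h.clm_apply hv.hasFDerivAt).fderiv
  refine (DFunLike.congr_fun h2 y).trans ?_
  simp

theorem integrable_star_ev_mul_ev (u v : ClPoly n) :
    Integrable (fun w : Sph n => star (ev (w : Eu n) u) * ev (w : Eu n) v) (surf n) :=
  integrable_of_continuous_sph ((continuous_ev u).star.mul (continuous_ev v))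

theorem clForm_opRot (i j : Fin (n + 1)) (u v : ClPoly n) :
    clForm n (opRot i j u) v = -clForm n u (opRot i j v) := by
  have h := integral_rotation_eq_zero (contDiff_star_ev_mul_ev u v) i j
  rw [eq_neg_iff_add_eq_zero, clForm_apply, clForm_apply, add_comm,
    ← integral_add (integrable_star_ev_mul_ev _ _) (integrable_star_ev_mul_ev _ _), ← h]
  congr 1
  funext w
  rw [fderiv_star_ev_mul_ev, ev_opRot, ev_opRot]

theorem clForm_opC (a : Cl n) (u v : ClPoly n) :
    clForm n (opC a u) v = clForm n u (opC (star a) v) := by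
  simp only [clForm_apply, ev_opC, star_mul, mul_assoc]

theorem opC_opRot (a : Cl n) (i j : Fin (n + 1)) (u : ClPoly n) :
    opC a (opRot i j u) = opRot i j (opC a u) := by
  have : (opC a * opRot i j : Module.End ℝ (ClPoly n)) = opRot i j * opC a :=
    TensorProduct.ext' fun p c => by simp [opRot]
  exact LinearMap.congr_fun this u

/-- Taking adjoints exchanges `i` and `j` in the coefficient, and the sign from the skew rotation
field is undone by swapping its indices. This gives the symmetry of both Gamma operators. -/
theorem clForm_sum_opRot (a b : Fin (n + 1) → Cl n) (hab : ∀ i, star (a i) = b i) (u v : ClPoly n) :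
    clForm n (∑ i, ∑ j, opC (a i * b j) (opRot i j u)) v =
      clForm n u (∑ i, ∑ j, opC (a i * b j) (opRot i j v)) := by
  have hba : ∀ i, star (b i) = a i := fun i => by rw [← hab, star_star]
  simp only [map_sum, LinearMap.sum_apply]
  rw [Finset.sum_comm]
  refine Finset.sum_congr rfl fun i _ => Finset.sum_congr rfl fun j _ => ?_
  rw [clForm_opC, clForm_opRot, star_mul, hab, hba, ← opC_opRot, opRot_swap i j, ← map_neg]
  congr 1
  simp

theorem clForm_opGam (u v : ClPoly n) : clForm n (opGam u) v = clForm n u (opGam v) := by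
  have h := clForm_sum_opRot (fun i => star (paraUnit i)) paraUnit (fun i => star_star _) u v
  rw [← two_smul_opGam, ← two_smul_opGam, map_smul, map_smul, LinearMap.smul_apply] at h
  exact smul_right_injective _ two_ne_zero h

theorem clForm_opGamBar (u v : ClPoly n) : clForm n (opGamBar u) v = clForm n u (opGamBar v) := by
  have h := clForm_sum_opRot paraUnit (fun i => star (paraUnit i)) (fun i => rfl) u v
  rw [← two_smul_opGamBar, ← two_smul_opGamBar, map_smul, map_smul, LinearMap.smul_apply] at h
  exact smul_right_injective _ two_ne_zero h

/-- Restriction to the sphere as a continuous function. -/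
noncomputable def evC (n : ℕ) : ClPoly n →ₗ[ℝ] C(Sph n, Cl n) where
  toFun u := ⟨fun w => ev (w : Eu n) u, continuous_ev u⟩
  map_add' u v := by ext w; simp
  map_smul' c u := by ext w; simp

@[simp] theorem evC_apply (u : ClPoly n) (w : Sph n) : evC n u w = ev (w : Eu n) u := rfl

/-- Restriction to the sphere as an element of `L²`. -/
noncomputable def evL (n : ℕ) : ClPoly n →ₗ[ℝ] Lp (Cl n) 2 (surf n) :=
  (ContinuousMap.toLp 2 (surf n) ℝ).toLinearMap ∘ₗ evC n

theorem coeFn_evL (u : ClPoly n) : evL n u =ᵐ[surf n] fun w : Sph n => ev (w : Eu n) u :=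
  ContinuousMap.coeFn_toLp _ _

theorem inner_evL (u v : ClPoly n) : inner ℝ (evL n u) (evL n v) = scalarPart n (clForm n u v) := by
  have hi : Integrable (fun w : Sph n => star (ev (w : Eu n) u) * ev (w : Eu n) v) (surf n) :=
    integrable_of_continuous_sph ((continuous_ev u).star.mul (continuous_ev v))
  rw [L2.inner_def, clForm_apply, ← (scalarPart n).integral_comp_comm hi]
  refine integral_congr_ae ?_
  filter_upwards [coeFn_evL u, coeFn_evL v] with w hu hv
  rw [hu, hv, scalarPart_star_mul]

theorem inner_opRot (i j : Fin (n + 1)) (u v : ClPoly n) :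
    inner ℝ (evL n (opRot i j u)) (evL n v) = -inner ℝ (evL n u) (evL n (opRot i j v)) := by
  rw [inner_evL, inner_evL, clForm_opRot, map_neg]

theorem norm_evL_opPara (u : ClPoly n) : ‖evL n (opPara u)‖ = ‖evL n u‖ := by
  rw [← sq_eq_sq₀ (norm_nonneg _) (norm_nonneg _), ← real_inner_self_eq_norm_sq,
    ← real_inner_self_eq_norm_sq, inner_evL, inner_evL, clForm_apply, clForm_apply]
  simp only [ev_opPara, star_mul]
  congr 2
  funext w
  rw [mul_assoc, ← mul_assoc _ (para (w : Eu n)), star_para_mul_para, one_mul]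

theorem clForm_opPara (u v : ClPoly n) : clForm n (opPara u) (opPara v) = clForm n u v := by
  rw [clForm_apply, clForm_apply]
  simp only [ev_opPara, star_mul]
  congr 1
  funext w
  rw [mul_assoc, ← mul_assoc _ (para (w : Eu n)), star_para_mul_para, one_mul]

/-- The Weitzenböck-type identity for `Γ - n / 2`, where `Γ` is either of the two Gamma operators. -/
theorem sum_norm_opRot_sq {Γ : Module.End ℝ (ClPoly n)}
    (hs : ∀ u v, clForm n (Γ u) v = clForm n u (Γ v))
    (h : ∀ u, ∑ i, ∑ j, opRot i j (opRot i j u) = (2 : ℝ) • (((n : ℝ) - 1) • Γ u - Γ (Γ u)))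
    (u : ClPoly n) {a : ClPoly n} (ha : a = Γ u - ((n : ℝ) / 2) • u) :
    (1 / 2 : ℝ) * ∑ i, ∑ j, ‖evL n (opRot i j u)‖ ^ 2 =
      ‖evL n a‖ ^ 2 + inner ℝ (evL n a) (evL n u) - (n * (n - 2) / 4 : ℝ) * ‖evL n u‖ ^ 2 := by
  have h1 : ∑ i, ∑ j, ‖evL n (opRot i j u)‖ ^ 2 =
      -inner ℝ (evL n u) (evL n (∑ i, ∑ j, opRot i j (opRot i j u))) := by
    simp only [map_sum, inner_sum, ← Finset.sum_neg_distrib]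
    refine Finset.sum_congr rfl fun i _ => Finset.sum_congr rfl fun j _ => ?_
    rw [← inner_opRot, real_inner_self_eq_norm_sq]
  have h2 : inner ℝ (evL n u) (evL n (Γ (Γ u))) = ‖evL n (Γ u)‖ ^ 2 := by
    rw [inner_evL, ← hs, ← inner_evL, real_inner_self_eq_norm_sq]
  have h3 : evL n (Γ u) = evL n a + ((n : ℝ) / 2) • evL n u := by
    rw [ha, map_sub, map_smul, sub_add_cancel]
  rw [h1, h, map_smul, map_sub, map_smul, inner_smul_right, inner_sub_right, inner_smul_right, h2,
    h3, norm_add_sq_real, inner_add_right, inner_smul_right, inner_smul_right, norm_smul,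
    real_inner_self_eq_norm_sq, real_inner_comm (evL n u) (evL n a), mul_pow,
    Real.norm_eq_abs, sq_abs]
  ring

theorem sum_norm_opRot_sq_opA (u : ClPoly n) :
    (1 / 2 : ℝ) * ∑ i, ∑ j, ‖evL n (opRot i j u)‖ ^ 2 =
      ‖evL n (opA n u)‖ ^ 2 + inner ℝ (evL n (opA n u)) (evL n u) -
        (n * (n - 2) / 4 : ℝ) * ‖evL n u‖ ^ 2 :=
  sum_norm_opRot_sq clForm_opGam sum_opRot_opRot u (opA_apply u)

/-- The energy identity of `Γ̄₀` at `w u`, where the intertwining relation reverses the sign of the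
cross term; its left side is dropped as nonnegative. -/
theorem le_norm_opA_sub (u : ClPoly n) :
    (n * (n - 2) / 4 : ℝ) * ‖evL n u‖ ^ 2 ≤
      ‖evL n (opA n u)‖ ^ 2 - inner ℝ (evL n (opA n u)) (evL n u) := by
  have h := sum_norm_opRot_sq clForm_opGamBar sum_opRot_opRot' (opPara u) (opABar_apply (opPara u))
  have h1 : 0 ≤ (1 / 2 : ℝ) * ∑ i, ∑ j, ‖evL n (opRot i j (opPara u))‖ ^ 2 := by positivity
  rw [h, opABar_opPara, map_neg, norm_neg, inner_neg_left, norm_evL_opPara, norm_evL_opPara,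
    inner_evL, clForm_opPara, ← inner_evL] at h1
  linarith

theorem three_fourths_le (hn : 3 ≤ n) : (3 / 4 : ℝ) ≤ n * (n - 2) / 4 := by
  have : (3 : ℝ) ≤ n := by exact_mod_cast hn
  nlinarith

/-- Adding the two energy inequalities removes the cross term and leaves `‖A u‖² ≥ (n(n-2)/4) ‖u‖² ≥
(3/4) ‖u‖²`. -/
theorem norm_evL_le_opA (hn : 3 ≤ n) (u : ClPoly n) : ‖evL n u‖ ≤ 2 * ‖evL n (opA n u)‖ := by
  have h1 := le_norm_opA_sub u
  have h2 := sum_norm_opRot_sq_opA u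
  have h3 : 0 ≤ (1 / 2 : ℝ) * ∑ i, ∑ j, ‖evL n (opRot i j u)‖ ^ 2 := by positivity
  have h4 := three_fourths_le hn
  refine abs_le_of_sq_le_sq' ?_ (by positivity) |>.2
  nlinarith [sq_nonneg ‖evL n u‖]

/-- With `y = (A + 1) u` the energy identity yields `(3/4) ‖u‖² ≤ ‖y‖² - ⟨y, u⟩`, and `(3/4) t² ≤ 1
+ t` forces `t ≤ 2`. For `n = 3` the constant 2 is attained by constants. -/
theorem norm_evL_le_opA_add (hn : 3 ≤ n) (u : ClPoly n) :
    ‖evL n u‖ ≤ 2 * ‖evL n (opA n u + u)‖ := by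
  have h2 := sum_norm_opRot_sq_opA u
  have h3 : 0 ≤ (1 / 2 : ℝ) * ∑ i, ∑ j, ‖evL n (opRot i j u)‖ ^ 2 := by positivity
  have h4 := three_fourths_le hn
  have h5 : evL n (opA n u) = evL n (opA n u + u) - evL n u := by rw [map_add, add_sub_cancel_right]
  rw [h5, norm_sub_sq_real, inner_sub_left, real_inner_self_eq_norm_sq] at h2
  have h6 := (abs_le.1 (abs_real_inner_le_norm (evL n (opA n u + u)) (evL n u))).1
  by_contra! h7
  have h8 := norm_nonneg (evL n (opA n u + u))
  have h9 : 3 / 4 * ‖evL n u‖ ^ 2 ≤ (n * (n - 2) / 4 : ℝ) * ‖evL n u‖ ^ 2 := by gcongr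
  nlinarith

theorem norm_opRot_le (i j : Fin (n + 1)) (u : ClPoly n) :
    ‖evL n (opRot i j u)‖ ^ 2 ≤ ∑ i, ∑ j, ‖evL n (opRot i j u)‖ ^ 2 := by
  refine le_trans ?_ (Finset.single_le_sum (f := fun i => ∑ j, ‖evL n (opRot i j u)‖ ^ 2)
    (fun i _ => by positivity) (Finset.mem_univ i))
  exact Finset.single_le_sum (f := fun j => ‖evL n (opRot i j u)‖ ^ 2)
    (fun i _ => by positivity) (Finset.mem_univ j)

/-- The full sum of squares is at most `2 (‖A u‖² + ‖A u‖ ‖u‖) ≤ 6 ‖A u‖²`, and `6 ≤ 3²`. -/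
theorem norm_opRot_le_opA (hn : 3 ≤ n) (i j : Fin (n + 1)) (u : ClPoly n) :
    ‖evL n (opRot i j u)‖ ≤ 3 * ‖evL n (opA n u)‖ := by
  have h1 := norm_opRot_le i j u
  have h2 := sum_norm_opRot_sq_opA u
  have h4 := three_fourths_le hn
  have h5 := norm_evL_le_opA hn u
  have h6 := (abs_le.1 (abs_real_inner_le_norm (evL n (opA n u)) (evL n u))).2
  have h8 := norm_nonneg (evL n (opA n u))
  have h9 : 0 ≤ (n * (n - 2) / 4 : ℝ) * ‖evL n u‖ ^ 2 := by positivity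
  refine abs_le_of_sq_le_sq' ?_ (by positivity) |>.2
  nlinarith

theorem norm_opRot_le_opA_add (hn : 3 ≤ n) (i j : Fin (n + 1)) (u : ClPoly n) :
    ‖evL n (opRot i j u)‖ ≤ 3 * ‖evL n (opA n u + u)‖ := by
  have h1 := norm_opRot_le i j u
  have h2 := sum_norm_opRot_sq_opA u
  have h4 := three_fourths_le hn
  have h5 := norm_evL_le_opA_add hn u
  have h50 : evL n (opA n u) = evL n (opA n u + u) - evL n u := by rw [map_add, add_sub_cancel_right]
  rw [h50, norm_sub_sq_real, inner_sub_left, real_inner_self_eq_norm_sq] at h2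
  have h6 := (abs_le.1 (abs_real_inner_le_norm (evL n (opA n u + u)) (evL n u))).1
  have h8 := norm_nonneg (evL n (opA n u + u))
  have h9 : 0 ≤ (n * (n - 2) / 4 : ℝ) * ‖evL n u‖ ^ 2 := by positivity
  refine abs_le_of_sq_le_sq' ?_ (by positivity) |>.2
  nlinarith

end ClPoly

/-! ### Solvability and density for Clifford-valued polynomials -/

/-- Rank-nullity on the invariant space `M`: `R ∘ A` has no larger kernel than `R`, and its range
lies in that of `R`, so the ranges agree. Injectivity is asked only modulo `ker R`, since distinct
polynomials may agree on the sphere. -/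
theorem LinearMap.exists_apply_eq_of_ker_le {V W : Type*} [AddCommGroup V] [Module ℝ V]
    [AddCommGroup W] [Module ℝ W] (A : Module.End ℝ V) (R : V →ₗ[ℝ] W) (M : Submodule ℝ V)
    [FiniteDimensional ℝ M] (hA : ∀ u ∈ M, A u ∈ M) (hR : ∀ u, R (A u) = 0 → R u = 0) {f : V}
    (hf : f ∈ M) : ∃ u, R (A u) = R f := by
  set R₁ : M →ₗ[ℝ] W := R.domRestrict M
  set R₂ : M →ₗ[ℝ] W := (R ∘ₗ A).domRestrict M
  have hker : LinearMap.ker R₂ ≤ LinearMap.ker R₁ := fun u hu => hR u hu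
  have hrange : LinearMap.range R₂ ≤ LinearMap.range R₁ := by
    rintro _ ⟨u, rfl⟩
    exact ⟨⟨A u, hA u u.2⟩, rfl⟩
  have h1 := R₁.finrank_range_add_finrank_ker
  have h2 := R₂.finrank_range_add_finrank_ker
  have h3 := Submodule.finrank_mono hker
  have h4 : LinearMap.range R₂ = LinearMap.range R₁ :=
    Submodule.eq_of_le_of_finrank_le hrange (by omega)
  have h5 : R₁ ⟨f, hf⟩ ∈ LinearMap.range R₂ := h4 ▸ ⟨_, rfl⟩
  obtain ⟨u, hu⟩ := h5
  exact ⟨u, hu⟩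

/-- On each monomial the derivative vanishes or lowers the degree by one, which the variable
restores. Hence rotation fields preserve the finite-dimensional degree filtration. -/
theorem MvPolynomial.totalDegree_X_mul_pderiv_le {σ : Type*} (i j : σ) (p : MvPolynomial σ ℝ) :
    (X i * pderiv j p).totalDegree ≤ p.totalDegree := by
  classical
  have hm : ∀ s ∈ p.support, (X i * pderiv j (monomial s (p.coeff s))).totalDegree ≤
      p.totalDegree := by
    intro s hs
    rw [pderiv_monomial]
    by_cases hj : s j = 0
    · simp [hj]
    · refine (totalDegree_mul _ _).trans ?_
      rw [totalDegree_X]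
      refine le_trans ?_ (le_totalDegree hs)
      refine (add_le_add_right (totalDegree_monomial_le _ _) 1).trans (le_of_eq ?_)
      conv_rhs => rw [← Finsupp.sub_add_single_one_cancel hj, Finsupp.sum_add_index' (fun _ => rfl)
        (fun _ _ _ => rfl), Finsupp.sum_single_index rfl]
      exact add_comm _ _
  conv_lhs => rw [p.as_sum, map_sum, Finset.mul_sum]
  refine (totalDegree_finsetSum _ _).trans (Finset.sup_le hm)

namespace ClPoly

variable {n : ℕ}

/-- Clifford-valued polynomials of degree at most `k`. -/
noncomputable def degLE (n k : ℕ) : Submodule ℝ (ClPoly n) :=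
  LinearMap.range ((MvPolynomial.restrictTotalDegree (Fin (n + 1)) ℝ k).subtype.rTensor (Cl n))

instance (k : ℕ) : FiniteDimensional ℝ (degLE n k) := by
  unfold degLE
  infer_instance

theorem tmul_mem_degLE {k : ℕ} {p : MvPolynomial (Fin (n + 1)) ℝ} (hp : p.totalDegree ≤ k)
    (a : Cl n) : p ⊗ₜ[ℝ] a ∈ degLE n k :=
  ⟨⟨p, (MvPolynomial.mem_restrictTotalDegree _ _ _).2 hp⟩ ⊗ₜ[ℝ] a, rfl⟩

theorem exists_mem_degLE (u : ClPoly n) : ∃ k, u ∈ degLE n k := by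
  induction u using TensorProduct.induction_on with
  | zero => exact ⟨0, zero_mem _⟩
  | tmul p a => exact ⟨p.totalDegree, tmul_mem_degLE le_rfl a⟩
  | add u v hu hv =>
    obtain ⟨k, hk⟩ := hu
    obtain ⟨l, hl⟩ := hv
    have mono : ∀ {k l : ℕ}, k ≤ l → degLE n k ≤ degLE n l := by
      rintro k l h _ ⟨x, rfl⟩
      induction x using TensorProduct.induction_on with
      | zero => rw [map_zero]; exact zero_mem _
      | tmul p a => exact tmul_mem_degLE (((MvPolynomial.mem_restrictTotalDegree _ _ _).1 p.2).trans h) a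
      | add x y hx hy => rw [map_add]; exact add_mem hx hy
    exact ⟨max k l, add_mem (mono (le_max_left _ _) hk) (mono (le_max_right _ _) hl)⟩

theorem apply_mem_degLE {k : ℕ} (F : Module.End ℝ (ClPoly n))
    (hF : ∀ p : MvPolynomial (Fin (n + 1)) ℝ, p.totalDegree ≤ k → ∀ a : Cl n,
      F (p ⊗ₜ[ℝ] a) ∈ degLE n k) {u : ClPoly n} (hu : u ∈ degLE n k) : F u ∈ degLE n k := by
  obtain ⟨x, rfl⟩ := hu
  induction x using TensorProduct.induction_on with
  | zero => rw [map_zero, map_zero]; exact zero_mem _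
  | tmul p a => exact hF p ((MvPolynomial.mem_restrictTotalDegree _ _ _).1 p.2) a
  | add x y hx hy => rw [map_add, map_add]; exact add_mem hx hy

theorem opRot_mem_degLE {k : ℕ} (i j : Fin (n + 1)) {u : ClPoly n} (hu : u ∈ degLE n k) :
    opRot i j u ∈ degLE n k := by
  refine apply_mem_degLE _ (fun p hp a => ?_) hu
  exact sub_mem (tmul_mem_degLE ((MvPolynomial.totalDegree_X_mul_pderiv_le i j p).trans hp) a)
    (tmul_mem_degLE ((MvPolynomial.totalDegree_X_mul_pderiv_le j i p).trans hp) a)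

theorem opC_mem_degLE {k : ℕ} (b : Cl n) {u : ClPoly n} (hu : u ∈ degLE n k) :
    opC b u ∈ degLE n k :=
  apply_mem_degLE _ (fun _ hp _ => tmul_mem_degLE hp _) hu

theorem opA_mem_degLE {k : ℕ} {u : ClPoly n} (hu : u ∈ degLE n k) : opA n u ∈ degLE n k := by
  have h : opGam u = (1 / 2 : ℝ) • (2 : ℝ) • opGam u := by
    rw [smul_smul]
    norm_num
  rw [opA_apply, h, two_smul_opGam]
  refine sub_mem (Submodule.smul_mem _ _ (sum_mem fun i _ => sum_mem fun j _ => ?_))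
    (Submodule.smul_mem _ _ hu)
  exact opC_mem_degLE _ (opRot_mem_degLE i j hu)

theorem exists_evL_opA (hn : 3 ≤ n) (f : ClPoly n) : ∃ u, evL n (opA n u) = evL n f := by
  obtain ⟨k, hk⟩ := exists_mem_degLE f
  refine LinearMap.exists_apply_eq_of_ker_le (opA n) (evL n) (degLE n k)
    (fun u hu => opA_mem_degLE hu) (fun u hu => ?_) hk
  have h := norm_evL_le_opA hn u
  rw [hu, norm_zero, mul_zero] at h
  exact norm_le_zero_iff.1 h

theorem exists_evL_opA_add (hn : 3 ≤ n) (f : ClPoly n) : ∃ u, evL n (opA n u + u) = evL n f := by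
  obtain ⟨A, hA⟩ : ∃ A : Module.End ℝ (ClPoly n), ∀ u, A u = opA n u + u :=
    ⟨opA n + LinearMap.id, fun u => rfl⟩
  obtain ⟨k, hk⟩ := exists_mem_degLE f
  simp only [← hA]
  refine LinearMap.exists_apply_eq_of_ker_le A (evL n) (degLE n k) (fun u hu => ?_)
    (fun u hu => ?_) hk
  · rw [hA]
    exact add_mem (opA_mem_degLE hu) hu
  · have h := norm_evL_le_opA_add hn u
    rw [← hA, hu, norm_zero, mul_zero] at h
    exact norm_le_zero_iff.1 h

theorem ev_opPara_opParaStar (u : ClPoly n) (w : Sph n) :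
    ev (w : Eu n) (opPara (opParaStar u)) = ev (w : Eu n) u := by
  rw [ev_opPara, ev_opParaStar, ← mul_assoc, para_mul_star_para, one_mul]

theorem evL_congr {u v : ClPoly n} (h : ∀ w : Sph n, ev (w : Eu n) u = ev (w : Eu n) v) :
    evL n u = evL n v := by
  have : evC n u = evC n v := by
    ext1 w
    exact h w
  exact congrArg (ContinuousMap.toLp 2 (surf n) ℝ) this

theorem evL_opPara_congr {u v : ClPoly n} (h : evL n u = evL n v) :
    evL n (opPara u) = evL n (opPara v) := by
  rw [← sub_eq_zero, ← map_sub, ← map_sub, ← norm_eq_zero, norm_evL_opPara, map_sub, h, sub_self,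
    norm_zero]

theorem exists_evL_opPara_opA (hn : 3 ≤ n) (f : ClPoly n) :
    ∃ u, evL n (opPara (opA n u)) = evL n f := by
  obtain ⟨u, hu⟩ := exists_evL_opA hn (opParaStar f)
  exact ⟨u, (evL_opPara_congr hu).trans (evL_congr (ev_opPara_opParaStar f))⟩

theorem exists_evL_opPara_opA_add (hn : 3 ≤ n) (f : ClPoly n) :
    ∃ u, evL n (opPara (opA n u + u)) = evL n f := by
  obtain ⟨u, hu⟩ := exists_evL_opA_add hn (opParaStar f)
  exact ⟨u, (evL_opPara_congr hu).trans (evL_congr (ev_opPara_opParaStar f))⟩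

/-- The coordinate functions on the sphere. -/
noncomputable def coordC (n : ℕ) (i : Fin (n + 1)) : C(Sph n, ℝ) :=
  ⟨fun w => (w : Eu n) i, by fun_prop⟩

theorem aeval_coordC (p : MvPolynomial (Fin (n + 1)) ℝ) (w : Sph n) :
    MvPolynomial.aeval (coordC n) p w = MvPolynomial.aeval (w : Eu n) p := by
  induction p using MvPolynomial.induction_on with
  | C a => simp
  | add p q hp hq => simp [hp, hq]
  | mul_X p i hp => simp [hp, coordC]

/-- Stone-Weierstrass for scalar polynomials, applied to each coordinate in the basis of the
Clifford algebra. -/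
theorem denseRange_evC : DenseRange (evC n) := by
  have hS : (MvPolynomial.aeval (R := ℝ) (coordC n)).range.topologicalClosure = ⊤ := by
    refine ContinuousMap.subalgebra_topologicalClosure_eq_top_of_separatesPoints _ ?_
    intro x y hxy
    obtain ⟨i, hi⟩ : ∃ i, (x : Eu n) i ≠ (y : Eu n) i := by
      by_contra! h
      exact hxy (Subtype.ext (PiLp.ext h))
    exact ⟨coordC n i, ⟨coordC n i, ⟨MvPolynomial.X i, by simp⟩, rfl⟩, hi⟩
  have hmem : ∀ (f : C(Sph n, ℝ)) (a : Cl n),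
      (⟨fun w => f w • a, by fun_prop⟩ : C(Sph n, Cl n)) ∈
        (LinearMap.range (evC n)).topologicalClosure := by
    intro f a
    have hc : Continuous fun f : C(Sph n, ℝ) =>
        (⟨fun w => f w • a, by fun_prop⟩ : C(Sph n, Cl n)) := by
      refine ContinuousMap.continuous_of_continuous_uncurry _ ?_
      exact (by fun_prop : Continuous fun q : C(Sph n, ℝ) × Sph n => q.1 q.2 • a)
    have hf : f ∈ closure ((MvPolynomial.aeval (R := ℝ) (coordC n)).range : Set C(Sph n, ℝ)) := by
      have : f ∈ (MvPolynomial.aeval (R := ℝ) (coordC n)).range.topologicalClosure := by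
        rw [hS]
        trivial
      exact this
    refine map_mem_closure hc hf ?_
    rintro _ ⟨p, rfl⟩
    refine ⟨p ⊗ₜ[ℝ] a, ?_⟩
    ext1 w
    rw [evC_apply, ev_tmul]
    exact congrArg (· • a) (aeval_coordC p w).symm
  intro F
  have hF : F = ∑ A : Finset (Fin n), (⟨fun w => ((clBasis n).coord A).toContinuousLinearMap (F w) •
      clBasis n A, by fun_prop⟩ : C(Sph n, Cl n)) := by
    ext1 w
    rw [ContinuousMap.coe_sum, Finset.sum_apply]
    exact ((clBasis n).sum_repr (F w)).symm
  rw [hF]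
  have := Submodule.sum_mem (LinearMap.range (evC n)).topologicalClosure
    (t := Finset.univ) fun A _ => hmem
      ⟨fun w => ((clBasis n).coord A).toContinuousLinearMap (F w), by fun_prop⟩ (clBasis n A)
  exact this

theorem denseRange_evL : DenseRange (evL n) :=
  (ContinuousMap.toLp_denseRange (Cl n) (surf n) ℝ (by simp)).comp denseRange_evC
    (ContinuousMap.toLp 2 (surf n) ℝ).continuous

theorem denseRange_evL_opPara_opA (hn : 3 ≤ n) : DenseRange fun u => evL n (opPara (opA n u)) := by
  refine denseRange_evL.mono ?_
  rintro _ ⟨f, rfl⟩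
  exact exists_evL_opPara_opA hn f

theorem denseRange_evL_opPara_opA_add (hn : 3 ≤ n) :
    DenseRange fun u => evL n (opPara (opA n u + u)) := by
  refine denseRange_evL.mono ?_
  rintro _ ⟨f, rfl⟩
  exact exists_evL_opPara_opA_add hn f

end ClPoly

/-! ### Schur's test and the integral operators on `L²` -/

/-- Cauchy-Schwarz with the weight split as `κ^(1/2) · κ^(1/2) F`. -/
theorem sq_lintegral_mul_le {α : Type*} [MeasurableSpace α] (μ : Measure α) {κ F : α → ENNReal}
    (hκ : AEMeasurable κ μ) (hF : AEMeasurable F μ) :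
    (∫⁻ y, κ y * F y ∂μ) ^ (2 : ℝ) ≤ (∫⁻ y, κ y ∂μ) * ∫⁻ y, κ y * F y ^ (2 : ℝ) ∂μ := by
  have h := ENNReal.lintegral_mul_le_Lp_mul_Lq μ Real.HolderConjugate.two_two
    (hκ.pow_const (1 / 2 : ℝ)) ((hκ.pow_const (1 / 2 : ℝ)).mul hF)
  have e1 : ∀ y, κ y ^ (1 / 2 : ℝ) * κ y ^ (1 / 2 : ℝ) = κ y := fun y => by
    rw [← ENNReal.rpow_add_of_nonneg _ _ (by norm_num) (by norm_num)]
    norm_num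
  have e2 : ∀ y, (κ y ^ (1 / 2 : ℝ)) ^ (2 : ℝ) = κ y := fun y => by
    rw [← ENNReal.rpow_mul]
    norm_num
  have h2 := ENNReal.rpow_le_rpow h (zero_le_two (α := ℝ))
  rw [ENNReal.mul_rpow_of_nonneg _ _ (zero_le_two (α := ℝ)), ← ENNReal.rpow_mul,
    ← ENNReal.rpow_mul] at h2
  rw [one_div_mul_cancel two_ne_zero, ENNReal.rpow_one, ENNReal.rpow_one] at h2
  simpa only [Pi.mul_apply, ← mul_assoc, e1, e2,
    ENNReal.mul_rpow_of_nonneg _ _ (zero_le_two (α := ℝ))] using h2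

/-- Schur's test: the row bound enters through Cauchy-Schwarz, the column bound after exchanging the
order of integration. -/
theorem lintegral_sq_lintegral_mul_le {α : Type*} [MeasurableSpace α] (μ : Measure α) [SFinite μ]
    {κ : α → α → ENNReal} (hκ : Measurable (Function.uncurry κ)) {F : α → ENNReal}
    (hF : AEMeasurable F μ) {M : ENNReal} (h1 : ∀ x, ∫⁻ y, κ x y ∂μ ≤ M)
    (h2 : ∀ y, ∫⁻ x, κ x y ∂μ ≤ M) :
    ∫⁻ x, (∫⁻ y, κ x y * F y ∂μ) ^ (2 : ℝ) ∂μ ≤ M * (M * ∫⁻ y, F y ^ (2 : ℝ) ∂μ) := by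
  have hm : AEMeasurable (Function.uncurry fun x y => κ x y * F y ^ (2 : ℝ)) (μ.prod μ) :=
    hκ.aemeasurable.mul (hF.comp_snd.pow_const 2)
  have hm' : AEMeasurable (fun x => ∫⁻ y, κ x y * F y ^ (2 : ℝ) ∂μ) μ := hm.lintegral_prod_right'
  calc _ ≤ ∫⁻ x, M * ∫⁻ y, κ x y * F y ^ (2 : ℝ) ∂μ ∂μ := by
        refine lintegral_mono fun x => ?_
        refine (sq_lintegral_mul_le μ (hκ.of_uncurry_left (x := x)).aemeasurable hF).trans ?_
        gcongr
        exact h1 x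
    _ = M * ∫⁻ y, (∫⁻ x, κ x y ∂μ) * F y ^ (2 : ℝ) ∂μ := by
        rw [lintegral_const_mul'' _ hm', lintegral_lintegral_swap hm]
        congr 1
        refine lintegral_congr fun y => ?_
        rw [lintegral_mul_const _ (hκ.of_uncurry_right (y := y))]
    _ ≤ M * ∫⁻ y, M * F y ^ (2 : ℝ) ∂μ := by
        gcongr with y
        exact h2 y
    _ = _ := by rw [lintegral_const_mul'' _ (hF.pow_const 2)]

/-- A kernel on the sphere with the weak singularity `‖w - v‖ ^ (1 - n)`. -/
structure IsWeaklySingular {n : ℕ} (k : Sph n → Sph n → Cl n) : Prop where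
  stronglyMeasurable : StronglyMeasurable fun p : Sph n × Sph n => k p.1 p.2
  exists_bound : ∃ C : ℝ, 0 ≤ C ∧ ∀ w v a,
    ‖k w v * a‖ ≤ C * ((‖(w : Eu n) - v‖ ^ (n - 1))⁻¹ * ‖a‖)

theorem isWeaklySingular_kerG {n : ℕ} (hn : 2 ≤ n) :
    IsWeaklySingular (kerG : Sph n → Sph n → Cl n) :=
  ⟨stronglyMeasurable_kerG, _, inv_nonneg.2 (area_pos (by omega)).le, norm_kerG_mul_le hn⟩

theorem isWeaklySingular_kerPlus {n : ℕ} (hn : 3 ≤ n) :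
    IsWeaklySingular (kerPlus : Sph n → Sph n → Cl n) :=
  ⟨stronglyMeasurable_kerPlus hn, _, mul_nonneg zero_le_three
    (inv_nonneg.2 (area_pos (by omega)).le), norm_kerPlus_mul_le hn⟩

namespace IsWeaklySingular

variable {n : ℕ} {k : Sph n → Sph n → Cl n}

/-- The inner integral is of norms, so the bound gives absolute convergence almost everywhere as
well as boundedness on `L²`. The majorant depends only on the distance, so rows and columns have the
same bound. -/
theorem exists_lintegral_sq_le (hk : IsWeaklySingular k) (hn : 0 < n) :
    ∃ M : ENNReal, M ≠ ⊤ ∧ ∀ f : Sph n → Cl n, AEStronglyMeasurable f (surf n) →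
      ∫⁻ w, (∫⁻ v, ‖k w v * f v‖ₑ ∂(surf n)) ^ (2 : ℝ) ∂(surf n) ≤
        M * ∫⁻ v, ‖f v‖ₑ ^ (2 : ℝ) ∂(surf n) := by
  obtain ⟨C, hC0, hC⟩ := hk.exists_bound
  set κ : Sph n → Sph n → ENNReal := fun w v =>
    ENNReal.ofReal (C * (‖(w : Eu n) - v‖ ^ (n - 1))⁻¹) with hκdef
  have hκ : Measurable (Function.uncurry κ) := by
    simp only [hκdef, Function.uncurry_def]
    fun_prop
  set M : ENNReal := ENNReal.ofReal C * ENNReal.ofReal (area n * Real.pi)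
  have h1 : ∀ w, ∫⁻ v, κ w v ∂(surf n) ≤ M := by
    intro w
    simp only [hκdef, ENNReal.ofReal_mul hC0]
    rw [lintegral_const_mul' _ _ ENNReal.ofReal_ne_top]
    exact mul_le_mul' le_rfl (lintegral_norm_sub_inv_le hn w)
  have h2 : ∀ v, ∫⁻ w, κ w v ∂(surf n) ≤ M := by
    intro v
    refine le_trans (le_of_eq (lintegral_congr fun w => ?_)) (h1 v)
    simp only [hκdef]
    rw [norm_sub_rev]
  refine ⟨M * M, ENNReal.mul_ne_top (ENNReal.mul_ne_top ENNReal.ofReal_ne_top ENNReal.ofReal_ne_top)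
    (ENNReal.mul_ne_top ENNReal.ofReal_ne_top ENNReal.ofReal_ne_top), fun f hf => ?_⟩
  refine le_trans (lintegral_mono fun w => ?_)
    ((lintegral_sq_lintegral_mul_le (surf n) hκ hf.enorm h1 h2).trans_eq (mul_assoc _ _ _).symm)
  refine ENNReal.rpow_le_rpow (lintegral_mono fun v => ?_) zero_le_two
  simp only [hκdef]
  rw [← ofReal_norm, ← ofReal_norm, ← ENNReal.ofReal_mul (by positivity)]
  refine ENNReal.ofReal_le_ofReal ((hC w v (f v)).trans_eq (mul_assoc _ _ _).symm)

theorem aestronglyMeasurable_mul (hk : IsWeaklySingular k) {f : Sph n → Cl n}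
    (hf : AEStronglyMeasurable f (surf n)) :
    AEStronglyMeasurable (fun p : Sph n × Sph n => k p.1 p.2 * f p.2)
      ((surf n).prod (surf n)) :=
  hk.stronglyMeasurable.aestronglyMeasurable.mul hf.comp_snd

theorem lintegral_enorm_sq_lt_top {f : Sph n → Cl n} (hf : MemLp f 2 (surf n)) :
    ∫⁻ v, ‖f v‖ₑ ^ (2 : ℝ) ∂(surf n) < ⊤ := by
  simpa using lintegral_rpow_enorm_lt_top_of_eLpNorm_lt_top two_ne_zero ENNReal.ofNat_ne_top
    hf.eLpNorm_lt_top

theorem ae_integrable (hk : IsWeaklySingular k) (hn : 0 < n) {f : Sph n → Cl n}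
    (hf : MemLp f 2 (surf n)) : ∀ᵐ w ∂(surf n), Integrable (fun v => k w v * f v) (surf n) := by
  obtain ⟨M, hM, h⟩ := hk.exists_lintegral_sq_le hn
  have hm := hk.aestronglyMeasurable_mul hf.1
  have h1 := (h f hf.1).trans_lt (ENNReal.mul_lt_top hM.lt_top (lintegral_enorm_sq_lt_top hf))
  have h2 := ae_lt_top' ((hm.enorm.lintegral_prod_right').pow_const 2) h1.ne
  filter_upwards [h2, hm.prodMk_left] with w hw hw2
  refine ⟨hw2, ?_⟩
  exact (ENNReal.rpow_lt_top_iff_of_pos zero_lt_two).1 hw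

theorem exists_eLpNorm_le (hk : IsWeaklySingular k) (hn : 0 < n) :
    ∃ M : ENNReal, M ≠ ⊤ ∧ ∀ f : Sph n → Cl n, MemLp f 2 (surf n) →
      eLpNorm (fun w => ∫ v, k w v * f v ∂(surf n)) 2 (surf n) ≤ M * eLpNorm f 2 (surf n) := by
  obtain ⟨M, hM, h⟩ := hk.exists_lintegral_sq_le hn
  refine ⟨M ^ (1 / 2 : ℝ), ENNReal.rpow_ne_top_of_nonneg (by norm_num) hM, fun f hf => ?_⟩
  rw [eLpNorm_eq_lintegral_rpow_enorm_toReal two_ne_zero ENNReal.ofNat_ne_top,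
    eLpNorm_eq_lintegral_rpow_enorm_toReal two_ne_zero ENNReal.ofNat_ne_top,
    ENNReal.toReal_ofNat, ← ENNReal.mul_rpow_of_nonneg _ _ (by norm_num)]
  refine ENNReal.rpow_le_rpow ((lintegral_mono fun w => ?_).trans (h f hf.1)) (by norm_num)
  exact ENNReal.rpow_le_rpow (enorm_integral_le_lintegral_enorm _) zero_le_two

theorem memLp (hk : IsWeaklySingular k) (hn : 0 < n) {f : Sph n → Cl n}
    (hf : MemLp f 2 (surf n)) : MemLp (fun w => ∫ v, k w v * f v ∂(surf n)) 2 (surf n) := by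
  obtain ⟨M, hM, h⟩ := hk.exists_eLpNorm_le hn
  exact ⟨(hk.aestronglyMeasurable_mul hf.1).integral_prod_right',
    (h f hf).trans_lt (ENNReal.mul_lt_top hM.lt_top hf.2)⟩

/-- The bounded operator on `L²` with a weakly singular kernel. -/
theorem exists_clm (hk : IsWeaklySingular k) (hn : 0 < n) :
    ∃ T : Lp (Cl n) 2 (surf n) →L[ℝ] Lp (Cl n) 2 (surf n), ∀ f : Lp (Cl n) 2 (surf n),
      T f =ᵐ[surf n] fun w => ∫ v, k w v * f v ∂(surf n) := by
  obtain ⟨M, hM, h⟩ := hk.exists_eLpNorm_le hn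
  let T₀ : Lp (Cl n) 2 (surf n) →ₗ[ℝ] Lp (Cl n) 2 (surf n) :=
    { toFun := fun f => (hk.memLp hn (Lp.memLp f)).toLp _
      map_add' := by
        intro f g
        refine Lp.ext ?_
        filter_upwards [MemLp.coeFn_toLp (hk.memLp hn (Lp.memLp (f + g))),
          Lp.coeFn_add ((hk.memLp hn (Lp.memLp f)).toLp _) ((hk.memLp hn (Lp.memLp g)).toLp _),
          MemLp.coeFn_toLp (hk.memLp hn (Lp.memLp f)), MemLp.coeFn_toLp (hk.memLp hn (Lp.memLp g)),
          hk.ae_integrable hn (Lp.memLp f), hk.ae_integrable hn (Lp.memLp g)]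
          with w h1 h2 h3 h4 h5 h6
        rw [h1, h2, Pi.add_apply, h3, h4, ← integral_add h5 h6]
        refine integral_congr_ae ?_
        filter_upwards [Lp.coeFn_add f g] with v hv
        rw [hv, Pi.add_apply, mul_add]
      map_smul' := by
        intro c f
        refine Lp.ext ?_
        filter_upwards [MemLp.coeFn_toLp (hk.memLp hn (Lp.memLp (c • f))),
          Lp.coeFn_smul c ((hk.memLp hn (Lp.memLp f)).toLp _),
          MemLp.coeFn_toLp (hk.memLp hn (Lp.memLp f))] with w h1 h2 h3
        rw [h1, RingHom.id_apply, h2, Pi.smul_apply, h3, ← integral_smul]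
        refine integral_congr_ae ?_
        filter_upwards [Lp.coeFn_smul c f] with v hv
        rw [hv, Pi.smul_apply, mul_smul_comm] }
  refine ⟨T₀.mkContinuous M.toReal fun f => ?_, fun f =>
    MemLp.coeFn_toLp (hk.memLp hn (Lp.memLp f))⟩
  change ‖(hk.memLp hn (Lp.memLp f)).toLp _‖ ≤ _
  rw [Lp.norm_toLp, Lp.norm_def, ← ENNReal.toReal_mul]
  exact ENNReal.toReal_mono (ENNReal.mul_ne_top hM (Lp.memLp f).eLpNorm_ne_top) (h f (Lp.memLp f))

end IsWeaklySingular

/-- Left multiplication by the conjugate paravector variable, as an isometry of `L²`. -/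
theorem exists_mul_star_para (n : ℕ) :
    ∃ W : Lp (Cl n) 2 (surf n) →L[ℝ] Lp (Cl n) 2 (surf n), ∀ f : Lp (Cl n) 2 (surf n),
      W f =ᵐ[surf n] fun w => star (para (w : Eu n)) * f w := by
  have hn : ∀ f : Sph n → Cl n, ∀ w : Sph n, ‖star (para (w : Eu n)) * f w‖ = ‖f w‖ := fun f w => by
    rw [norm_star_para_mul, norm_eq_of_mem_sphere, one_mul]
  have hm : ∀ f : Lp (Cl n) 2 (surf n),
      MemLp (fun w : Sph n => star (para (w : Eu n)) * f w) 2 (surf n) := fun f =>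
    (Lp.memLp f).congr_norm ((continuous_para.comp
      continuous_subtype_val).star.aestronglyMeasurable.mul (Lp.aestronglyMeasurable f))
      (Filter.Eventually.of_forall fun w => (hn f w).symm)
  let W₀ : Lp (Cl n) 2 (surf n) →ₗ[ℝ] Lp (Cl n) 2 (surf n) :=
    { toFun := fun f => (hm f).toLp _
      map_add' := by
        intro f g
        refine Lp.ext ?_
        filter_upwards [(hm (f + g)).coeFn_toLp, Lp.coeFn_add ((hm f).toLp _) ((hm g).toLp _),
          (hm f).coeFn_toLp, (hm g).coeFn_toLp, Lp.coeFn_add f g] with w h1 h2 h3 h4 h5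
        rw [h1, h2, Pi.add_apply, h3, h4, h5, Pi.add_apply, mul_add]
      map_smul' := by
        intro c f
        refine Lp.ext ?_
        filter_upwards [(hm (c • f)).coeFn_toLp, Lp.coeFn_smul c ((hm f).toLp _),
          (hm f).coeFn_toLp, Lp.coeFn_smul c f] with w h1 h2 h3 h4
        rw [h1, RingHom.id_apply, h2, Pi.smul_apply, h3, h4, Pi.smul_apply, mul_smul_comm] }
  refine ⟨W₀.mkContinuous 1 fun f => ?_, fun f => (hm f).coeFn_toLp⟩
  change ‖(hm f).toLp _‖ ≤ _
  rw [Lp.norm_toLp, Lp.norm_def, one_mul,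
    eLpNorm_congr_norm_ae (Filter.Eventually.of_forall (hn f))]

/-! ### Weak derivatives of transforms given on a dense set -/

section WeakDerivatives

variable {n : ℕ}

/-- Pairing with a fixed `a` turns a vector-valued integral into a continuous functional of `f`, so
identities between such integrals can be checked on a dense set. -/
theorem inner_integral_smul {φ : Sph n → ℝ} (hφ : Continuous φ) (a : Cl n)
    (f : Lp (Cl n) 2 (surf n)) : inner ℝ a (∫ w, φ w • f w ∂(surf n)) =
      inner ℝ (ContinuousMap.toLp 2 (surf n) ℝ
        (⟨fun w => φ w • a, hφ.smul continuous_const⟩ : C(Sph n, Cl n))) f := by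
  have hf : Integrable f (surf n) := (Lp.memLp f).integrable one_le_two
  obtain ⟨C, hC⟩ := isCompact_univ.exists_bound_of_continuousOn hφ.continuousOn
  have hi : Integrable (fun w => φ w • f w) (surf n) :=
    hf.bdd_smul C hφ.aestronglyMeasurable (Filter.Eventually.of_forall fun w => hC w trivial)
  rw [← integral_inner hi, L2.inner_def]
  refine integral_congr_ae ?_
  filter_upwards [ContinuousMap.coeFn_toLp (p := 2) (𝕜 := ℝ) (surf n)
    (⟨fun w => φ w • a, hφ.smul continuous_const⟩ : C(Sph n, Cl n))] with w hw
  rw [hw]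
  simp only [ContinuousMap.coe_mk]
  rw [inner_smul_left, inner_smul_right]
  rfl

theorem continuous_rot {φ : Eu n → ℝ} (hφ : ContDiff ℝ 1 φ) (i j : Fin (n + 1)) :
    Continuous fun w : Sph n => rot i j φ w := by
  have hd : Continuous fun w : Sph n => fderiv ℝ φ w :=
    (hφ.continuous_fderiv one_ne_zero).comp continuous_subtype_val
  unfold rot
  fun_prop

/-- The defining identity of a weak derivative is closed under `L²` limits, and on the dense data it
is classical integration by parts. -/
theorem hasWeakRot_of_denseRange {e : ClPoly n → Lp (Cl n) 2 (surf n)} (he : DenseRange e)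
    {T S : Lp (Cl n) 2 (surf n) →L[ℝ] Lp (Cl n) 2 (surf n)} {i j : Fin (n + 1)}
    (hT : ∀ u, T (e u) = ClPoly.evL n u) (hS : ∀ u, S (e u) = ClPoly.evL n (ClPoly.opRot i j u))
    (f : Lp (Cl n) 2 (surf n)) : HasWeakRot i j (T f) (S f) := by
  refine ⟨Lp.memLp _, fun φ hφ => ext_inner_left ℝ fun a => ?_⟩
  have hφ1 : ContDiff ℝ 1 φ := hφ.of_le (by simp)
  have hc : Continuous fun w : Sph n => φ w := hφ.continuous.comp continuous_subtype_val
  have hr := continuous_rot hφ1 i j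
  rw [inner_neg_right, inner_integral_smul hc, inner_integral_smul hr]
  refine congrFun (he.equalizer (g := fun f => inner ℝ _ (S f)) (h := fun f => -inner ℝ _ (T f))
    (by fun_prop) (by fun_prop) (funext fun u => ?_)) f
  simp only [Function.comp_apply]
  rw [hT, hS, ← inner_integral_smul hc, ← inner_integral_smul hr, ← inner_neg_right]
  congr 1
  have h1 : ∀ v : ClPoly n, ∀ ψ : Sph n → ℝ, ∫ w, ψ w • ClPoly.evL n v w ∂(surf n) =
      ∫ w : Sph n, ψ w • ClPoly.ev (w : Eu n) v ∂(surf n) := fun v ψ =>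
    integral_congr_ae ((ClPoly.coeFn_evL v).mono fun w hw => by simp only [hw])
  rw [h1, h1, integral_smul_ev_opRot hφ1]

theorem HasWeakRot.congr {i j : Fin (n + 1)} {u u' h : Sph n → Cl n} (hu : HasWeakRot i j u h)
    (e : u =ᵐ[surf n] u') : HasWeakRot i j u' h := by
  refine ⟨hu.1, fun φ hφ => (hu.2 φ hφ).trans ?_⟩
  congr 1
  exact integral_congr_ae (e.mono fun w hw => by simp only [hw])

theorem inner_evL_toLp {h : Sph n → Cl n} (hh : MemLp h 2 (surf n)) (p : MvPolynomial (Fin (n + 1)) ℝ)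
    (a : Cl n) : inner ℝ (ClPoly.evL n (p ⊗ₜ[ℝ] a)) (hh.toLp h) =
      inner ℝ a (∫ w : Sph n, MvPolynomial.aeval (w : Eu n) p • h w ∂(surf n)) := by
  have hc : Continuous fun w : Sph n => MvPolynomial.aeval (R := ℝ) (w : Eu n) p :=
    (ClPoly.contDiff_aeval p).continuous.comp continuous_subtype_val
  have h1 : ∫ w : Sph n, MvPolynomial.aeval (w : Eu n) p • h w ∂(surf n) =
      ∫ w : Sph n, MvPolynomial.aeval (w : Eu n) p • hh.toLp h w ∂(surf n) :=
    integral_congr_ae (hh.coeFn_toLp.mono fun w hw => by simp only [hw])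
  have h2 : ClPoly.evC n (p ⊗ₜ[ℝ] a) =
      ⟨fun w => MvPolynomial.aeval (w : Eu n) p • a, hc.smul continuous_const⟩ := by
    ext1 w
    exact ClPoly.ev_tmul _ _ _
  rw [h1, inner_integral_smul hc, ← h2]
  rfl

/-- Polynomials are admissible test functions and are dense in `L²`. Thus the choice made in
`weakRot` is harmless almost everywhere. -/
theorem HasWeakRot.ae_eq {i j : Fin (n + 1)} {u h h' : Sph n → Cl n} (hu : HasWeakRot i j u h)
    (hu' : HasWeakRot i j u h') : h =ᵐ[surf n] h' := by
  have key : ∀ v : ClPoly n, inner ℝ (ClPoly.evL n v) (hu.1.toLp h - hu'.1.toLp h') = 0 := by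
    intro v
    induction v using TensorProduct.induction_on with
    | zero => simp
    | tmul p a =>
      have hφ : ContDiff ℝ ∞ fun x : Eu n => MvPolynomial.aeval (R := ℝ) x p :=
        ClPoly.contDiff_aeval p
      rw [inner_sub_right, inner_evL_toLp, inner_evL_toLp, hu.2 _ hφ, hu'.2 _ hφ, sub_self]
    | add v v' hv hv' => rw [map_add, inner_add_left, hv, hv', add_zero]
  have h0 := ClPoly.denseRange_evL.eq_zero_of_inner_right ℝ key
  exact (MemLp.toLp_eq_toLp_iff hu.1 hu'.1).1 (sub_eq_zero.1 h0)

theorem HasWeakRot.weakRot_ae_eq {i j : Fin (n + 1)} {u h : Sph n → Cl n} (hu : HasWeakRot i j u h) :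
    weakRot i j u =ᵐ[surf n] h := by
  have hex : ∃ v, HasWeakRot i j u v := ⟨h, hu⟩
  rw [weakRot, dif_pos hex]
  exact hex.choose_spec.ae_eq hu

/-- Left multiplication by a constant on `L²`. -/
noncomputable def mulLp (a : Cl n) : Lp (Cl n) 2 (surf n) →L[ℝ] Lp (Cl n) 2 (surf n) :=
  (mulCl n a).compLpL 2 (surf n)

theorem coeFn_mulLp (a : Cl n) (f : Lp (Cl n) 2 (surf n)) :
    mulLp a f =ᵐ[surf n] fun w => a * f w :=
  ContinuousLinearMap.coeFn_compLpL _ _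

theorem exists_gammaBar_clm
    (S : Fin (n + 1) → Fin (n + 1) → Lp (Cl n) 2 (surf n) →L[ℝ] Lp (Cl n) 2 (surf n)) :
    ∃ G : Lp (Cl n) 2 (surf n) →L[ℝ] Lp (Cl n) 2 (surf n), ∀ f, G f =ᵐ[surf n] fun w =>
      -(∑ j : Fin n, clGen j * S 0 j.succ f w) -
        ∑ i : Fin n, ∑ j ∈ Finset.Ioi i, clGen i * clGen j * S i.succ j.succ f w := by
  refine ⟨-(∑ j : Fin n, (mulLp (clGen j)).comp (S 0 j.succ)) - ∑ i : Fin n, ∑ j ∈ Finset.Ioi i,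
    (mulLp (clGen i * clGen j)).comp (S i.succ j.succ), fun f => ?_⟩
  have h1 : ∀ᵐ w ∂(surf n), ∀ j : Fin n,
      mulLp (clGen j) (S 0 j.succ f) w = clGen j * S 0 j.succ f w :=
    ae_all_iff.2 fun j => coeFn_mulLp _ _
  have h2 : ∀ᵐ w ∂(surf n), ∀ i j : Fin n,
      mulLp (clGen i * clGen j) (S i.succ j.succ f) w = clGen i * clGen j * S i.succ j.succ f w :=
    ae_all_iff.2 fun i => ae_all_iff.2 fun j => coeFn_mulLp _ _
  have h3 : ∀ᵐ w ∂(surf n), ∀ i : Fin n,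
      (∑ j ∈ Finset.Ioi i, mulLp (clGen i * clGen j) (S i.succ j.succ f) :
        Lp (Cl n) 2 (surf n)) w =
        ∑ j ∈ Finset.Ioi i, mulLp (clGen i * clGen j) (S i.succ j.succ f) w := by
    refine ae_all_iff.2 fun i => (Lp.coeFn_finsetSum (Finset.Ioi i)
      (fun j => mulLp (clGen i * clGen j) (S i.succ j.succ f))).mono fun w hw => ?_
    rw [hw, Finset.sum_apply]
  simp only [sub_apply, neg_apply, sum_apply, ContinuousLinearMap.comp_apply]
  filter_upwards [h1, h2, h3,
    Lp.coeFn_sub (-∑ j : Fin n, mulLp (clGen j) (S 0 j.succ f))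
      (∑ i : Fin n, ∑ j ∈ Finset.Ioi i, mulLp (clGen i * clGen j) (S i.succ j.succ f)),
    Lp.coeFn_neg (∑ j : Fin n, mulLp (clGen j) (S 0 j.succ f)),
    Lp.coeFn_finsetSum Finset.univ (fun j : Fin n => mulLp (clGen j) (S 0 j.succ f)),
    Lp.coeFn_finsetSum Finset.univ (fun i : Fin n =>
      ∑ j ∈ Finset.Ioi i, mulLp (clGen i * clGen j) (S i.succ j.succ f))]
    with w h1 h2 h3 h4 h5 h6 h7
  rw [h4, Pi.sub_apply, h5, Pi.neg_apply, h6, h7, Finset.sum_apply, Finset.sum_apply]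
  simp only [h1, h2, h3]

/-- Here `e` stands for `w A` or `w (A + 1)` and `T` for its inverse. By the energy bound each map
`e u ↦ (x_i ∂_j - x_j ∂_i) u` extends to a bounded operator giving the weak derivatives of `T f`;
combining them extends `e u ↦ Ā u`. -/
theorem exists_diracBar_clm {e : ClPoly n →ₗ[ℝ] Lp (Cl n) 2 (surf n)} (he : DenseRange e)
    {T : Lp (Cl n) 2 (surf n) →L[ℝ] Lp (Cl n) 2 (surf n)} (hT : ∀ u, T (e u) = ClPoly.evL n u)
    (hb : ∀ i j u, ‖ClPoly.evL n (ClPoly.opRot i j u)‖ ≤ 3 * ‖e u‖) :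
    ∃ X : Lp (Cl n) 2 (surf n) →L[ℝ] Lp (Cl n) 2 (surf n),
      (∀ u, X (e u) = ClPoly.evL n (ClPoly.opABar n u)) ∧
      ∀ (f : Lp (Cl n) 2 (surf n)) (F : Sph n → Cl n), T f =ᵐ[surf n] F → MemSobolev F ∧
        diracBar F =ᵐ[surf n] fun w => star (para (w : Eu n)) * X f w := by
  set S : Fin (n + 1) → Fin (n + 1) → Lp (Cl n) 2 (surf n) →L[ℝ] Lp (Cl n) 2 (surf n) :=
    fun i j => (ClPoly.evL n ∘ₗ ClPoly.opRot i j).extendOfNorm e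
  have hS : ∀ i j u, S i j (e u) = ClPoly.evL n (ClPoly.opRot i j u) := fun i j u =>
    LinearMap.extendOfNorm_eq he ⟨3, hb i j⟩ u
  have hW : ∀ i j f, HasWeakRot i j (T f) (S i j f) := fun i j f =>
    hasWeakRot_of_denseRange he hT (hS i j) f
  obtain ⟨G, hG⟩ := exists_gammaBar_clm S
  refine ⟨G - ((n : ℝ) / 2) • T, fun u => ?_, fun f F hF => ⟨⟨(Lp.memLp (T f)).ae_eq hF,
    fun i j => ⟨_, (hW i j f).congr hF⟩⟩, ?_⟩⟩
  · have h1 : G (e u) = ClPoly.evL n (ClPoly.opGamBar u) := by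
      refine Lp.ext ?_
      have h2 : ∀ᵐ w ∂(surf n), ∀ i j,
          S i j (e u) w = ClPoly.ev (w : Eu n) (ClPoly.opRot i j u) := by
        refine ae_all_iff.2 fun i => ae_all_iff.2 fun j => ?_
        rw [hS]
        exact ClPoly.coeFn_evL _
      filter_upwards [hG (e u), h2, ClPoly.coeFn_evL (ClPoly.opGamBar u)] with w h3 h4 h5
      rw [h3, h5, ClPoly.ev_opGamBar]
      simp only [h4]
    rw [sub_apply, smul_apply, h1, hT, ClPoly.opABar_apply, map_sub, map_smul]
  · have h2 : ∀ᵐ w ∂(surf n), ∀ i j, weakRot i j F w = S i j f w :=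
      ae_all_iff.2 fun i => ae_all_iff.2 fun j => ((hW i j f).congr hF).weakRot_ae_eq
    filter_upwards [h2, hG f, hF, Lp.coeFn_sub (G f) (((n : ℝ) / 2) • T f),
      Lp.coeFn_smul ((n : ℝ) / 2) (T f)] with w h3 h4 h5 h6 h7
    rw [diracBar, gammaBar, sub_apply, smul_apply, h6, Pi.sub_apply, h7, Pi.smul_apply, h4, h5]
    simp only [h3]

end WeakDerivatives

/-! ### The two `Π`-operators on `L²` -/

section PiOperators

variable {n : ℕ}

namespace ClPoly

theorem clForm_opA (u v : ClPoly n) : clForm n (opA n u) v = clForm n u (opA n v) := by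
  rw [opA_apply, opA_apply, map_sub, map_sub, LinearMap.sub_apply, clForm_opGam, map_smul, map_smul,
    LinearMap.smul_apply]

theorem clForm_opABar (u v : ClPoly n) : clForm n (opABar n u) v = clForm n u (opABar n v) := by
  rw [opABar_apply, opABar_apply, map_sub, map_sub, LinearMap.sub_apply, clForm_opGamBar, map_smul,
    map_smul, LinearMap.smul_apply]

/-- Both Gamma operators express the same sum of squared rotation fields, and completing the square
with the shift `n / 2` turns `(n - 1) Γ - Γ²` into `-(A² + A)` plus a constant. -/
theorem opABar_opABar_add (u : ClPoly n) :
    opABar n (opABar n u) + opABar n u = opA n (opA n u) + opA n u := by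
  have h : ((n : ℝ) - 1) • opGamBar u - opGamBar (opGamBar u) =
      ((n : ℝ) - 1) • opGam u - opGam (opGam u) :=
    smul_right_injective _ (two_ne_zero (α := ℝ)) ((sum_opRot_opRot' u).symm.trans (sum_opRot_opRot u))
  have h2 : opGamBar (opGamBar u) = ((n : ℝ) - 1) • opGamBar u -
      (((n : ℝ) - 1) • opGam u - opGam (opGam u)) := by
    rw [← h]
    abel
  rw [opABar_apply, opABar_apply, opA_apply, opA_apply, map_sub, map_smul, map_sub, map_smul, h2]
  module

/-- The isometry identity on polynomial data: move `Ā` to the right, replace `Ā² + Ā` by `A² + A`,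
and move `A` back. -/
theorem clForm_opABar_add (u v : ClPoly n) : clForm n (opABar n u + u) (opABar n v) =
    clForm n (opPara (opA n u)) (opPara (opA n v + v)) := by
  rw [clForm_opPara, map_add, LinearMap.add_apply, clForm_opABar, ← map_add, opABar_opABar_add,
    map_add, ← clForm_opA, map_add, clForm_opA u v]

/-- `u ↦ w (Γ₀ - n / 2) u` as a map into `L²`. -/
noncomputable def diracL (n : ℕ) : ClPoly n →ₗ[ℝ] Lp (Cl n) 2 (surf n) :=
  evL n ∘ₗ opPara ∘ₗ opA n

theorem diracL_apply (u : ClPoly n) : diracL n u = evL n (opPara (opA n u)) := rfl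

/-- `u ↦ w (Γ₀ - n / 2 + 1) u` as a map into `L²`. -/
noncomputable def diracAddL (n : ℕ) : ClPoly n →ₗ[ℝ] Lp (Cl n) 2 (surf n) :=
  evL n ∘ₗ opPara ∘ₗ (opA n + LinearMap.id)

theorem diracAddL_apply (u : ClPoly n) : diracAddL n u = evL n (opPara (opA n u + u)) := rfl

end ClPoly

open ClPoly

theorem opT_congr {Ω : Set (Sph n)} {f g : Sph n → Cl n} (h : f =ᵐ[(surf n).restrict Ω] g) :
    opT Ω f = opT Ω g := by
  funext w
  exact integral_congr_ae (h.mono fun v hv => by simp only [hv])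

theorem opTPlus_congr {Ω : Set (Sph n)} {f g : Sph n → Cl n} (h : f =ᵐ[(surf n).restrict Ω] g) :
    opTPlus Ω f = opTPlus Ω g := by
  funext w
  exact integral_congr_ae (h.mono fun v hv => by simp only [hv])

theorem setIntegral_mul_indicator {Ω : Set (Sph n)} (hΩ : MeasurableSet Ω) (k f : Sph n → Cl n) :
    ∫ v in Ω, k v * f v ∂(surf n) = ∫ v in Set.univ, k v * Ω.indicator f v ∂(surf n) := by
  rw [← integral_indicator hΩ, setIntegral_univ]
  simp only [← Set.indicator_mul_right]

theorem opT_eq_univ {Ω : Set (Sph n)} (hΩ : MeasurableSet Ω) {f : Sph n → Cl n}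
    (hf : MemLp (Ω.indicator f) 2 (surf n)) : opT Ω f = opT Set.univ (hf.toLp _) := by
  rw [opT_congr (g := Ω.indicator f) (Ω := Set.univ) (by simpa using hf.coeFn_toLp)]
  funext w
  exact setIntegral_mul_indicator hΩ _ _

theorem opTPlus_eq_univ {Ω : Set (Sph n)} (hΩ : MeasurableSet Ω) {f : Sph n → Cl n}
    (hf : MemLp (Ω.indicator f) 2 (surf n)) : opTPlus Ω f = opTPlus Set.univ (hf.toLp _) := by
  rw [opTPlus_congr (g := Ω.indicator f) (Ω := Set.univ) (by simpa using hf.coeFn_toLp)]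
  funext w
  exact setIntegral_mul_indicator hΩ _ _

theorem IsWeaklySingular.ae_integrableOn {k : Sph n → Sph n → Cl n} (hk : IsWeaklySingular k)
    (hn : 0 < n) {Ω : Set (Sph n)} (hΩ : MeasurableSet Ω) {f : Sph n → Cl n}
    (hf : MemLp (Ω.indicator f) 2 (surf n)) :
    ∀ᵐ w ∂(surf n), IntegrableOn (fun v => k w v * f v) Ω (surf n) := by
  filter_upwards [hk.ae_integrable hn hf] with w hw
  rw [← integrable_indicator_iff hΩ]
  simpa only [← Set.indicator_mul_right] using hw

/-- `T_Ω` for the whole sphere and the conjugate Dirac operator applied to it, on `L²`. -/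
theorem exists_opT_clm (hn : 3 ≤ n) :
    ∃ T X : Lp (Cl n) 2 (surf n) →L[ℝ] Lp (Cl n) 2 (surf n),
      (∀ u, T (diracL n u) = evL n u) ∧ (∀ u, X (diracL n u) = evL n (opABar n u)) ∧
      ∀ f : Lp (Cl n) 2 (surf n), T f =ᵐ[surf n] opT Set.univ f ∧ MemSobolev (opT Set.univ f) ∧
        diracBar (opT Set.univ f) =ᵐ[surf n] fun w => star (para (w : Eu n)) * X f w := by
  obtain ⟨T, hT⟩ := (isWeaklySingular_kerG (n := n) (by omega)).exists_clm (by omega)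
  have hT' : ∀ f : Lp (Cl n) 2 (surf n), T f =ᵐ[surf n] opT Set.univ f := fun f =>
    (hT f).trans (Filter.Eventually.of_forall fun w => by rw [opT, setIntegral_univ])
  have hTe : ∀ u, T (diracL n u) = evL n u := fun u => by
    refine Lp.ext ((hT' _).trans ?_)
    rw [opT_congr (g := fun v : Sph n => ev (v : Eu n) (opPara (opA n u)))
      (by rw [Measure.restrict_univ]; exact coeFn_evL (opPara (opA n u)))]
    filter_upwards [coeFn_evL u] with w hw
    rw [hw, opT_opPara_opA hn]
  obtain ⟨X, hX, hD⟩ := exists_diracBar_clm (e := diracL n) (denseRange_evL_opPara_opA hn) hTe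
    fun i j u => (norm_opRot_le_opA hn i j u).trans_eq (by rw [diracL_apply, norm_evL_opPara])
  exact ⟨T, X, hTe, hX, fun f => ⟨hT' f, hD f _ (hT' f)⟩⟩

theorem exists_opTPlus_clm (hn : 3 ≤ n) :
    ∃ T X : Lp (Cl n) 2 (surf n) →L[ℝ] Lp (Cl n) 2 (surf n),
      (∀ u, X (diracAddL n u) = evL n (opABar n u)) ∧
      ∀ f : Lp (Cl n) 2 (surf n), T f =ᵐ[surf n] opTPlus Set.univ f ∧
        MemSobolev (opTPlus Set.univ f) ∧
        diracBar (opTPlus Set.univ f) =ᵐ[surf n] fun w => star (para (w : Eu n)) * X f w := by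
  obtain ⟨T, hT⟩ := (isWeaklySingular_kerPlus hn).exists_clm (by omega)
  have hT' : ∀ f : Lp (Cl n) 2 (surf n), T f =ᵐ[surf n] opTPlus Set.univ f := fun f =>
    (hT f).trans (Filter.Eventually.of_forall fun w => by rw [opTPlus, setIntegral_univ])
  have hTe : ∀ u, T (diracAddL n u) = evL n u := fun u => by
    refine Lp.ext ((hT' _).trans ?_)
    rw [opTPlus_congr (g := fun v : Sph n => ev (v : Eu n) (opPara (opA n u + u)))
      (by rw [Measure.restrict_univ]; exact coeFn_evL (opPara (opA n u + u)))]
    filter_upwards [coeFn_evL u] with w hw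
    rw [hw, opTPlus_opPara_opA_add hn]
  obtain ⟨X, hX, hD⟩ := exists_diracBar_clm (e := diracAddL n) (denseRange_evL_opPara_opA_add hn) hTe
    fun i j u => (norm_opRot_le_opA_add hn i j u).trans_eq (by rw [diracAddL_apply, norm_evL_opPara])
  exact ⟨T, X, hX, fun f => ⟨hT' f, hD f _ (hT' f)⟩⟩

/-! ### The `Cl_n`-valued pairing on `L²` and its extension by density. -/

theorem integrable_star_mul (f g : Lp (Cl n) 2 (surf n)) :
    Integrable (fun w => star (f w) * g w) (surf n) := by
  have h : Integrable (fun w => ‖f w‖ * ‖g w‖) (surf n) :=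
    (Lp.memLp f).norm.integrable_mul (Lp.memLp g).norm
  refine (h.const_mul (‖mulCl n‖ * ‖starCl n‖)).mono'
    ((Lp.aestronglyMeasurable f).star.mul (Lp.aestronglyMeasurable g))
    (Filter.Eventually.of_forall fun w => ?_)
  calc _ ≤ _ := norm_mul_le_Cl _ _
    _ ≤ ‖mulCl n‖ * (‖starCl n‖ * ‖f w‖) * ‖g w‖ := by
      gcongr
      exact norm_star_le_Cl _
    _ = _ := by ring

theorem inner_integral_star_mul (f g : Lp (Cl n) 2 (surf n)) (a : Cl n) :
    inner ℝ a (∫ w, star (f w) * g w ∂(surf n)) =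
      inner ℝ (((mulCl n).flip a).compLpL 2 (surf n) f) g := by
  rw [← integral_inner (integrable_star_mul f g), L2.inner_def]
  refine integral_congr_ae ?_
  filter_upwards [ContinuousLinearMap.coeFn_compLpL ((mulCl n).flip a) f] with w hw
  rw [hw, ContinuousLinearMap.flip_apply, mulCl_apply, inner_mul_left_Cl]

theorem scalarPart_integral_star_mul (f g : Lp (Cl n) 2 (surf n)) :
    scalarPart n (∫ w, star (f w) * g w ∂(surf n)) = inner ℝ f g := by
  rw [← (scalarPart n).integral_comp_comm (integrable_star_mul f g), L2.inner_def]
  simp only [scalarPart_star_mul]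

theorem integral_star_evL_mul_evL (u v : ClPoly n) :
    ∫ w, star (evL n u w) * evL n v w ∂(surf n) = clForm n u v := by
  rw [clForm_apply]
  refine integral_congr_ae ?_
  filter_upwards [coeFn_evL u, coeFn_evL v] with w hu hv
  rw [hu, hv]

/-- Pairing with a constant `a` moves it onto `f` as a right multiplication and leaves a real inner
product, continuous in each variable; density is then used once per variable. -/
theorem integral_star_mul_eq_of_denseRange {e e' : ClPoly n → Lp (Cl n) 2 (surf n)}
    (he : DenseRange e) (he' : DenseRange e')
    {Z X : Lp (Cl n) 2 (surf n) →L[ℝ] Lp (Cl n) 2 (surf n)}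
    (h : ∀ u v, ∫ w, star (Z (e u) w) * X (e' v) w ∂(surf n) =
      ∫ w, star (e u w) * e' v w ∂(surf n)) (f g : Lp (Cl n) 2 (surf n)) :
    ∫ w, star (Z f w) * X g w ∂(surf n) = ∫ w, star (f w) * g w ∂(surf n) := by
  refine ext_inner_left ℝ fun a => ?_
  rw [inner_integral_star_mul, inner_integral_star_mul]
  have h1 : ∀ u, inner ℝ (((mulCl n).flip a).compLpL 2 (surf n) (Z (e u))) (X g) =
      inner ℝ (((mulCl n).flip a).compLpL 2 (surf n) (e u)) g := by
    intro u
    refine congrFun (he'.equalizer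
      (g := fun g => inner ℝ (((mulCl n).flip a).compLpL 2 (surf n) (Z (e u))) (X g))
      (h := fun g => inner ℝ (((mulCl n).flip a).compLpL 2 (surf n) (e u)) g)
      (by fun_prop) (by fun_prop) (funext fun v => ?_)) g
    simp only [Function.comp_apply]
    rw [← inner_integral_star_mul, ← inner_integral_star_mul, h]
  exact congrFun (he.equalizer
    (g := fun f => inner ℝ (((mulCl n).flip a).compLpL 2 (surf n) (Z f)) (X g))
    (h := fun f => inner ℝ (((mulCl n).flip a).compLpL 2 (surf n) f) g)
    (by fun_prop) (by fun_prop) (funext h1)) f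

end PiOperators

/-- Taking `f = g` gives `‖g‖ ≤ ‖P‖ ‖Q g‖`, so `Q` is injective with closed range, hence onto. The
hypothesis also says that `P` inverts the adjoint of `Q`, which yields preimages under `P`. -/
theorem exists_equiv_of_inner_eq {H : Type*} [NormedAddCommGroup H] [InnerProductSpace ℝ H]
    [CompleteSpace H] {P Q : H →L[ℝ] H} (h : ∀ f g, inner ℝ (P f) (Q g) = inner ℝ f g)
    (hQ : DenseRange Q) : (∃ P' : H ≃L[ℝ] H, ⇑P' = P) ∧ ∃ Q' : H ≃L[ℝ] H, ⇑Q' = Q := by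
  have hb : ∀ g, ‖g‖ ≤ (‖P‖₊ : ℝ) * ‖Q g‖ := by
    intro g
    rcases eq_or_lt_of_le (norm_nonneg g) with h0 | h0
    · rw [← h0]
      positivity
    · have h1 := real_inner_le_norm (P g) (Q g)
      rw [h, real_inner_self_eq_norm_sq] at h1
      have h2 := mul_le_mul_of_nonneg_right (P.le_opNorm g) (norm_nonneg (Q g))
      refine le_of_mul_le_mul_left ?_ h0
      rw [coe_nnnorm]
      nlinarith
  have ha := Q.antilipschitz_of_bound hb
  have hsurj : Function.Surjective Q := by
    rw [← Set.range_eq_univ, ← (ha.isClosed_range Q.uniformContinuous).closure_eq]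
    exact hQ.closure_range
  have hPinj : ∀ f, P f = 0 → f = 0 := fun f hf => by
    rw [← inner_self_eq_zero (𝕜 := ℝ), ← h, hf, inner_zero_left]
  have hPsurj : Function.Surjective P := fun y => by
    refine ⟨ContinuousLinearMap.adjoint Q y, ext_inner_right ℝ fun z => ?_⟩
    obtain ⟨g, rfl⟩ := hsurj z
    rw [h, ContinuousLinearMap.adjoint_inner_left]
  exact ⟨⟨ContinuousLinearEquiv.ofBijective P (LinearMap.ker_eq_bot'.2 hPinj)
    (LinearMap.range_eq_top.2 hPsurj), ContinuousLinearEquiv.coeFn_ofBijective _ _ _⟩,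
    ⟨ContinuousLinearEquiv.ofBijective Q (LinearMap.ker_eq_bot.2 ha.injective)
    (LinearMap.range_eq_top.2 hsurj), ContinuousLinearEquiv.coeFn_ofBijective _ _ _⟩⟩

theorem mainTheorem2 (n : ℕ) (hn : 3 ≤ n) :
    (∀ Ω : Set (Sph n), MeasurableSet Ω → ∀ f g : Sph n → Cl n,
      MemLp f 2 ((surf n).restrict Ω) → MemLp g 2 ((surf n).restrict Ω) →
        (∀ᵐ w ∂(surf n), IntegrableOn (fun v => kerG w v * f v) Ω (surf n)) ∧
        (∀ᵐ w ∂(surf n), IntegrableOn (fun v => kerPlus w v * g v) Ω (surf n)) ∧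
        MemSobolev (opT Ω f) ∧ MemSobolev (opTPlus Ω g) ∧
        MemLp (piZero Ω f) 2 (surf n) ∧ MemLp (piPlus Ω g) 2 (surf n) ∧
        clInner Set.univ (piZero Ω f) (piPlus Ω g) = clInner Ω f g) ∧
    (∃ P : Lp (Cl n) 2 (surf n) ≃L[ℝ] Lp (Cl n) 2 (surf n),
      ∀ f : Lp (Cl n) 2 (surf n), P f =ᵐ[surf n] piZero Set.univ f) ∧
    (∃ P : Lp (Cl n) 2 (surf n) ≃L[ℝ] Lp (Cl n) 2 (surf n),
      ∀ f : Lp (Cl n) 2 (surf n), P f =ᵐ[surf n] piPlus Set.univ f) := by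
  obtain ⟨T, X, hT, hX, hTX⟩ := exists_opT_clm hn
  obtain ⟨T', X', hX', hTX'⟩ := exists_opTPlus_clm hn
  obtain ⟨W, hW⟩ := exists_mul_star_para n
  -- On `L²` the operators factor as `Π_{s,0} = W (X + T)` and `Π_s⁺ = W X'`, with `W`
  -- multiplication by `w̄`, which drops out of the pairing.
  have h0 : ∀ f : Lp (Cl n) 2 (surf n), W ((X + T) f) =ᵐ[surf n] piZero Set.univ f := fun f => by
    filter_upwards [hW ((X + T) f), (hTX f).1, (hTX f).2.2, Lp.coeFn_add (X f) (T f)]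
      with w h1 h2 h3 h4
    rw [h1, piZero, h3, ← h2, add_apply, h4, Pi.add_apply, mul_add]
  have h1 : ∀ f : Lp (Cl n) 2 (surf n), W (X' f) =ᵐ[surf n] piPlus Set.univ f := fun f =>
    (hW (X' f)).trans (hTX' f).2.2.symm
  have hWW : ∀ f g : Lp (Cl n) 2 (surf n), ∫ w, star (W f w) * W g w ∂(surf n) =
      ∫ w, star (f w) * g w ∂(surf n) := fun f g => by
    refine integral_congr_ae ?_
    filter_upwards [hW f, hW g] with w h2 h3
    rw [h2, h3, star_mul, star_star, mul_assoc, ← mul_assoc (para _), para_mul_star_para, one_mul]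
  have key : ∀ f g : Lp (Cl n) 2 (surf n), ∫ w, star (W ((X + T) f) w) * W (X' g) w ∂(surf n) =
      ∫ w, star (f w) * g w ∂(surf n) := fun f g => by
    rw [hWW]
    refine integral_star_mul_eq_of_denseRange (e := ClPoly.diracL n) (e' := ClPoly.diracAddL n)
      (ClPoly.denseRange_evL_opPara_opA hn) (ClPoly.denseRange_evL_opPara_opA_add hn)
      (fun u v => ?_) f g
    rw [add_apply, hX, hT, hX', ← map_add, ClPoly.diracL_apply, ClPoly.diracAddL_apply,
      integral_star_evL_mul_evL, integral_star_evL_mul_evL, ClPoly.clForm_opABar_add]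
  refine ⟨fun Ω hΩ f g hf hg => ?_, ?_⟩
  · have hf' := (memLp_indicator_iff_restrict hΩ).2 hf
    have hg' := (memLp_indicator_iff_restrict hΩ).2 hg
    have ef : piZero Ω f = piZero Set.univ (hf'.toLp _) := by
      funext w
      rw [piZero, piZero, opT_eq_univ hΩ hf']
    have eg : piPlus Ω g = piPlus Set.univ (hg'.toLp _) := by
      funext w
      rw [piPlus, piPlus, opTPlus_eq_univ hΩ hg']
    refine ⟨(isWeaklySingular_kerG (by omega)).ae_integrableOn (by omega) hΩ hf',
      (isWeaklySingular_kerPlus hn).ae_integrableOn (by omega) hΩ hg', ?_, ?_, ?_, ?_, ?_⟩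
    · rw [opT_eq_univ hΩ hf']
      exact (hTX _).2.1
    · rw [opTPlus_eq_univ hΩ hg']
      exact (hTX' _).2.1
    · rw [ef]
      exact (Lp.memLp _).ae_eq (h0 _)
    · rw [eg]
      exact (Lp.memLp _).ae_eq (h1 _)
    · rw [ef, eg, clInner, clInner, setIntegral_univ, ← integral_indicator hΩ]
      refine Eq.trans (integral_congr_ae ?_) ((key (hf'.toLp _) (hg'.toLp _)).trans
        (integral_congr_ae ?_))
      · filter_upwards [h0 (hf'.toLp _), h1 (hg'.toLp _)] with w h2 h3
        rw [h2, h3]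
      · filter_upwards [hf'.coeFn_toLp, hg'.coeFn_toLp] with w h2 h3
        rw [h2, h3]
        by_cases hw : w ∈ Ω <;> simp [hw]
  · have hin : ∀ f g : Lp (Cl n) 2 (surf n), inner ℝ ((W.comp (X + T)) f) ((W.comp X') g) =
        inner ℝ f g := fun f g => by
      rw [← scalarPart_integral_star_mul, ← scalarPart_integral_star_mul]
      exact congrArg _ (key f g)
    have hWp : ∀ u : ClPoly n, W (ClPoly.evL n (ClPoly.opPara u)) = ClPoly.evL n u := fun u => by
      refine Lp.ext ?_
      filter_upwards [hW (ClPoly.evL n (ClPoly.opPara u)), ClPoly.coeFn_evL u,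
        ClPoly.coeFn_evL (ClPoly.opPara u)] with w h2 h3 h4
      rw [h2, h3, h4, ClPoly.ev_opPara, ← mul_assoc, star_para_mul_para, one_mul]
    have hd : DenseRange (W.comp X') := by
      refine ClPoly.denseRange_evL.mono ?_
      rintro _ ⟨f, rfl⟩
      obtain ⟨u, hu⟩ := ClPoly.exists_evL_opA hn f
      -- `X'` sends the `w (A + 1)` image of `w u` to `Ā (w u) = -w A u`; then `W` cancels `w`, and
      -- `u` was chosen so that `A u` is the given polynomial on the sphere.
      refine ⟨-ClPoly.diracAddL n (ClPoly.opPara u), ?_⟩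
      rw [map_neg, ContinuousLinearMap.comp_apply, hX', ClPoly.opABar_opPara, map_neg, map_neg,
        neg_neg, hWp, hu]
    obtain ⟨⟨P, hP⟩, ⟨Q, hQ⟩⟩ := exists_equiv_of_inner_eq hin hd
    refine ⟨⟨P, fun f => ?_⟩, ⟨Q, fun f => ?_⟩⟩
    · rw [hP]
      exact h0 f
    · rw [hQ]
      exact h1 f
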